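/- Let $b\in\mathbb{R}$, $\varphi(\xi)=e^{-|\xi|}$, and let $\varphi'(\xi)=-\operatorname{sgn}(\xi)e^{-|\xi|}$ be its piecewise derivative. On the complex Hilbert space $L^2(\mathbb{R})$ consider the operator $$L=(1-\varphi^2)\partial_\xi+(4-b)\varphi\varphi'+Q,\qquad Qv=(b-3)\big[\varphi*((\varphi^2)'v)-2\,\varphi'*(\varphi^2v)\big],$$ with domain $\mathrm{Dom}(L)=\{v\in L^2(\mathbb{R}):(1-\varphi^2)v'\in L^2(\mathbb{R})\}$, where $v'$ is the distributional derivative and $*$ denotes convolution. For an operator $A$ with domain $D\subset L^2(\mathbb{R})$, $\sigma(A)$ is the set of $\lambda\in\mathbb{C}$ for which $A-\lambda:D\to L^2(\mathbb{R})$ is not a bijection with bounded inverse; $\sigma_p(A)$ (point spectrum) is the set of eigenvalues; $\sigma_r(A)$ (residual spectrum) is the set of $\lambda$ for which $A-\lambda$ is injective with non-dense range; $\sigma_c(A)$ (continuous spectrum) is the set of $\lambda\in\sigma(A)$ for which $A-\lambda$ is injective with dense range. Put $E_b=\{\pm i\sqrt{(b-2)(b-4)}\}$ if $b\le 2$ or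 $b\ge 4$, and $E_b=\emptyset$ if $2<b<4$. Theorem. For every $b\in\mathbb{R}$: 1. $\sigma(L)=\{\lambda\in\mathbb{C}:|\mathrm{Re}\,\lambda|\le|5-b|\}$. 2. If $b<5$, then $\{\lambda:0<|\mathrm{Re}\,\lambda|<5-b\}\subset\sigma_p(L)$. 3. $\sigma_r(L)=\{\lambda:0<|\mathrm{Re}\,\lambda|<b-5\}$; in particular there is residual spectrum if and only if $b>5$. 4. $\sigma_c(L)=\{\lambda:\mathrm{Re}\,\lambda=0\ \text{or}\ |\mathrm{Re}\,\lambda|=|5-b|\}\setminus E_b$, and $E_b\subset\sigma_p(L)$. -/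

import Mathlib

open MeasureTheory
open scoped ContDiff Convolution

noncomputable section

/-! ## Spectra of unbounded operators -/

namespace UnboundedSpectrum

variable {X : Type*} [NormedAddCommGroup X] [NormedSpace ℂ X]

/-- The linear map `A - λ : dom A → X`. -/
def shift (A : X →ₗ.[ℂ] X) (z : ℂ) : A.domain →ₗ[ℂ] X :=
  A.toFun - z • A.domain.subtype

/-- The resolvent set: `A - λ : dom A → X` is a bijection with bounded inverse. -/
def resolventSet (A : X →ₗ.[ℂ] X) : Set ℂ :=
  {z | Function.Bijective (shift A z) ∧ ∃ C : ℝ, ∀ v : A.domain, ‖(v : X)‖ ≤ C * ‖shift A z v‖}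

/-- The spectrum: the complement of the resolvent set. -/
def spectrum (A : X →ₗ.[ℂ] X) : Set ℂ := (resolventSet A)ᶜ

/-- The point spectrum: the set of eigenvalues. -/
def pointSpectrum (A : X →ₗ.[ℂ] X) : Set ℂ :=
  {z | ∃ v : A.domain, (v : X) ≠ 0 ∧ A v = z • (v : X)}

/-- The residual spectrum: `A - λ` is injective and its range is not dense. -/
def residualSpectrum (A : X →ₗ.[ℂ] X) : Set ℂ :=
  {z | Function.Injective (shift A z) ∧ ¬ DenseRange (shift A z)}

/-- The continuous spectrum: `λ` is in the spectrum, `A - λ` is injective and its range is dense. -/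
def continuousSpectrum (A : X →ₗ.[ℂ] X) : Set ℂ :=
  {z | z ∈ spectrum A ∧ Function.Injective (shift A z) ∧ DenseRange (shift A z)}

end UnboundedSpectrum

/-! ## The linearized operator at the peakon -/

namespace Peakon

/-- The complex Hilbert space `L²(ℝ)`. -/
abbrev H : Type := Lp ℂ 2 (volume : Measure ℝ)

/-- The peakon `φ(ξ) = e^{-|ξ|}`. -/
def phi (ξ : ℝ) : ℝ := Real.exp (-|ξ|)

/-- The piecewise continuous derivative `φ'(ξ) = -sgn(ξ) e^{-|ξ|}`. -/
def phi' (ξ : ℝ) : ℝ := -Real.sign ξ * Real.exp (-|ξ|)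

theorem hasDerivAt_phi {ξ : ℝ} (hξ : ξ ≠ 0) : HasDerivAt phi (phi' ξ) ξ := by
  rcases lt_or_gt_of_ne hξ with h | h
  · have h1 : HasDerivAt (fun x : ℝ => Real.exp x) (Real.exp ξ) ξ := Real.hasDerivAt_exp ξ
    have h2 : phi' ξ = Real.exp ξ := by simp [phi', Real.sign_of_neg h, abs_of_neg h]
    rw [h2]
    refine h1.congr_of_eventuallyEq ?_
    filter_upwards [Iio_mem_nhds h] with x hx
    simp [phi, abs_of_neg (show x < 0 from hx)]
  · have h1 : HasDerivAt (fun x : ℝ => Real.exp (-x)) (Real.exp (-ξ) * (-1)) ξ :=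
      (hasDerivAt_neg ξ).exp
    have h2 : phi' ξ = Real.exp (-ξ) * (-1) := by simp [phi', Real.sign_of_pos h, abs_of_pos h]
    rw [h2]
    refine h1.congr_of_eventuallyEq ?_
    filter_upwards [Ioi_mem_nhds h] with x hx
    simp [phi, abs_of_pos (show 0 < x from hx)]

theorem measurable_phi : Measurable phi := by
  unfold phi; fun_prop

theorem measurable_phi' : Measurable phi' := by
  have h : Measurable Real.sign := by
    unfold Real.sign
    exact Measurable.ite measurableSet_Iio measurable_const
      (Measurable.ite measurableSet_Ioi measurable_const measurable_const)
  unfold phi'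
  fun_prop

theorem phi_nonneg (ξ : ℝ) : 0 ≤ phi ξ := (Real.exp_pos _).le

theorem phi_le_one (ξ : ℝ) : phi ξ ≤ 1 := by simp [phi]

theorem abs_phi'_le (ξ : ℝ) : |phi' ξ| ≤ phi ξ := by
  rcases Real.sign_apply_eq ξ with h | h | h <;> simp [phi', phi, h, Real.exp_nonneg]

theorem phi_mul_le (ξ η : ℝ) : phi (ξ - η) * phi η ≤ phi ξ := by
  unfold phi
  rw [← Real.exp_add, Real.exp_le_exp]
  have := abs_add_le (ξ - η) η
  rw [sub_add_cancel] at this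
  linarith

theorem integrable_phi : Integrable phi (volume : Measure ℝ) := by
  rw [← integrableOn_univ, ← Set.Iic_union_Ioi (a := (0 : ℝ))]
  refine IntegrableOn.union ?_ ?_
  · refine (integrableOn_exp_Iic 0).congr_fun (fun x hx => ?_) measurableSet_Iic
    simp [phi, abs_of_nonpos (show x ≤ 0 from hx)]
  · refine (exp_neg_integrableOn_Ioi 0 one_pos).congr_fun (fun x hx => ?_) measurableSet_Ioi
    simp [phi, abs_of_pos (show 0 < x from hx)]

theorem memLp_phi : MemLp phi 2 (volume : Measure ℝ) := by
  rw [memLp_two_iff_integrable_sq measurable_phi.aestronglyMeasurable]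
  refine integrable_phi.mono' (measurable_phi.pow_const 2).aestronglyMeasurable
    (Filter.Eventually.of_forall fun x => ?_)
  rw [Real.norm_of_nonneg (sq_nonneg _)]
  nlinarith [phi_nonneg x, phi_le_one x]

theorem integrable_smul_of_memLp {f : ℝ → ℝ} {v : ℝ → ℂ} (hf : MemLp f 2 (volume : Measure ℝ))
    (hv : MemLp v 2 (volume : Measure ℝ)) : Integrable (fun x => f x • v x) volume :=
  memLp_one_iff_integrable.mp (hv.smul hf)

/-- `w = (1 - φ²) v'`, where `v'` is the distributional derivative of `v`: for every test function
`ψ`, `∫ w ψ = -∫ v ((1 - φ²) ψ)'`, where `((1 - φ²) ψ)' = (1 - φ²) ψ' - 2 φ φ' ψ` almost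
everywhere. -/
def IsWeightedDeriv (v w : ℝ → ℂ) : Prop :=
  ∀ ψ : ℝ → ℝ, ContDiff ℝ ∞ ψ → HasCompactSupport ψ →
    ∫ ξ, ψ ξ • w ξ =
      -∫ ξ, ((1 - phi ξ ^ 2) * deriv ψ ξ - 2 * phi ξ * phi' ξ * ψ ξ) • v ξ

theorem memLp_test {ψ : ℝ → ℝ} (hψ : ContDiff ℝ ∞ ψ) (hc : HasCompactSupport ψ) :
    MemLp ψ 2 (volume : Measure ℝ) :=
  hψ.continuous.memLp_of_hasCompactSupport hc

theorem memLp_weight_test {ψ : ℝ → ℝ} (hψ : ContDiff ℝ ∞ ψ) (hc : HasCompactSupport ψ) :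
    MemLp (fun ξ => (1 - phi ξ ^ 2) * deriv ψ ξ - 2 * phi ξ * phi' ξ * ψ ξ) 2
      (volume : Measure ℝ) := by
  have hd : MemLp (deriv ψ) 2 (volume : Measure ℝ) :=
    (hψ.continuous_deriv (by simp)).memLp_of_hasCompactSupport hc.deriv
  refine MemLp.sub (hd.of_le_mul (c := 1) ?_ (Filter.Eventually.of_forall fun x => ?_))
    ((memLp_test hψ hc).of_le_mul (c := 2) ?_ (Filter.Eventually.of_forall fun x => ?_))
  · exact ((measurable_const.sub (measurable_phi.pow_const 2)).mul
      (measurable_deriv ψ)).aestronglyMeasurable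
  · rw [norm_mul]
    refine mul_le_mul_of_nonneg_right ?_ (norm_nonneg _)
    rw [Real.norm_eq_abs, abs_le]
    constructor <;> nlinarith [phi_nonneg x, phi_le_one x]
  · exact (((measurable_const.mul measurable_phi).mul measurable_phi').mul
      hψ.continuous.measurable).aestronglyMeasurable
  · rw [norm_mul]
    refine mul_le_mul_of_nonneg_right ?_ (norm_nonneg _)
    rw [Real.norm_eq_abs, abs_mul, abs_mul, abs_two, abs_of_nonneg (phi_nonneg x)]
    have := abs_phi'_le x
    nlinarith [phi_nonneg x, phi_le_one x, abs_nonneg (phi' x)]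

theorem IsWeightedDeriv.unique {v w₁ w₂ : ℝ → ℂ} (h₁ : IsWeightedDeriv v w₁)
    (h₂ : IsWeightedDeriv v w₂) (hw₁ : MemLp w₁ 2 (volume : Measure ℝ))
    (hw₂ : MemLp w₂ 2 (volume : Measure ℝ)) : w₁ =ᵐ[volume] w₂ := by
  have h : ∀ᵐ x ∂(volume : Measure ℝ), (w₁ - w₂) x = 0 := by
    refine ae_eq_zero_of_integral_contDiff_smul_eq_zero
      ((hw₁.sub hw₂).locallyIntegrable (by norm_num)) ?_
    intro ψ hψ hc
    have i₁ : Integrable (fun x => ψ x • w₁ x) (volume : Measure ℝ) :=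
      integrable_smul_of_memLp (memLp_test hψ hc) hw₁
    have i₂ : Integrable (fun x => ψ x • w₂ x) (volume : Measure ℝ) :=
      integrable_smul_of_memLp (memLp_test hψ hc) hw₂
    simp only [Pi.sub_apply, smul_sub]
    rw [integral_sub i₁ i₂, h₁ ψ hψ hc, h₂ ψ hψ hc, sub_self]
  filter_upwards [h] with x hx
  exact sub_eq_zero.mp hx

theorem IsWeightedDeriv.congr {v v' w w' : ℝ → ℂ} (h : IsWeightedDeriv v w)
    (hv : v =ᵐ[volume] v') (hw : w =ᵐ[volume] w') : IsWeightedDeriv v' w' := by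
  intro ψ hψ hc
  have e₁ : ∫ ξ, ψ ξ • w' ξ = ∫ ξ, ψ ξ • w ξ :=
    integral_congr_ae (by filter_upwards [hw] with x hx; rw [hx])
  rw [e₁, h ψ hψ hc]
  congr 1
  exact integral_congr_ae (by filter_upwards [hv] with x hx; rw [hx])

theorem IsWeightedDeriv.add {v₁ v₂ w₁ w₂ : H} (h₁ : IsWeightedDeriv v₁ w₁)
    (h₂ : IsWeightedDeriv v₂ w₂) : IsWeightedDeriv (v₁ + v₂ : H) (w₁ + w₂ : H) := by
  refine IsWeightedDeriv.congr (v := ⇑v₁ + ⇑v₂) (w := ⇑w₁ + ⇑w₂) ?_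
    (Lp.coeFn_add v₁ v₂).symm (Lp.coeFn_add w₁ w₂).symm
  intro ψ hψ hc
  have a := memLp_test hψ hc
  have c := memLp_weight_test hψ hc
  simp only [Pi.add_apply, smul_add]
  rw [integral_add (integrable_smul_of_memLp a (Lp.memLp w₁)) (integrable_smul_of_memLp a (Lp.memLp w₂)),
    integral_add (integrable_smul_of_memLp c (Lp.memLp v₁)) (integrable_smul_of_memLp c (Lp.memLp v₂)),
    h₁ ψ hψ hc, h₂ ψ hψ hc, neg_add]

theorem IsWeightedDeriv.smul {v w : H} (h : IsWeightedDeriv v w) (c : ℂ) :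
    IsWeightedDeriv (c • v : H) (c • w : H) := by
  refine IsWeightedDeriv.congr (v := c • ⇑v) (w := c • ⇑w) ?_
    (Lp.coeFn_smul c v).symm (Lp.coeFn_smul c w).symm
  intro ψ hψ hc
  simp only [Pi.smul_apply, smul_comm _ c]
  rw [integral_smul, integral_smul, h ψ hψ hc, smul_neg]

theorem IsWeightedDeriv.zero : IsWeightedDeriv (0 : H) (0 : H) := by
  refine IsWeightedDeriv.congr (v := 0) (w := 0) ?_
    (Lp.coeFn_zero ℂ 2 volume).symm (Lp.coeFn_zero ℂ 2 volume).symm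
  intro ψ hψ hc
  simp

theorem IsWeightedDeriv.unique_Lp {v w₁ w₂ : H} (h₁ : IsWeightedDeriv v w₁)
    (h₂ : IsWeightedDeriv v w₂) : w₁ = w₂ :=
  Lp.ext (h₁.unique h₂ (Lp.memLp w₁) (Lp.memLp w₂))

/-- `Dom(L) = {v ∈ L² : (1 - φ²) v' ∈ L²}`. -/
def dom : Submodule ℂ H where
  carrier := {v | ∃ w : H, IsWeightedDeriv v w}
  add_mem' := by
    rintro v₁ v₂ ⟨w₁, h₁⟩ ⟨w₂, h₂⟩
    exact ⟨w₁ + w₂, h₁.add h₂⟩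
  zero_mem' := ⟨0, IsWeightedDeriv.zero⟩
  smul_mem' := by
    rintro c v ⟨w, h⟩
    exact ⟨c • w, h.smul c⟩

/-- The map `v ↦ (1 - φ²) v'` from `Dom(L)` to `L²`. -/
def weightedDeriv : dom →ₗ[ℂ] H where
  toFun v := v.2.choose
  map_add' v₁ v₂ :=
    (v₁ + v₂).2.choose_spec.unique_Lp (v₁.2.choose_spec.add v₂.2.choose_spec)
  map_smul' c v := (c • v).2.choose_spec.unique_Lp (v.2.choose_spec.smul c)

theorem memLp_mul {v : ℝ → ℂ} (hv : MemLp v 2 (volume : Measure ℝ)) :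
    MemLp (fun ξ => (phi ξ * phi' ξ) • v ξ) 2 (volume : Measure ℝ) := by
  refine hv.of_le_mul (c := 1)
    ((measurable_phi.mul measurable_phi').aestronglyMeasurable.smul hv.1)
    (Filter.Eventually.of_forall fun x => ?_)
  rw [norm_smul]
  refine mul_le_mul_of_nonneg_right ?_ (norm_nonneg _)
  rw [Real.norm_eq_abs, abs_mul, abs_of_nonneg (phi_nonneg x)]
  have := abs_phi'_le x
  nlinarith [phi_nonneg x, phi_le_one x, abs_nonneg (phi' x)]

/-- Multiplication by `φ φ'` on `L²`. -/
def mulPhiPhi' : H →ₗ[ℂ] H where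
  toFun v := (memLp_mul (Lp.memLp v)).toLp _
  map_add' v₁ v₂ := by
    rw [← MemLp.toLp_add, MemLp.toLp_eq_toLp_iff]
    filter_upwards [Lp.coeFn_add v₁ v₂] with x hx
    simp only [hx, Pi.add_apply, smul_add]
  map_smul' c v := by
    rw [RingHom.id_apply, ← MemLp.toLp_const_smul, MemLp.toLp_eq_toLp_iff]
    filter_upwards [Lp.coeFn_smul c v] with x hx
    simp only [hx, Pi.smul_apply]
    exact smul_comm _ _ _

/-- The function `φ * ((φ²)' v) - 2 φ' * (φ² v)`, where `*` is convolution. -/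
def qFun (v : ℝ → ℂ) (ξ : ℝ) : ℂ :=
  (phi ⋆[ContinuousLinearMap.lsmul ℝ ℝ, volume] fun η => (2 * phi η * phi' η) • v η) ξ
    - 2 * (phi' ⋆[ContinuousLinearMap.lsmul ℝ ℝ, volume] fun η => (phi η ^ 2) • v η) ξ

theorem qFun_eq (v : ℝ → ℂ) (ξ : ℝ) :
    qFun v ξ = (∫ η, phi (ξ - η) • (2 * phi η * phi' η) • v η)
      - 2 * ∫ η, phi' (ξ - η) • (phi η ^ 2) • v η := by
  rw [qFun, convolution_lsmul_swap, convolution_lsmul_swap]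

theorem kernel_bound {k a : ℝ → ℝ} (hk : ∀ η, |k η| ≤ phi η) (ha : ∀ η, |a η| ≤ 2 * phi η ^ 2)
    (v : ℝ → ℂ) (ξ η : ℝ) :
    ‖k (ξ - η) • a η • v η‖ ≤ 2 * phi ξ * ‖phi η • v η‖ := by
  rw [norm_smul, norm_smul, norm_smul, Real.norm_eq_abs, Real.norm_eq_abs, Real.norm_eq_abs,
    abs_of_nonneg (phi_nonneg η), ← mul_assoc, ← mul_assoc]
  refine mul_le_mul_of_nonneg_right ?_ (norm_nonneg _)
  calc |k (ξ - η)| * |a η| ≤ phi (ξ - η) * (2 * phi η ^ 2) :=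
        mul_le_mul (hk _) (ha _) (abs_nonneg _) (phi_nonneg _)
    _ = 2 * (phi (ξ - η) * phi η) * phi η := by ring
    _ ≤ 2 * phi ξ * phi η :=
        mul_le_mul_of_nonneg_right (by linarith [phi_mul_le ξ η]) (phi_nonneg _)

theorem integrable_kernel {k a : ℝ → ℝ} (hkm : Measurable k) (ham : Measurable a)
    (hk : ∀ η, |k η| ≤ phi η) (ha : ∀ η, |a η| ≤ 2 * phi η ^ 2)
    {v : ℝ → ℂ} (hv : MemLp v 2 (volume : Measure ℝ)) (ξ : ℝ) :
    Integrable (fun η => k (ξ - η) • a η • v η) volume :=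
  ((integrable_smul_of_memLp memLp_phi hv).norm.const_mul (2 * phi ξ)).mono'
    ((hkm.comp (measurable_const.sub measurable_id)).aestronglyMeasurable.smul
      (ham.aestronglyMeasurable.smul hv.1))
    (Filter.Eventually.of_forall fun η => kernel_bound hk ha v ξ η)

theorem memLp_kernel {k a : ℝ → ℝ} (hkm : Measurable k) (ham : Measurable a)
    (hk : ∀ η, |k η| ≤ phi η) (ha : ∀ η, |a η| ≤ 2 * phi η ^ 2)
    {v : ℝ → ℂ} (hv : MemLp v 2 (volume : Measure ℝ)) :
    MemLp (k ⋆[ContinuousLinearMap.lsmul ℝ ℝ, volume] fun η => a η • v η) 2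
      (volume : Measure ℝ) := by
  refine memLp_phi.of_le_mul (c := 2 * ∫ η, ‖phi η • v η‖) ?_
    (Filter.Eventually.of_forall fun ξ => ?_)
  · exact (AEStronglyMeasurable.convolution_integrand (μ := (volume : Measure ℝ))
      (ν := (volume : Measure ℝ)) (ContinuousLinearMap.lsmul ℝ ℝ)
      hkm.aestronglyMeasurable (ham.aestronglyMeasurable.smul hv.1)).integral_prod_right'
  · rw [convolution_lsmul_swap, Real.norm_of_nonneg (phi_nonneg ξ)]
    refine (norm_integral_le_integral_norm _).trans ?_
    refine (integral_mono (integrable_kernel hkm ham hk ha hv ξ).norm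
      ((integrable_smul_of_memLp memLp_phi hv).norm.const_mul (2 * phi ξ))
      (fun η => kernel_bound hk ha v ξ η)).trans ?_
    rw [integral_const_mul]
    exact le_of_eq (by ring)

theorem weight_bound₁ (η : ℝ) : |2 * phi η * phi' η| ≤ 2 * phi η ^ 2 := by
  rw [abs_mul, abs_mul, abs_two, abs_of_nonneg (phi_nonneg η)]
  nlinarith [abs_phi'_le η, phi_nonneg η]

theorem weight_bound₂ (η : ℝ) : |phi η ^ 2| ≤ 2 * phi η ^ 2 := by
  rw [abs_of_nonneg (sq_nonneg _)]
  nlinarith [sq_nonneg (phi η)]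

theorem measurable_weight₁ : Measurable fun η => 2 * phi η * phi' η :=
  (measurable_const.mul measurable_phi).mul measurable_phi'

theorem measurable_weight₂ : Measurable fun η => phi η ^ 2 := measurable_phi.pow_const 2

theorem abs_phi_le (η : ℝ) : |phi η| ≤ phi η := (abs_of_nonneg (phi_nonneg η)).le

theorem memLp_qFun {v : ℝ → ℂ} (hv : MemLp v 2 (volume : Measure ℝ)) :
    MemLp (qFun v) 2 (volume : Measure ℝ) :=
  (memLp_kernel measurable_phi measurable_weight₁ abs_phi_le weight_bound₁ hv).sub
    ((memLp_kernel measurable_phi' measurable_weight₂ abs_phi'_le weight_bound₂ hv).const_mul 2)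

theorem qFun_congr {v w : ℝ → ℂ} (h : v =ᵐ[volume] w) : qFun v = qFun w := by
  funext ξ
  rw [qFun_eq, qFun_eq]
  congr 1
  · exact integral_congr_ae (by filter_upwards [h] with η hη; rw [hη])
  · congr 1
    exact integral_congr_ae (by filter_upwards [h] with η hη; rw [hη])

theorem qFun_add {v w : ℝ → ℂ} (hv : MemLp v 2 (volume : Measure ℝ))
    (hw : MemLp w 2 (volume : Measure ℝ)) : qFun (v + w) = qFun v + qFun w := by
  funext ξ
  have i₁ {u : ℝ → ℂ} (hu : MemLp u 2 (volume : Measure ℝ)) :=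
    integrable_kernel measurable_phi measurable_weight₁ abs_phi_le weight_bound₁ hu ξ
  have i₂ {u : ℝ → ℂ} (hu : MemLp u 2 (volume : Measure ℝ)) :=
    integrable_kernel measurable_phi' measurable_weight₂ abs_phi'_le weight_bound₂ hu ξ
  rw [Pi.add_apply, qFun_eq, qFun_eq, qFun_eq]
  simp only [Pi.add_apply, smul_add]
  rw [integral_add (i₁ hv) (i₁ hw), integral_add (i₂ hv) (i₂ hw)]
  ring

theorem qFun_smul (c : ℂ) (v : ℝ → ℂ) : qFun (c • v) = c • qFun v := by
  funext ξ
  rw [Pi.smul_apply, qFun_eq, qFun_eq]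
  simp only [Pi.smul_apply, smul_comm _ c]
  rw [integral_smul, integral_smul]
  simp only [smul_eq_mul]
  ring

/-- The map `v ↦ φ * ((φ²)' v) - 2 φ' * (φ² v)` on `L²`. -/
def qMap : H →ₗ[ℂ] H where
  toFun v := (memLp_qFun (Lp.memLp v)).toLp _
  map_add' v₁ v₂ := by
    rw [← MemLp.toLp_add, MemLp.toLp_eq_toLp_iff, qFun_congr (Lp.coeFn_add v₁ v₂),
      qFun_add (Lp.memLp v₁) (Lp.memLp v₂)]
  map_smul' c v := by
    rw [RingHom.id_apply, ← MemLp.toLp_const_smul, MemLp.toLp_eq_toLp_iff,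
      qFun_congr (Lp.coeFn_smul c v), qFun_smul]

/-- The operator `Q v = (b - 3) (φ * ((φ²)' v) - 2 φ' * (φ² v))` on `L²`. -/
def Q (b : ℝ) : H →ₗ[ℂ] H := ((b - 3 : ℝ) : ℂ) • qMap

/-- The operator `L = (1 - φ²) ∂_ξ + (4 - b) φ φ' + Q` on `L²(ℝ)` with domain `Dom(L)`. -/
def L (b : ℝ) : H →ₗ.[ℂ] H where
  domain := dom
  toFun := weightedDeriv + (((4 - b : ℝ) : ℂ) • mulPhiPhi' + Q b) ∘ₗ dom.subtype

/-- The purely imaginary eigenvalues `± i √((b - 2)(b - 4))`, present if `b ≤ 2` or `4 ≤ b`. -/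
def embeddedEigenvalues (b : ℝ) : Set ℂ :=
  {z | (b ≤ 2 ∨ 4 ≤ b) ∧ (z = Complex.I * (√((b - 2) * (b - 4)) : ℝ) ∨
    z = -(Complex.I * (√((b - 2) * (b - 4)) : ℝ)))}

end Peakon

end

/-!
The reflection `ξ ↦ -ξ` turns `L` into `-L`, so everything can be studied on the half-line `ξ > 0`,
for `z` and for `-z`. There, with `x = e^{-2ξ} ∈ (0, 1)` and `v = 2 e^ξ u`, the kernel of `Q`
vanishes unless `η > ξ` or `η < 0` (`qFun_of_pos`), and `(L - z) v = f` becomes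
`T u = -e^{-ξ} f / 4 + (b - 3) A x`, where
`T u = x (1 - x) u' + ((z - 1) / 2 + (5 - b) / 2 x) u + (b - 3) ∫₀ˣ u` and the number
`A = ∫_{η > 0} e^{-3η} v(-η) dη` is the only trace of the other half-line. The point is that two
derivatives in `x` remove both the integral and the right-hand term: `(T u)'' = S u''` with `S` a
first order operator whose kernel is spanned by `h₀ = x^{-(z + 3) / 2} (1 - x)^{(z - b) / 2}`
(`exists_secondDeriv_eq`). Up to multiples of `u = x`, that is, of `v = 2 e^{-ξ}`, all questions
are thus answered by the growth of explicit powers: for suitable constants of integration, a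
solution with `u'' = h₀` makes `v` square-integrable at infinity if and only if `Re z < 0`, and at
`0` if and only if `Re z > b - 5`. The multiples of `e^{-|ξ|}` on the two half-lines solve a linear
system of determinant `1 - z² - (b - 3)²`, singular exactly for `z² = -(b - 2)(b - 4)`.

* Point spectrum. If `z² = -(b - 2)(b - 4)`, there is an eigenfunction proportional to `e^{-|ξ|}`
  on each half-line (`mem_pointSpectrum_of_sq_eq`). If `0 < |Re z| < 5 - b`, a solution with
  `u'' = h₀` on one half-line is completed by such multiples (`mem_pointSpectrum_of_abs_re_lt`).
  There are no other eigenvalues (`injective_shift`): `(1 - φ²) |v|²` vanishes at `0` and at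
  infinity (`energy_tendsto`), which for the remaining `z` excludes a component along `h₀`.
* Range. Let `z² ≠ -(b - 2)(b - 4)`. With `ρ = 1 / (x (1 - x) h₀)`, variation of constants solves
  `(L - z) v = f` for every `f = -4 e^ξ G` with a test function `G` that satisfies at most the one
  condition `∫ G ρ'' dx = 0`. The condition is needed only for `0 ≤ Re z ≤ b - 5`. So a functional
  which annihilates the range is zero or, on one of the half-lines, a multiple of `x^{3/2} ρ''`
  (`annihilator`). This function is not square-integrable if `Re z = 0` or `Re z = b - 5`
  (`denseRange_shift`). If `0 < Re z < b - 5`, it is square-integrable and does annihilate the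
  range, because `ρ''` is in the kernel of the transpose of `T` (`not_denseRange_shift`).
* Resolvent set. Since `Re ⟨(L - Q) v, v⟩ = (5 - b) ∫ φ φ' |v|²`, the operator `L - Q - z` is
  bounded below if `|Re z| > |5 - b|`. As `Q` is compact and `L` is closed, an injective `L - z`
  with dense range has then a bounded inverse (`mem_resolventSet_of_injective_of_denseRange`).
* The rest of the closed strip `|Re z| ≤ |5 - b|` is a limit of the two cases above, in which
  `L - z` fails to be invertible (`mem_spectrum_of_abs_re_le`).
-/

noncomputable section

namespace Peakon

open Set Filter Topology Asymptotics

/-! ### Integration by parts and the du Bois-Reymond lemma -/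

theorem absolutelyContinuousOnInterval_integral {f : ℝ → ℂ} {a b : ℝ}
    (hf : IntervalIntegrable f volume a b) :
    AbsolutelyContinuousOnInterval (fun x => ∫ t in a..x, f t) a b := by
  have h1 : IntervalIntegrable (fun t => (f t).re) volume a b :=
    ⟨hf.1.re, hf.2.re⟩
  have h2 : IntervalIntegrable (fun t => (f t).im) volume a b :=
    ⟨hf.1.im, hf.2.im⟩
  have c1 : AbsolutelyContinuousOnInterval (fun _ : ℝ => (1 : ℂ)) a b :=
    (LipschitzWith.const (1 : ℂ)).lipschitzOnWith.absolutelyContinuousOnInterval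
  have c2 : AbsolutelyContinuousOnInterval (fun _ : ℝ => Complex.I) a b :=
    (LipschitzWith.const Complex.I).lipschitzOnWith.absolutelyContinuousOnInterval
  have a1 := (h1.absolutelyContinuousOnInterval_intervalIntegral left_mem_uIcc).smul c1
  have a2 := (h2.absolutelyContinuousOnInterval_intervalIntegral left_mem_uIcc).smul c2
  have e := a1.add a2
  rw [absolutelyContinuousOnInterval_iff] at e ⊢
  intro ε hε
  obtain ⟨δ, hδ, H⟩ := e ε hε
  refine ⟨δ, hδ, fun E hE hl => ?_⟩
  have key : ∀ x ∈ uIcc a b, ∫ t in a..x, f t =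
      (∫ t in a..x, (f t).re) • (1 : ℂ) + (∫ t in a..x, (f t).im) • Complex.I := by
    intro x hx
    have hfx : IntervalIntegrable f volume a x := hf.mono_set (uIcc_subset_uIcc_left hx)
    have h1x : IntervalIntegrable (fun t => (f t).re) volume a x := ⟨hfx.1.re, hfx.2.re⟩
    have h2x : IntervalIntegrable (fun t => (f t).im) volume a x := ⟨hfx.1.im, hfx.2.im⟩
    rw [← intervalIntegral.integral_smul_const, ← intervalIntegral.integral_smul_const,
      ← intervalIntegral.integral_add]
    · refine intervalIntegral.integral_congr fun t _ => ?_
      simp [Complex.re_add_im]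
    · exact ⟨h1x.1.smul_const _, h1x.2.smul_const _⟩
    · exact ⟨h2x.1.smul_const _, h2x.2.smul_const _⟩
  convert! H E hE hl using 3 with i hi
  all_goals
    have hm := hE.1 i hi
    simp only [Pi.add_apply, Pi.smul_apply']
    first | exact key _ hm.1 | exact key _ hm.2

/-- Integration by parts for two primitives of integrable functions. -/
theorem mul_sub_mul_eq_integral {F f G g : ℝ → ℂ} {a b : ℝ} (hab : a ≤ b)
    (hf : IntervalIntegrable f volume a b) (hg : IntervalIntegrable g volume a b)
    (hF : ∀ x ∈ Icc a b, F x = F a + ∫ t in a..x, f t)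
    (hG : ∀ x ∈ Icc a b, G x = G a + ∫ t in a..x, g t) :
    F b * G b - F a * G a = ∫ t in a..b, (f t * G t + F t * g t) := by
  set F₀ : ℝ → ℂ := fun x => F a + ∫ t in a..x, f t with hF₀
  set G₀ : ℝ → ℂ := fun x => G a + ∫ t in a..x, g t with hG₀
  have cst (c : ℂ) : AbsolutelyContinuousOnInterval (fun _ : ℝ => c) a b :=
    (LipschitzWith.const c).lipschitzOnWith.absolutelyContinuousOnInterval
  have aF : AbsolutelyContinuousOnInterval F₀ a b :=
    (cst (F a)).add (absolutelyContinuousOnInterval_integral hf)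
  have aG : AbsolutelyContinuousOnInterval G₀ a b :=
    (cst (G a)).add (absolutelyContinuousOnInterval_integral hg)
  have hi : IntervalIntegrable (fun t => f t * G₀ t + F₀ t * g t) volume a b :=
    (hf.mul_continuousOn aG.continuousOn).add (hg.continuousOn_mul aF.continuousOn)
  have aI := absolutelyContinuousOnInterval_integral hi
  have aP : AbsolutelyContinuousOnInterval (F₀ • G₀) a b := aF.smul aG
  obtain ⟨C, hC⟩ := (aP.sub aI).const_of_ae_hasDerivAt_zero (by
    filter_upwards [hf.ae_hasDerivAt_integral, hg.ae_hasDerivAt_integral,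
      hi.ae_hasDerivAt_integral] with x h1 h2 h3 hx
    have d1 : HasDerivAt F₀ (f x) x := (h1 hx a left_mem_uIcc).const_add _
    have d2 : HasDerivAt G₀ (g x) x := (h2 hx a left_mem_uIcc).const_add _
    have := (d1.mul d2).sub (h3 hx a left_mem_uIcc)
    rw [sub_self] at this
    exact this)
  have e1 := hC a left_mem_uIcc
  have e2 := hC b right_mem_uIcc
  have e3 : ∫ t in a..b, (f t * G t + F t * g t) = ∫ t in a..b, (f t * G₀ t + F₀ t * g t) := by
    refine intervalIntegral.integral_congr fun t ht => ?_
    rw [uIcc_of_le hab] at ht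
    simp only [hF t ht, hG t ht, hF₀, hG₀]
  rw [e3, hF b (right_mem_Icc.2 hab), hG b (right_mem_Icc.2 hab)]
  simp only [Pi.sub_apply, smul_eq_mul, Pi.mul_apply, hF₀, hG₀, intervalIntegral.integral_same,
    add_zero, sub_zero] at e1 e2 ⊢
  rw [e1, ← e2]; ring

theorem integrable_smul_of_tsupport_subset {U : Set ℝ} {f : ℝ → ℂ} (hf : LocallyIntegrableOn f U)
    {g : ℝ → ℝ} (hg : Continuous g) (hc : HasCompactSupport g) (hs : tsupport g ⊆ U) :
    Integrable (fun x => g x • f x) := by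
  have h : IntegrableOn (fun x => g x • f x) (tsupport g) :=
    (hf.integrableOn_compact_subset hs hc).continuousOn_smul hg.continuousOn hc
  refine (integrableOn_iff_integrable_of_support_subset fun x hx => ?_).1 h
  exact subset_tsupport g fun h0 => hx (by simp [h0])

theorem exists_Icc_of_tsupport_subset_Ioi {E : Type*} [Zero E] {g : ℝ → E} (hc : HasCompactSupport g)
    (hs : tsupport g ⊆ Ioi 0) : ∃ s t, 0 < s ∧ s ≤ t ∧ tsupport g ⊆ Icc s t := by
  have hK : IsCompact (insert (1 : ℝ) (tsupport g)) := hc.isCompact.insert 1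
  obtain ⟨s, hs1, hs2⟩ := hK.exists_isLeast ⟨1, mem_insert _ _⟩
  obtain ⟨t, ht1, ht2⟩ := hK.exists_isGreatest ⟨1, mem_insert _ _⟩
  refine ⟨s, t, ?_, hs2 ht1, fun x hx => ⟨hs2 (mem_insert_of_mem _ hx), ht2 (mem_insert_of_mem _ hx)⟩⟩
  rcases hs1 with h | h
  · rw [h]; exact one_pos
  · exact hs h

/-- A smooth compactly supported function on `(0, ∞)` of integral zero has a compactly supported
primitive. -/
theorem exists_primitive_of_integral_eq_zero {θ : ℝ → ℝ} (hθ : ContDiff ℝ ∞ θ)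
    (hc : HasCompactSupport θ) (hs : tsupport θ ⊆ Ioi 0) (h0 : ∫ x, θ x = 0) :
    ∃ χ : ℝ → ℝ, ContDiff ℝ ∞ χ ∧ HasCompactSupport χ ∧ tsupport χ ⊆ Ioi 0 ∧ deriv χ = θ := by
  obtain ⟨s, t, hs0, hst, hsub⟩ := exists_Icc_of_tsupport_subset_Ioi hc hs
  have hz : ∀ x, x ∉ Icc s t → θ x = 0 := fun x hx =>
    image_eq_zero_of_notMem_tsupport fun h => hx (hsub h)
  obtain ⟨a, has⟩ : ∃ a, a < s := ⟨s - 1, by linarith⟩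
  have hd : ∀ x, HasDerivAt (fun x => ∫ y in a..x, θ y) (θ x) x := fun x =>
    intervalIntegral.integral_hasDerivAt_right (hθ.continuous.intervalIntegrable _ _)
      (hθ.continuous.stronglyMeasurableAtFilter _ _) hθ.continuous.continuousAt
  have hder : deriv (fun x => ∫ y in a..x, θ y) = θ := funext fun x => (hd x).deriv
  have hfull : ∫ y in a..t, θ y = 0 := by
    rw [intervalIntegral.integral_of_le (has.le.trans hst), ← h0]
    exact setIntegral_eq_integral_of_forall_compl_eq_zero fun x hx => hz x fun hx' =>
      hx ⟨has.trans_le hx'.1, hx'.2⟩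
  have hsupp : ∀ x, x ∉ Icc s t → ∫ y in a..x, θ y = 0 := by
    intro x hx
    rcases lt_or_ge x s with h | h
    · refine (intervalIntegral.integral_congr_ae (g := fun _ => 0)
        (Eventually.of_forall fun y hy => hz y fun hy' => ?_)).trans (by simp)
      exact absurd hy'.1 (not_le.2 (hy.2.trans_lt (max_lt has h)))
    · have hxt : t < x := by
        by_contra h'
        exact hx ⟨h, not_lt.1 h'⟩
      rw [← intervalIntegral.integral_add_adjacent_intervals
        (hθ.continuous.intervalIntegrable a t) (hθ.continuous.intervalIntegrable t x), hfull, zero_add]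
      refine (intervalIntegral.integral_congr_ae (g := fun _ => 0)
        (Eventually.of_forall fun y hy => hz y fun hy' => ?_)).trans (by simp)
      rw [uIoc_of_le hxt.le] at hy
      exact absurd hy'.2 (not_le.2 hy.1)
  have hts : tsupport (fun x => ∫ y in a..x, θ y) ⊆ Icc s t :=
    closure_minimal (fun x hx => by_contra fun h => hx (hsupp x h)) isClosed_Icc
  refine ⟨fun x => ∫ y in a..x, θ y, ?_, ?_, ?_, hder⟩
  · rw [contDiff_infty_iff_deriv, hder]
    exact ⟨fun x => (hd x).differentiableAt, hθ⟩
  · exact isCompact_Icc.of_isClosed_subset (isClosed_tsupport _) hts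
  · exact hts.trans fun x hx => hs0.trans_le hx.1

/-- The du Bois-Reymond lemma on the half-line: a function with vanishing distributional derivative
is constant. -/
theorem ae_eq_const_of_integral_deriv_smul_eq_zero {f : ℝ → ℂ}
    (hf : LocallyIntegrableOn f (Ioi 0))
    (h : ∀ χ : ℝ → ℝ, ContDiff ℝ ∞ χ → HasCompactSupport χ → tsupport χ ⊆ Ioi 0 →
      ∫ x, deriv χ x • f x = 0) :
    ∃ c : ℂ, ∀ᵐ x, x ∈ Ioi (0 : ℝ) → f x = c := by
  let B : ContDiffBump (2 : ℝ) := ⟨1 / 2, 1, by norm_num, by norm_num⟩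
  set η : ℝ → ℝ := B.normed volume with hη
  have ηd : ContDiff ℝ ∞ η := B.contDiff_normed
  have ηc : HasCompactSupport η := B.hasCompactSupport_normed
  have ηs : tsupport η ⊆ Ioi 0 := by
    rw [hη, B.tsupport_normed_eq, Real.closedBall_eq_Icc]
    intro x hx
    have : (2 : ℝ) - 1 ≤ x := hx.1
    exact lt_of_lt_of_le (by norm_num) this
  have ηi : ∫ x, η x = 1 := B.integral_normed
  refine ⟨∫ x, η x • f x, ?_⟩
  set c := ∫ x, η x • f x with hc
  have key := isOpen_Ioi.ae_eq_zero_of_integral_contDiff_smul_eq_zero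
    (f := fun x => f x - c) (μ := volume) (U := Ioi (0 : ℝ))
    (hf.sub (locallyIntegrableOn_const c)) (by
      intro g gd gc gs
      set m := ∫ x, g x with hm
      have ig := integrable_smul_of_tsupport_subset hf gd.continuous gc gs
      have iη := integrable_smul_of_tsupport_subset hf ηd.continuous ηc ηs
      have jg := gd.continuous.integrable_of_hasCompactSupport (μ := volume) gc
      have jη := ηd.continuous.integrable_of_hasCompactSupport (μ := volume) ηc
      have mη : HasCompactSupport (fun x => m * η x) := ηc.mul_left
      have tη : tsupport (fun x => m * η x) ⊆ Ioi 0 :=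
        (tsupport_mul_subset_right (f := fun _ => m) (g := η)).trans ηs
      obtain ⟨χ, χd, χc, χs, χ'⟩ := exists_primitive_of_integral_eq_zero
        (θ := fun x => g x - m * η x) (gd.sub (contDiff_const.mul ηd)) (gc.sub mη)
        ((tsupport_sub g (fun x => m * η x)).trans (union_subset gs tη))
        (by rw [integral_sub jg (jη.const_mul m), integral_const_mul, ηi, mul_one, sub_self])
      have := h χ χd χc χs
      rw [χ'] at this
      simp only [sub_smul, mul_smul] at this
      rw [integral_sub ig (g := fun x => m • η x • f x) (iη.smul m), integral_smul, ← hc] at this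
      simp only [smul_sub]
      rw [integral_sub ig (jg.smul_const c), integral_smul_const]
      exact this)
  filter_upwards [key] with x hx h0
  exact sub_eq_zero.1 (hx h0)

/-! ### The domain of `L` -/

theorem one_sub_exp_pos {t : ℝ} (ht : 0 < t) : 0 < 1 - Real.exp (-2 * t) := by
  rw [sub_pos, Real.exp_lt_one_iff]; linarith

theorem phi_sq_of_pos {t : ℝ} (ht : 0 ≤ t) : phi t ^ 2 = Real.exp (-2 * t) := by
  rw [phi, abs_of_nonneg ht, ← Real.exp_nat_mul]; congr 1; push_cast; ring

theorem phi_mul_phi'_of_pos {t : ℝ} (ht : 0 < t) : phi t * phi' t = -Real.exp (-2 * t) := by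
  rw [phi', Real.sign_of_pos ht, phi, abs_of_pos ht, neg_mul, one_mul, mul_neg, ← Real.exp_add]
  congr 2; ring

theorem phi_neg (t : ℝ) : phi (-t) = phi t := by simp [phi]

theorem phi'_neg (t : ℝ) : phi' (-t) = -phi' t := by
  simp [phi', Real.sign_neg]

theorem continuous_phi : Continuous phi := by unfold phi; fun_prop

theorem hasDerivAt_one_sub_exp (t : ℝ) :
    HasDerivAt (fun t : ℝ => 1 - Real.exp (-2 * t)) (2 * Real.exp (-2 * t)) t := by
  have := (((hasDerivAt_id t).const_mul (-2)).exp).const_sub 1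
  convert! this using 1
  simp only [id]; ring

theorem locallyIntegrableOn_div_weight {w : ℝ → ℂ} (hw : MemLp w 2 (volume : Measure ℝ)) :
    LocallyIntegrableOn (fun t => (1 - Real.exp (-2 * t))⁻¹ • w t) (Ioi 0) := by
  refine LocallyIntegrableOn.continuousOn_smul isOpen_Ioi.isLocallyClosed
    ((hw.locallyIntegrable (by norm_num)).locallyIntegrableOn _) ?_
  exact ContinuousOn.inv₀ (by fun_prop) fun t ht => (one_sub_exp_pos ht).ne'

theorem intervalIntegrable_of_locallyIntegrableOn_Ioi {g : ℝ → ℂ}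
    (hg : LocallyIntegrableOn g (Ioi 0)) {s t : ℝ} (hs : 0 < s) (ht : 0 < t) :
    IntervalIntegrable g volume s t := by
  rw [intervalIntegrable_iff']
  exact hg.integrableOn_compact_subset (fun x hx => (lt_min hs ht).trans_le hx.1) isCompact_uIcc

theorem continuousOn_of_eq_integral {V g : ℝ → ℂ} (hg : LocallyIntegrableOn g (Ioi 0))
    (hV : ∀ s t, 0 < s → 0 < t → V t - V s = ∫ η in s..t, g η) : ContinuousOn V (Ioi 0) := by
  intro t ht
  have ht' : (0 : ℝ) < t := ht
  have h := intervalIntegral.continuousOn_primitive_interval' (a := t) (b₁ := t / 2) (b₂ := t + 1)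
    (intervalIntegrable_of_locallyIntegrableOn_Ioi hg (by linarith) (by linarith))
    (by rw [uIcc_of_le (by linarith)]; constructor <;> linarith)
  have h' : ContinuousAt (fun b => V t + ∫ x in t..b, g x) t :=
    continuousAt_const.add (h.continuousAt (by
      rw [uIcc_of_le (by linarith)]; exact Icc_mem_nhds (by linarith) (by linarith)))
  refine (h'.congr ?_).continuousWithinAt
  filter_upwards [Ioi_mem_nhds ht'] with b hb
  rw [← hV t b ht hb]; ring

/-- On `(0, ∞)` a function of the domain is a primitive: `v(t) - v(s) = ∫ₛᵗ w / (1 - φ²)`. -/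
theorem IsWeightedDeriv.exists_primitive {v w : ℝ → ℂ} (h : IsWeightedDeriv v w)
    (hv : MemLp v 2 (volume : Measure ℝ)) (hw : MemLp w 2 (volume : Measure ℝ)) :
    ∃ V : ℝ → ℂ, (∀ᵐ ξ, ξ ∈ Ioi (0 : ℝ) → v ξ = V ξ) ∧
      ∀ s t, 0 < s → 0 < t → V t - V s = ∫ η in s..t, (1 - Real.exp (-2 * η))⁻¹ • w η := by
  set g : ℝ → ℂ := fun η => (1 - Real.exp (-2 * η))⁻¹ • w η with hg
  have gl : LocallyIntegrableOn g (Ioi 0) := locallyIntegrableOn_div_weight hw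
  have gi {s t : ℝ} (hs : 0 < s) (ht : 0 < t) : IntervalIntegrable g volume s t :=
    intervalIntegrable_of_locallyIntegrableOn_Ioi gl hs ht
  set V₀ : ℝ → ℂ := fun t => ∫ η in (1 : ℝ)..t, g η with hV₀
  have hsub : ∀ s t, 0 < s → 0 < t → V₀ t - V₀ s = ∫ η in s..t, g η := fun s t hs ht =>
    intervalIntegral.integral_interval_sub_left (gi one_pos ht) (gi one_pos hs)
  have vl : LocallyIntegrableOn v (Ioi 0) :=
    (hv.locallyIntegrable (by norm_num)).locallyIntegrableOn _
  have Vl : LocallyIntegrableOn V₀ (Ioi 0) :=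
    (continuousOn_of_eq_integral gl hsub).locallyIntegrableOn measurableSet_Ioi
  obtain ⟨c, hc⟩ := ae_eq_const_of_integral_deriv_smul_eq_zero (vl.sub Vl) (by
    intro χ χd χc χs
    obtain ⟨s, t, hs0, hst, hst'⟩ := exists_Icc_of_tsupport_subset_Ioi χc χs
    have χ'd : Continuous (deriv χ) := χd.continuous_deriv (by simp)
    have χ's : tsupport (deriv χ) ⊆ Ioi 0 := tsupport_deriv_subset.trans χs
    -- the weak equation, tested with `χ / (1 - φ²)`
    have e1 : ∫ x, χ x • g x = -∫ x, deriv χ x • v x := by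
      set ψ : ℝ → ℝ := fun x => χ x * (1 - Real.exp (-2 * x))⁻¹ with hψ
      have ψd : ContDiff ℝ ∞ ψ := by
        rw [contDiff_iff_contDiffAt]
        intro x
        by_cases hx : x ∈ tsupport χ
        · refine χd.contDiffAt.mul (ContDiffAt.inv ?_ (one_sub_exp_pos (χs hx)).ne')
          exact (contDiff_const.sub (contDiff_const.mul contDiff_id).exp).contDiffAt
        · refine (contDiffAt_const (c := (0 : ℝ))).congr_of_eventuallyEq ?_
          filter_upwards [notMem_tsupport_iff_eventuallyEq.1 hx] with y hy
          simp [hψ, hy]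
      have ψc : HasCompactSupport ψ := χc.mul_right
      have := h ψ ψd ψc
      convert! this using 2
      · funext x
        simp only [hg, hψ, smul_smul]
      · congr 1
        funext x
        congr 1
        by_cases hx : x ∈ tsupport χ
        · have hx0 : 0 < x := χs hx
          have k := (one_sub_exp_pos hx0).ne'
          have d : HasDerivAt ψ (deriv χ x * (1 - Real.exp (-2 * x))⁻¹ +
              χ x * (-(2 * Real.exp (-2 * x)) / (1 - Real.exp (-2 * x)) ^ 2)) x :=
            ((χd.differentiable (by simp)) x).hasDerivAt.mul ((hasDerivAt_one_sub_exp x).inv k)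
          rw [d.deriv, mul_assoc 2, phi_mul_phi'_of_pos hx0, phi_sq_of_pos hx0.le]
          simp only [hψ]
          generalize Real.exp (-2 * x) = E at k
          field_simp
          ring
        · have h1 := notMem_tsupport_iff_eventuallyEq.1 hx
          have h2 : ψ =ᶠ[𝓝 x] fun _ => 0 := by
            filter_upwards [h1] with y hy
            simp [hψ, hy]
          rw [h1.deriv_eq, h2.deriv_eq, h2.eq_of_nhds]
          simp
    -- integration by parts for the primitive
    have e2 : ∫ x, (deriv χ x • V₀ x + χ x • g x) = 0 := by
      have hz : ∀ x, x ∉ Icc s t → deriv χ x = 0 ∧ χ x = 0 := fun x hx =>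
        ⟨image_eq_zero_of_notMem_tsupport fun h => hx (hst' (tsupport_deriv_subset h)),
          image_eq_zero_of_notMem_tsupport fun h => hx (hst' h)⟩
      have hab : s / 2 ≤ t + 1 := by linarith
      have ha : 0 < s / 2 := by linarith
      have := mul_sub_mul_eq_integral (F := fun x => (χ x : ℂ)) (f := fun x => ((deriv χ x : ℝ) : ℂ))
        (G := V₀) (g := g) hab
        ((Complex.continuous_ofReal.comp χ'd).intervalIntegrable _ _) (gi ha (by linarith))
        (fun x _ => by
          rw [intervalIntegral.integral_ofReal, intervalIntegral.integral_deriv_eq_sub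
            (fun y _ => (χd.differentiable (by simp)) y) (χ'd.intervalIntegrable _ _)]
          push_cast; ring)
        (fun x hx => by rw [← hsub _ _ ha (ha.trans_le hx.1)]; ring)
      rw [(hz (s / 2) fun h => by linarith [h.1]).2, (hz (t + 1) fun h => by linarith [h.2]).2,
        intervalIntegral.integral_of_le hab] at this
      simp only [Complex.ofReal_zero, zero_mul, sub_zero] at this
      rw [← setIntegral_eq_integral_of_forall_compl_eq_zero (s := Ioc (s / 2) (t + 1)), this]
      · rfl
      · intro x hx
        obtain ⟨h1, h2⟩ := hz x fun h => hx ⟨by linarith [h.1], by linarith [h.2]⟩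
        simp [h1, h2]
    have i1 := integrable_smul_of_tsupport_subset vl χ'd χc.deriv χ's
    have i2 := integrable_smul_of_tsupport_subset Vl χ'd χc.deriv χ's
    have i3 := integrable_smul_of_tsupport_subset gl χd.continuous χc χs
    rw [integral_add i2 i3] at e2
    simp only [Pi.sub_apply, smul_sub]
    rw [integral_sub i1 i2]
    linear_combination -e2 + e1)
  refine ⟨fun t => V₀ t + c, ?_, fun s t hs ht => ?_⟩
  · filter_upwards [hc] with x hx h0
    rw [← hx h0]; simp
  · rw [← hsub s t hs ht]; ring

theorem IsWeightedDeriv.comp_neg {v w : ℝ → ℂ} (h : IsWeightedDeriv v w) :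
    IsWeightedDeriv (fun ξ => v (-ξ)) (fun ξ => -w (-ξ)) := by
  intro ψ hψ hc
  have hn : Topology.IsClosedEmbedding (fun x : ℝ => -x) := (Homeomorph.neg ℝ).isClosedEmbedding
  have := h (fun x => ψ (-x)) (hψ.comp contDiff_neg) (hc.comp_isClosedEmbedding hn)
  rw [← integral_neg_eq_self, ← integral_neg_eq_self (f := fun ξ => (_ : ℝ) • v ξ)] at this
  simp only [smul_neg, integral_neg, neg_neg, neg_inj] at this ⊢
  rw [this, ← integral_neg]
  refine integral_congr_ae (Eventually.of_forall fun x => ?_)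
  simp only
  rw [← neg_smul]
  congr 1
  rw [deriv_comp_neg, phi_neg, phi'_neg, neg_neg]
  ring

/-- A function which is differentiable off the origin, and does not grow too fast there, has the
expected weighted derivative. -/
theorem isWeightedDeriv_of_hasDerivAt {v v' w : ℝ → ℂ} (hv : MemLp v 2 (volume : Measure ℝ))
    (hw : MemLp w 2 (volume : Measure ℝ)) (hd : ∀ ξ, ξ ≠ 0 → HasDerivAt v (v' ξ) ξ)
    (hw' : ∀ ξ, ξ ≠ 0 → w ξ = (1 - phi ξ ^ 2) • v' ξ)
    (h0 : Tendsto (fun ξ => (1 - phi ξ ^ 2) • v ξ) (𝓝[≠] 0) (𝓝 0)) : IsWeightedDeriv v w := by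
  intro ψ hψ hc
  set F : ℝ → ℂ := fun ξ => ψ ξ • (1 - phi ξ ^ 2) • v ξ with hF
  have i1 := integrable_smul_of_memLp (memLp_test hψ hc) hw
  have i2 := integrable_smul_of_memLp (memLp_weight_test hψ hc) hv
  have dF : ∀ ξ, ξ ≠ 0 → HasDerivAt F (ψ ξ • w ξ +
      ((1 - phi ξ ^ 2) * deriv ψ ξ - 2 * phi ξ * phi' ξ * ψ ξ) • v ξ) ξ := by
    intro ξ hξ
    have d1 : HasDerivAt ψ (deriv ψ ξ) ξ := ((hψ.differentiable (by simp)) ξ).hasDerivAt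
    have d2 : HasDerivAt (fun ξ => 1 - phi ξ ^ 2) (-(2 * phi ξ * phi' ξ)) ξ := by
      have := ((hasDerivAt_phi hξ).pow 2).const_sub 1
      convert! this using 1
      simp
    have := d1.smul (d2.smul (hd ξ hξ))
    convert! this using 1
    rw [hw' ξ hξ]
    simp only [Pi.smul_apply', Complex.real_smul]
    push_cast
    ring
  have cF : Continuous F := by
    rw [continuous_iff_continuousAt]
    intro ξ
    rcases eq_or_ne ξ 0 with rfl | hξ
    · rw [continuousAt_iff_punctured_nhds]
      have := (hψ.continuous.tendsto 0).mono_left (nhdsWithin_le_nhds (s := {0}ᶜ))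
      have := this.smul h0
      simpa [hF, phi] using this
    · exact (dF ξ hξ).continuousAt
  obtain ⟨R, hR⟩ := hc.isCompact.isBounded.subset_closedBall 0
  rw [Real.closedBall_eq_Icc, zero_sub, zero_add] at hR
  have hz : ∀ x, x ∉ Icc (-R) R → ψ x = 0 ∧ deriv ψ x = 0 := fun x hx =>
    ⟨image_eq_zero_of_notMem_tsupport fun h => hx (hR h),
      image_eq_zero_of_notMem_tsupport fun h => hx (hR (tsupport_deriv_subset h))⟩
  have hRR : -(|R| + 1) ≤ |R| + 1 := by linarith [abs_nonneg R]
  have key := integral_eq_of_hasDerivAt_off_countable_of_le F _ hRR (countable_singleton 0)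
    cF.continuousOn (fun x hx => dF x fun h => hx.2 (by simp [h])) (i1.add i2).intervalIntegrable
  rw [hF] at key
  simp only at key
  rw [(hz (|R| + 1) fun h => by linarith [h.2, le_abs_self R]).1,
    (hz (-(|R| + 1)) fun h => by linarith [h.1, le_abs_self R]).1,
    intervalIntegral.integral_of_le hRR,
    setIntegral_eq_integral_of_forall_compl_eq_zero] at key
  · rw [integral_add i1 i2, zero_smul, zero_smul, sub_zero] at key
    exact eq_neg_of_add_eq_zero_left key
  · intro x hx
    obtain ⟨h1, h2⟩ := hz x fun h => hx ⟨by linarith [h.1, le_abs_self R], by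
      linarith [h.2, le_abs_self R]⟩
    simp [h1, h2]

/-! ### The nonlocal term on the half-line -/

theorem memLp_comp_neg {v : ℝ → ℂ} (hv : MemLp v 2 (volume : Measure ℝ)) :
    MemLp (fun ξ => v (-ξ)) 2 (volume : Measure ℝ) :=
  hv.comp_measurePreserving (Measure.measurePreserving_neg (volume : Measure ℝ))

/-- The tail moment `∫_{η > ξ} e^{-3η} v(η) dη`, the only nonlocal quantity in the operator on
`(0, ∞)`. -/
def tail (v : ℝ → ℂ) (ξ : ℝ) : ℂ := ∫ η in Ioi ξ, Real.exp (-3 * η) • v η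

theorem integrableOn_tail {v : ℝ → ℂ} (hv : MemLp v 2 (volume : Measure ℝ)) {ξ : ℝ} (hξ : 0 ≤ ξ) :
    IntegrableOn (fun η => Real.exp (-3 * η) • v η) (Ioi ξ) := by
  have h := integrable_smul_of_memLp memLp_phi hv
  refine (h.norm.integrableOn (s := Ioi ξ)).mono' ?_ ?_
  · exact ((by fun_prop : Continuous fun η : ℝ => Real.exp (-3 * η)).aestronglyMeasurable.smul
      hv.1).restrict
  · filter_upwards [ae_restrict_mem measurableSet_Ioi] with η hη
    have h0 : 0 < η := hξ.trans_lt hη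
    rw [norm_smul, norm_smul]
    refine mul_le_mul_of_nonneg_right ?_ (norm_nonneg _)
    rw [Real.norm_of_nonneg (Real.exp_pos _).le, Real.norm_of_nonneg (phi_nonneg _), phi,
      abs_of_pos h0, Real.exp_le_exp]
    linarith

theorem integral_indicator_comp_neg (g : ℝ → ℂ) :
    ∫ η, (Iio (0 : ℝ)).indicator g η = ∫ η in Ioi (0 : ℝ), g (-η) := by
  rw [integral_indicator measurableSet_Iio, ← integral_Iic_eq_integral_Iio,
    integral_comp_neg_Ioi, neg_zero]

theorem qFun_neg (v : ℝ → ℂ) (ξ : ℝ) : qFun (fun η => v (-η)) ξ = -qFun v (-ξ) := by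
  rw [qFun_eq, qFun_eq, ← integral_neg_eq_self,
    ← integral_neg_eq_self (f := fun η => phi' (ξ - η) • phi η ^ 2 • v (-η))]
  have h1 : ∀ η, phi (ξ - -η) = phi (-ξ - η) := fun η => by rw [← phi_neg]; congr 1; ring
  have h2 : ∀ η, phi' (ξ - -η) = -phi' (-ξ - η) := fun η => by rw [← phi'_neg]; congr 1; ring
  simp only [h1, h2, phi_neg, phi'_neg, neg_neg, mul_neg, neg_smul, smul_neg, integral_neg]
  ring

/-- On `(0, ∞)` the kernel of the nonlocal term vanishes unless `η < 0` or `η > ξ`. -/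
theorem qFun_of_pos {v : ℝ → ℂ} (hv : MemLp v 2 (volume : Measure ℝ)) {ξ : ℝ} (hξ : 0 < ξ) :
    qFun v ξ = -4 * Real.exp ξ * tail v ξ + 4 * Real.exp (-ξ) * tail (fun η => v (-η)) 0 := by
  have i₁ := integrable_kernel measurable_phi measurable_weight₁ abs_phi_le weight_bound₁ hv ξ
  have i₂ := integrable_kernel measurable_phi' measurable_weight₂ abs_phi'_le weight_bound₂ hv ξ
  have j₁ := integrableOn_tail hv hξ.le
  have j₂ := integrableOn_tail (memLp_comp_neg hv) le_rfl
  have j₃ : IntegrableOn (fun η => Real.exp (3 * η) • v η) (Iio 0) := by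
    have := IntegrableOn.comp_neg_Iio (c := 0) (f := fun η => Real.exp (-3 * η) • v (-η))
      (by simpa using j₂)
    simpa using this
  rw [qFun_eq, ← integral_const_mul, ← integral_sub i₁ (i₂.const_mul 2), tail, tail,
    ← integral_const_mul, ← integral_const_mul, ← integral_indicator measurableSet_Ioi]
  have e : ∫ η in Ioi (0 : ℝ), 4 * (Real.exp (-ξ) : ℂ) * Real.exp (-3 * η) • v (-η) =
      ∫ η, (Iio (0 : ℝ)).indicator
        (fun η => 4 * (Real.exp (-ξ) : ℂ) * Real.exp (3 * η) • v η) η := by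
    rw [integral_indicator_comp_neg]; simp
  rw [e, ← integral_add]
  · refine integral_congr_ae ?_
    have n0 : ∀ᵐ η : ℝ, η ≠ 0 := by simp [ae_iff]
    have n1 : ∀ᵐ η : ℝ, η ≠ ξ := by simp [ae_iff]
    filter_upwards [n0, n1] with η h0 h1
    rcases lt_or_gt_of_ne h0 with h | h
    · rw [indicator_of_notMem (by simp; linarith), indicator_of_mem (by simpa using h)]
      have a1 : phi (ξ - η) = Real.exp (-ξ) * Real.exp η := by
        rw [phi, abs_of_pos (by linarith), ← Real.exp_add]; congr 1; ring
      have a2 : phi' (ξ - η) = -(Real.exp (-ξ) * Real.exp η) := by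
        rw [phi', Real.sign_of_pos (by linarith), abs_of_pos (by linarith), ← Real.exp_add, neg_one_mul]
        congr 2; ring
      have a3 : phi η = Real.exp η := by rw [phi, abs_of_neg h, neg_neg]
      have a4 : phi' η = Real.exp η := by rw [phi', Real.sign_of_neg h, abs_of_neg h]; simp
      have a5 : Real.exp (3 * η) = Real.exp η ^ 3 := by rw [← Real.exp_nat_mul]; norm_num
      rw [a1, a2, a3, a4, a5]
      simp only [Complex.real_smul]
      push_cast
      ring
    · rw [indicator_of_notMem (s := Iio 0) (by simp; linarith)]
      have a3 : phi η = Real.exp (-η) := by rw [phi, abs_of_pos h]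
      have a4 : phi' η = -Real.exp (-η) := by rw [phi', Real.sign_of_pos h, abs_of_pos h]; simp
      rcases lt_or_gt_of_ne h1 with h' | h'
      · rw [indicator_of_notMem (by simp; linarith)]
        have a1 : phi (ξ - η) = Real.exp (-(ξ - η)) := by rw [phi, abs_of_pos (by linarith)]
        have a2 : phi' (ξ - η) = -Real.exp (-(ξ - η)) := by
          rw [phi', Real.sign_of_pos (by linarith), abs_of_pos (by linarith)]; simp
        rw [a1, a2, a3, a4]
        simp only [Complex.real_smul]
        push_cast
        ring
      · rw [indicator_of_mem (by simpa using h')]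
        have a1 : phi (ξ - η) = Real.exp ξ * Real.exp (-η) := by
          rw [phi, abs_of_neg (by linarith), ← Real.exp_add]; congr 1; ring
        have a2 : phi' (ξ - η) = Real.exp ξ * Real.exp (-η) := by
          rw [phi', Real.sign_of_neg (by linarith), abs_of_neg (by linarith), ← Real.exp_add, neg_neg,
            one_mul]
          congr 1; ring
        have a5 : Real.exp (-3 * η) = Real.exp (-η) ^ 3 := by
          rw [← Real.exp_nat_mul]; congr 1; push_cast; ring
        rw [a1, a2, a3, a4, a5]
        simp only [Complex.real_smul]
        push_cast
        ring
  · exact (integrable_indicator_iff measurableSet_Ioi).2 (j₁.const_mul _)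
  · exact (integrable_indicator_iff measurableSet_Iio).2 (j₃.const_mul _)

/-! ### Compactness of the nonlocal term -/

/-- A square-integrable family of functionals defines a compact operator on `L²` (an operator of
Hilbert–Schmidt type): it is a limit of operators of finite rank. -/
theorem isCompactOperator_compLpL₂_flip (K : Lp (H →L[ℂ] ℂ) 2 (volume : Measure ℝ)) :
    IsCompactOperator
      ((ContinuousLinearMap.compLpL₂ 2 (volume : Measure ℝ)
        (ContinuousLinearMap.id ℂ (H →L[ℂ] ℂ)).flip).flip K) := by
  set op := (ContinuousLinearMap.compLpL₂ 2 (volume : Measure ℝ)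
        (ContinuousLinearMap.id ℂ (H →L[ℂ] ℂ)).flip).flip with hop
  induction K using Lp.induction (by simp : (2 : ENNReal) ≠ ⊤) with
  | @indicatorConst c s hs hμ =>
    -- a simple function `1_s c` defines the operator `v ↦ c(v) 1_s` of rank one
    set e : H := indicatorConstLp 2 hs hμ.ne (1 : ℂ)
    have h1 : IsCompactOperator ((ContinuousLinearMap.toSpanSingleton ℂ e) ∘ c) :=
      (isCompactOperator_of_locallyCompactSpace_dom c).clm_comp _
    convert! h1 using 1
    funext v
    refine Lp.ext ?_
    simp only [Function.comp_apply, hop, ContinuousLinearMap.flip_apply,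
      ContinuousLinearMap.compLpL₂_apply_apply, ContinuousLinearMap.toSpanSingleton_apply]
    rw [Lp.simpleFunc.coe_indicatorConst]
    filter_upwards [ContinuousLinearMap.coeFn_compLp
      ((ContinuousLinearMap.id ℂ (H →L[ℂ] ℂ)).flip v) (indicatorConstLp 2 hs hμ.ne c),
      indicatorConstLp_coeFn (p := 2) (hs := hs) (hμs := hμ.ne) (c := c),
      Lp.coeFn_smul (c v) e,
      indicatorConstLp_coeFn (p := 2) (hs := hs) (hμs := hμ.ne) (c := (1 : ℂ))] with x h1 h2 h3 h4
    rw [h1, h2, h3, Pi.smul_apply, h4]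
    by_cases hx : x ∈ s <;> simp [hx]
  | add hf hg _ h1 h2 =>
    rw [map_add]
    exact h1.add h2
  | isClosed =>
    exact isClosed_setOfPred_isCompactOperator.preimage op.continuous

theorem integral_norm_smul_le {f : ℝ → ℝ} {v : ℝ → ℂ} (hf : MemLp f 2 (volume : Measure ℝ))
    (hv : MemLp v 2 (volume : Measure ℝ)) :
    ∫ x, ‖f x • v x‖ ≤ (eLpNorm f 2 volume).toReal * (eLpNorm v 2 volume).toReal := by
  change ∫ x, ‖(f • v) x‖ ≤ _
  rw [integral_norm_eq_lintegral_enorm (hf.1.smul hv.1), ← eLpNorm_one_eq_lintegral_enorm,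
    ← ENNReal.toReal_mul]
  exact ENNReal.toReal_mono (ENNReal.mul_ne_top hf.2.ne hv.2.ne)
    (eLpNorm_smul_le_mul_eLpNorm hv.1 hf.1)

theorem norm_kernel_le {k a : ℝ → ℝ} (hkm : Measurable k) (ham : Measurable a)
    (hk : ∀ η, |k η| ≤ phi η) (ha : ∀ η, |a η| ≤ 2 * phi η ^ 2)
    {v : ℝ → ℂ} (hv : MemLp v 2 (volume : Measure ℝ)) (ξ : ℝ) :
    ‖∫ η, k (ξ - η) • a η • v η‖ ≤ 2 * phi ξ * ∫ η, ‖phi η • v η‖ := by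
  refine (norm_integral_le_integral_norm _).trans ?_
  rw [← integral_const_mul]
  exact integral_mono (integrable_kernel hkm ham hk ha hv ξ).norm
    ((integrable_smul_of_memLp memLp_phi hv).norm.const_mul (2 * phi ξ))
    (fun η => kernel_bound hk ha v ξ η)

theorem norm_qFun_le {v : ℝ → ℂ} (hv : MemLp v 2 (volume : Measure ℝ)) (ξ : ℝ) :
    ‖qFun v ξ‖ ≤ 6 * (eLpNorm phi 2 volume).toReal * phi ξ * (eLpNorm v 2 volume).toReal := by
  have h1 := norm_kernel_le measurable_phi measurable_weight₁ abs_phi_le weight_bound₁ hv ξ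
  have h2 := norm_kernel_le measurable_phi' measurable_weight₂ abs_phi'_le weight_bound₂ hv ξ
  have h3 := mul_le_mul_of_nonneg_left (integral_norm_smul_le memLp_phi hv) (phi_nonneg ξ)
  rw [qFun_eq]
  refine (norm_sub_le _ _).trans ?_
  rw [norm_mul, RCLike.norm_ofNat]
  nlinarith

theorem memLp_indicator_phi_pow {s : Set ℝ} (hs : MeasurableSet s) :
    MemLp (s.indicator fun η => ((phi η ^ 3 : ℝ) : ℂ)) 2 (volume : Measure ℝ) := by
  refine MemLp.indicator hs ?_
  refine memLp_phi.of_le_mul (c := 1) (by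
    exact (Complex.continuous_ofReal.comp (continuous_phi.pow 3)).aestronglyMeasurable) ?_
  refine Eventually.of_forall fun x => ?_
  rw [Complex.norm_real, Real.norm_of_nonneg (pow_nonneg (phi_nonneg x) 3),
    Real.norm_of_nonneg (phi_nonneg x), one_mul]
  exact pow_le_of_le_one (phi_nonneg x) (phi_le_one x) (by norm_num)

/-- The vector `1_s φ³` of `L²`. -/
def cutPhi (s : Set ℝ) (hs : MeasurableSet s) : H := (memLp_indicator_phi_pow hs).toLp _

theorem inner_cutPhi {s : Set ℝ} (hs : MeasurableSet s) (v : H) :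
    inner ℂ (cutPhi s hs) v = ∫ η in s, phi η ^ 3 • v η := by
  rw [L2.inner_def, ← integral_indicator hs]
  refine integral_congr_ae ?_
  filter_upwards [(memLp_indicator_phi_pow hs).coeFn_toLp] with η hη
  rw [cutPhi, hη]
  by_cases h : η ∈ s
  · simp [h, mul_comm]
  · simp [h]

theorem inner_cutPhi_Ioi (v : H) {t : ℝ} (ht : 0 ≤ t) :
    inner ℂ (cutPhi (Ioi t) measurableSet_Ioi) v = tail v t := by
  rw [inner_cutPhi, tail]
  refine setIntegral_congr_fun measurableSet_Ioi fun η hη => ?_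
  have h : 0 < η := ht.trans_lt hη
  rw [phi, abs_of_pos h, ← Real.exp_nat_mul]
  congr 2
  push_cast; ring

theorem inner_cutPhi_Iio (v : H) {t : ℝ} (ht : t ≤ 0) :
    inner ℂ (cutPhi (Iio t) measurableSet_Iio) v = tail (fun η => v (-η)) (-t) := by
  rw [inner_cutPhi, tail, ← integral_Iic_eq_integral_Iio, ← neg_neg t, ← integral_comp_neg_Ioi,
    neg_neg]
  refine setIntegral_congr_fun measurableSet_Ioi fun η hη => ?_
  have h : 0 < η := lt_of_le_of_lt (by linarith) (mem_Ioi.1 hη)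
  rw [phi_neg, phi, abs_of_pos h, ← Real.exp_nat_mul]
  congr 2
  push_cast; ring

/-- If `s` and `s'` differ only between `a` and `b`, then `1_s φ³` and `1_{s'} φ³` are close,
because `φ ≤ 1`. -/
theorem norm_cutPhi_sub_le {s s' : Set ℝ} (hs : MeasurableSet s) (hs' : MeasurableSet s')
    {a b : ℝ} (h : ∀ x, x ∉ uIcc a b → (x ∈ s ↔ x ∈ s')) :
    ‖cutPhi s hs - cutPhi s' hs'‖ ≤ |b - a| ^ (1 / 2 : ℝ) := by
  have hm : MeasurableSet (uIcc a b) := measurableSet_uIcc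
  have hf : volume (uIcc a b) ≠ ⊤ := isCompact_uIcc.measure_ne_top
  have h1 : ‖cutPhi s hs - cutPhi s' hs'‖ ≤ ‖indicatorConstLp 2 hm hf (1 : ℂ)‖ := by
    refine Lp.norm_le_norm_of_ae_le ?_
    filter_upwards [(memLp_indicator_phi_pow hs).coeFn_toLp,
      (memLp_indicator_phi_pow hs').coeFn_toLp, Lp.coeFn_sub (cutPhi s hs) (cutPhi s' hs'),
      indicatorConstLp_coeFn (p := 2) (hs := hm) (hμs := hf) (c := (1 : ℂ))] with x h1 h2 h3 h4
    rw [h3, h4, Pi.sub_apply, cutPhi, cutPhi, h1, h2]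
    have hb : ‖((phi x ^ 3 : ℝ) : ℂ)‖ ≤ 1 := by
      rw [Complex.norm_real, Real.norm_of_nonneg (pow_nonneg (phi_nonneg x) 3)]
      exact pow_le_one₀ (phi_nonneg x) (phi_le_one x)
    by_cases hx : x ∈ uIcc a b
    · rw [indicator_of_mem hx]
      by_cases a1 : x ∈ s <;> by_cases a2 : x ∈ s' <;> simp only [a1, a2, indicator_of_mem, not_false_eq_true,
        indicator_of_notMem, sub_self, sub_zero, zero_sub, norm_neg, norm_zero, norm_one] <;>
        first | exact hb | exact zero_le_one
    · by_cases a1 : x ∈ s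
      · simp [a1, (h x hx).1 a1]
      · have a2 : x ∉ s' := fun h' => a1 ((h x hx).2 h')
        simp [a1, a2]
  refine h1.trans (le_of_eq ?_)
  rw [norm_indicatorConstLp (by norm_num) (by norm_num), norm_one, one_mul, measureReal_def,
    Real.volume_interval, ENNReal.toReal_ofReal (abs_nonneg _)]
  norm_num

theorem continuous_of_norm_sub_le_sqrt {E : Type*} [NormedAddCommGroup E] {f : ℝ → E}
    (h : ∀ a b, ‖f b - f a‖ ≤ |b - a| ^ (1 / 2 : ℝ)) : Continuous f := by
  rw [continuous_iff_continuousAt]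
  intro a
  rw [ContinuousAt, tendsto_iff_norm_sub_tendsto_zero]
  refine squeeze_zero (fun _ => norm_nonneg _) (fun b => h a b) ?_
  have : Continuous fun b : ℝ => |b - a| ^ (1 / 2 : ℝ) :=
    (continuous_id.sub continuous_const).abs.rpow_const fun _ => Or.inr (by norm_num)
  simpa using this.tendsto a

/-- The functional `v ↦ (φ * ((φ²)' v) - 2 φ' * (φ² v))(ξ)`, for `ξ ≠ 0`. In terms of
`tail v ξ = ⟨1_{(ξ, ∞)} φ³, v⟩`, `ξ ≥ 0`, it is given by `qFun_of_pos` and its reflection; `max` and `min`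
combine the two signs of `ξ`. -/
def qDual (ξ : ℝ) : H →L[ℂ] ℂ :=
  (-4 * Real.exp ξ : ℂ) • innerSL ℂ (cutPhi (Ioi (max 0 ξ)) measurableSet_Ioi) +
    (4 * Real.exp (-ξ) : ℂ) • innerSL ℂ (cutPhi (Iio (min 0 ξ)) measurableSet_Iio)

theorem qDual_apply (v : H) {ξ : ℝ} (hξ : ξ ≠ 0) : qDual ξ v = qFun v ξ := by
  simp only [qDual, add_apply, smul_apply,
    innerSL_apply_apply, smul_eq_mul]
  rw [inner_cutPhi_Ioi v (le_max_left _ _), inner_cutPhi_Iio v (min_le_left _ _)]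
  rcases lt_or_gt_of_ne hξ with h | h
  · rw [max_eq_left h.le, min_eq_right h.le]
    have := qFun_neg v (-ξ)
    rw [neg_neg, qFun_of_pos (memLp_comp_neg (Lp.memLp v)) (neg_pos.2 h)] at this
    simp only [neg_neg] at this
    linear_combination -this
  · rw [max_eq_right h.le, min_eq_left h.le, qFun_of_pos (Lp.memLp v) h, neg_zero]

/-- Continuity in the operator norm is what makes `qDual` strongly measurable, hence an element of
`L²` with values in the dual of `H`. -/
theorem continuous_qDual : Continuous qDual := by
  have c1 : Continuous fun t : ℝ => cutPhi (Ioi t) measurableSet_Ioi := by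
    refine continuous_of_norm_sub_le_sqrt fun a b => norm_cutPhi_sub_le _ _ fun x hx => ?_
    simp only [mem_Ioi]
    constructor
    · intro h
      by_contra h'
      exact hx (Icc_subset_uIcc' ⟨h.le, not_lt.1 h'⟩)
    · intro h
      by_contra h'
      exact hx (Icc_subset_uIcc ⟨h.le, not_lt.1 h'⟩)
  have c2 : Continuous fun t : ℝ => cutPhi (Iio t) measurableSet_Iio := by
    refine continuous_of_norm_sub_le_sqrt fun a b => norm_cutPhi_sub_le _ _ fun x hx => ?_
    simp only [mem_Iio]
    constructor
    · intro h
      by_contra h'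
      exact hx (Icc_subset_uIcc ⟨not_lt.1 h', h.le⟩)
    · intro h
      by_contra h'
      exact hx (Icc_subset_uIcc' ⟨not_lt.1 h', h.le⟩)
  have d1 : Continuous fun ξ : ℝ => innerSL ℂ (cutPhi (Ioi (max 0 ξ)) measurableSet_Ioi) :=
    (innerSL ℂ (E := H)).continuous.comp (c1.comp (continuous_const.max continuous_id))
  have d2 : Continuous fun ξ : ℝ => innerSL ℂ (cutPhi (Iio (min 0 ξ)) measurableSet_Iio) :=
    (innerSL ℂ (E := H)).continuous.comp (c2.comp (continuous_const.min continuous_id))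
  unfold qDual
  have e1 : Continuous fun ξ : ℝ => (-4 * Real.exp ξ : ℂ) := by fun_prop
  have e2 : Continuous fun ξ : ℝ => (4 * Real.exp (-ξ) : ℂ) := by fun_prop
  exact (e1.smul d1).add (e2.smul d2)

theorem memLp_qDual : MemLp qDual 2 (volume : Measure ℝ) := by
  refine memLp_phi.of_le_mul (c := 6 * (eLpNorm phi 2 volume).toReal)
    continuous_qDual.aestronglyMeasurable ?_
  have n0 : ∀ᵐ η : ℝ, η ≠ 0 := by simp [ae_iff]
  filter_upwards [n0] with ξ hξ
  refine ContinuousLinearMap.opNorm_le_bound _ (by positivity) fun v => ?_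
  rw [qDual_apply v hξ, Real.norm_of_nonneg (phi_nonneg ξ), Lp.norm_def]
  exact norm_qFun_le (Lp.memLp v) ξ

/-- The nonlocal term as a bounded operator. -/
def qCLM : H →L[ℂ] H :=
  (ContinuousLinearMap.compLpL₂ 2 (volume : Measure ℝ)
    (ContinuousLinearMap.id ℂ (H →L[ℂ] ℂ)).flip).flip (memLp_qDual.toLp _)

theorem qCLM_apply (v : H) : qCLM v = qMap v := by
  refine Lp.ext ?_
  have n0 : ∀ᵐ η : ℝ, η ≠ 0 := by simp [ae_iff]
  filter_upwards [n0, (memLp_qFun (Lp.memLp v)).coeFn_toLp, memLp_qDual.coeFn_toLp,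
    ContinuousLinearMap.coeFn_compLp
      ((ContinuousLinearMap.id ℂ (H →L[ℂ] ℂ)).flip v) (memLp_qDual.toLp _)] with x h0 h1 h2 h3
  simp only [qCLM, ContinuousLinearMap.flip_apply, ContinuousLinearMap.compLpL₂_apply_apply]
  rw [h3, h2, qMap]
  simp only [LinearMap.coe_mk, AddHom.coe_mk]
  rw [h1, ← qDual_apply v h0]
  rfl

theorem isCompactOperator_qCLM : IsCompactOperator qCLM := isCompactOperator_compLpL₂_flip _

/-! ### The energy identity -/

open ComplexConjugate in
/-- The integrated form of `((1 - e^{-2t}) |V|²)' = 2 e^{-2t} |V|² + 2 Re (w V̄)`. -/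
theorem energy_sub {V w : ℝ → ℂ}
    (hw : LocallyIntegrableOn (fun η => (1 - Real.exp (-2 * η))⁻¹ • w η) (Ioi 0))
    (hV : ∀ s t, 0 < s → 0 < t → V t - V s = ∫ η in s..t, (1 - Real.exp (-2 * η))⁻¹ • w η)
    {s t : ℝ} (hs : 0 < s) (hst : s ≤ t) :
    (1 - Real.exp (-2 * t)) * ‖V t‖ ^ 2 - (1 - Real.exp (-2 * s)) * ‖V s‖ ^ 2 =
      ∫ η in s..t, (2 * (Real.exp (-2 * η) * ‖V η‖ ^ 2) + 2 * (w η * conj (V η)).re) := by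
  set g : ℝ → ℂ := fun η => (1 - Real.exp (-2 * η))⁻¹ • w η with hg
  have gi : ∀ x ∈ Icc s t, IntervalIntegrable g volume s x := fun x hx =>
    intervalIntegrable_of_locallyIntegrableOn_Ioi hw hs (hs.trans_le hx.1)
  have gci : ∀ x ∈ Icc s t, IntervalIntegrable (fun η => conj (g η)) volume s x := fun x hx =>
    ⟨(Complex.conjCLE : ℂ →L[ℝ] ℂ).integrable_comp (gi x hx).1,
      (Complex.conjCLE : ℂ →L[ℝ] ℂ).integrable_comp (gi x hx).2⟩
  have hF : ∀ x ∈ Icc s t, V x = V s + ∫ η in s..x, g η := fun x hx => by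
    rw [← hV s x hs (hs.trans_le hx.1)]; ring
  have hG : ∀ x ∈ Icc s t, conj (V x) = conj (V s) + ∫ η in s..x, conj (g η) := fun x hx => by
    rw [hF x hx, map_add, intervalIntegral.integral_of_le hx.1, intervalIntegral.integral_of_le hx.1,
      integral_conj]
  have ht : t ∈ Icc s t := ⟨hst, le_rfl⟩
  have cV : ContinuousOn V (Icc s t) := (continuousOn_of_eq_integral hw hV).mono
    fun x hx => hs.trans_le hx.1
  have ip : ∀ x ∈ Icc s t,
      IntervalIntegrable (fun η => g η * conj (V η) + V η * conj (g η)) volume s x := by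
    intro x hx
    have cV' : ContinuousOn V (uIcc s x) := by
      rw [uIcc_of_le hx.1]; exact cV.mono (Icc_subset_Icc_right hx.2)
    exact ((gi x hx).mul_continuousOn (Complex.continuous_conj.comp_continuousOn cV')).add
      ((gci x hx).continuousOn_mul cV')
  have hP : ∀ x ∈ Icc s t, V x * conj (V x) = V s * conj (V s) +
      ∫ η in s..x, (g η * conj (V η) + V η * conj (g η)) := by
    intro x hx
    rw [← mul_sub_mul_eq_integral hx.1 (gi x hx) (gci x hx)
      (fun y hy => hF y ⟨hy.1, hy.2.trans hx.2⟩) (fun y hy => hG y ⟨hy.1, hy.2.trans hx.2⟩)]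
    ring
  have hX : ∀ x ∈ Icc s t, ((1 - Real.exp (-2 * x) : ℝ) : ℂ) = ((1 - Real.exp (-2 * s) : ℝ) : ℂ) +
      ∫ η in s..x, ((2 * Real.exp (-2 * η) : ℝ) : ℂ) := by
    intro x hx
    rw [intervalIntegral.integral_ofReal, intervalIntegral.integral_eq_sub_of_hasDerivAt
      (fun y _ => hasDerivAt_one_sub_exp y) (by
        exact (by fun_prop : Continuous fun η : ℝ => 2 * Real.exp (-2 * η)).intervalIntegrable _ _)]
    push_cast; ring
  have iX : IntervalIntegrable (fun η : ℝ => ((2 * Real.exp (-2 * η) : ℝ) : ℂ)) volume s t :=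
    (by fun_prop : Continuous fun η : ℝ => ((2 * Real.exp (-2 * η) : ℝ) : ℂ)).intervalIntegrable _ _
  have key := mul_sub_mul_eq_integral hst iX (ip t ht) hX hP
  have iN : IntervalIntegrable (fun η => ((2 * Real.exp (-2 * η) : ℝ) : ℂ) * (V η * conj (V η)) +
      ((1 - Real.exp (-2 * η) : ℝ) : ℂ) * (g η * conj (V η) + V η * conj (g η))) volume s t := by
    rw [← uIcc_of_le hst] at cV
    exact (iX.mul_continuousOn (cV.mul (Complex.continuous_conj.comp_continuousOn cV))).add
      ((ip t ht).continuousOn_mul (by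
        exact (by fun_prop : Continuous fun η : ℝ =>
          ((1 - Real.exp (-2 * η) : ℝ) : ℂ)).continuousOn))
  have key2 := congrArg Complex.reCLM key
  rw [← Complex.reCLM.intervalIntegral_comp_comm iN] at key2
  simp only [Complex.mul_conj, Complex.normSq_eq_norm_sq, Complex.reCLM_apply, ← Complex.ofReal_mul,
    ← Complex.ofReal_sub, Complex.ofReal_re, Complex.add_re, Complex.re_ofReal_mul] at key2
  rw [key2]
  refine intervalIntegral.integral_congr fun η hη => ?_
  rw [uIcc_of_le hst] at hη
  have k := (one_sub_exp_pos (hs.trans_le hη.1)).ne'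
  have e1 : (V η * conj (g η)).re = (g η * conj (V η)).re := by
    simp only [Complex.mul_re, Complex.conj_re, Complex.conj_im]; ring
  have e2 : (g η * conj (V η)).re = (1 - Real.exp (-2 * η))⁻¹ * (w η * conj (V η)).re := by
    rw [hg]; simp only [Complex.real_smul, mul_assoc, Complex.re_ofReal_mul]
  simp only [e1, e2]
  generalize Real.exp (-2 * η) = E at k
  field_simp
  ring

/-- If `N` is integrable, then `(1 - e^{-2t}) N(t)` can only tend to `0` at `0`, as `1 / t` is not
integrable there. -/
theorem eq_zero_of_tendsto_nhdsGT {Y N : ℝ → ℝ} {l : ℝ} (hN : IntegrableOn N (Ioi 0))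
    (hY : ∀ t, 0 < t → Y t = (1 - Real.exp (-2 * t)) * N t) (h0 : ∀ t, 0 ≤ N t)
    (hl : Tendsto Y (𝓝[>] 0) (𝓝 l)) : l = 0 := by
  have hpos : 0 ≤ l := ge_of_tendsto hl (by
    filter_upwards [self_mem_nhdsWithin] with t ht
    rw [hY t ht]; exact mul_nonneg (one_sub_exp_pos ht).le (h0 t))
  by_contra hne
  have hl0 : 0 < l := lt_of_le_of_ne hpos (Ne.symm hne)
  obtain ⟨ε, hε, H⟩ := mem_nhdsGT_iff_exists_Ioo_subset.1 (hl.eventually_const_lt (half_lt_self hl0))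
  have hε' : (0 : ℝ) < ε := hε
  have hi : IntegrableOn (fun t : ℝ => t⁻¹) (Ioo 0 ε) := by
    refine ((hN.mono_set Ioo_subset_Ioi_self).const_mul (4 / l)).mono'
      (measurable_inv.aestronglyMeasurable) ?_
    filter_upwards [ae_restrict_mem measurableSet_Ioo] with t ht
    have h1 : l / 2 < Y t := H ht
    rw [hY t ht.1] at h1
    have h2 : 1 - Real.exp (-2 * t) ≤ 2 * t := by
      have := Real.add_one_le_exp (-2 * t); linarith
    have h3 : l / 2 < 2 * t * N t := h1.trans_le (mul_le_mul_of_nonneg_right h2 (h0 t))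
    rw [Real.norm_of_nonneg (inv_nonneg.2 ht.1.le), inv_le_iff_one_le_mul₀ ht.1]
    have : 4 / l * N t * t = (2 * t * N t) / (l / 2) := by field_simp; ring
    rw [this, le_div_iff₀ (by linarith)]
    linarith
  have := (intervalIntegral.integrableOn_Ioo_rpow_iff (s := -1) hε').1
    (hi.congr_fun (fun t ht => (Real.rpow_neg_one t).symm) measurableSet_Ioo)
  linarith

theorem eq_zero_of_tendsto_atTop {Y N : ℝ → ℝ} {l : ℝ} (hN : IntegrableOn N (Ioi 0))
    (hY : ∀ t, 0 < t → Y t = (1 - Real.exp (-2 * t)) * N t) (h0 : ∀ t, 0 ≤ N t)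
    (hl : Tendsto Y atTop (𝓝 l)) : l = 0 := by
  have hpos : 0 ≤ l := ge_of_tendsto hl (by
    filter_upwards [eventually_gt_atTop 0] with t ht
    rw [hY t ht]; exact mul_nonneg (one_sub_exp_pos ht).le (h0 t))
  by_contra hne
  have hl0 : 0 < l := lt_of_le_of_ne hpos (Ne.symm hne)
  obtain ⟨a, ha⟩ := eventually_atTop.1 (hl.eventually_const_lt (half_lt_self hl0))
  have hi : IntegrableOn (fun _ : ℝ => l / 2) (Ioi (max a 0)) := by
    refine (hN.mono_set (Ioi_subset_Ioi (le_max_right a 0))).mono'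
      aestronglyMeasurable_const ?_
    filter_upwards [ae_restrict_mem measurableSet_Ioi] with t ht
    have t0 : 0 < t := (le_max_right a 0).trans_lt ht
    have h1 := ha t ((le_max_left a 0).trans (le_of_lt ht))
    rw [hY t t0] at h1
    rw [Real.norm_of_nonneg (by linarith)]
    refine h1.le.trans (mul_le_of_le_one_left (h0 t) ?_)
    linarith [Real.exp_pos (-2 * t)]
  rw [integrableOn_const_iff (by simp)] at hi
  rcases hi with h | h
  · simp at h; linarith
  · simp at h

theorem exists_tendsto_of_sub_eq_integral {E : Type*} [NormedAddCommGroup E] [NormedSpace ℝ E]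
    [CompleteSpace E] {Y n : ℝ → E} (ni : IntegrableOn n (Ioi 0))
    (hsub : ∀ s t, 0 < s → s ≤ t → Y t - Y s = ∫ η in s..t, n η) :
    ∃ l₀ l₁, Tendsto Y (𝓝[>] 0) (𝓝 l₀) ∧ Tendsto Y atTop (𝓝 l₁) ∧
      l₁ - l₀ = ∫ η in Ioi (0 : ℝ), n η := by
  have n1 : IntegrableOn n (Ioi 1) := ni.mono_set (Ioi_subset_Ioi zero_le_one)
  have t1 : Tendsto Y atTop (𝓝 (Y 1 + ∫ η in Ioi 1, n η)) := by
    refine (tendsto_const_nhds.add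
      (intervalIntegral_tendsto_integral_Ioi 1 n1 tendsto_id)).congr' ?_
    filter_upwards [eventually_ge_atTop 1] with t ht
    rw [id, ← hsub 1 t one_pos ht]; abel
  have t0 : Tendsto Y (𝓝[>] 0) (𝓝 (Y 1 - ∫ η in (0 : ℝ)..1, n η)) := by
    have c := intervalIntegral.continuousOn_primitive_interval_left (f := n) (μ := volume) (a := 0)
      (b := 1) (by rw [uIcc_of_le zero_le_one]; exact (integrableOn_Icc_iff_integrableOn_Ioc).2
                    (ni.mono_set Ioc_subset_Ioi_self))
    have c0 := c 0 left_mem_uIcc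
    rw [uIcc_of_le (zero_le_one (α := ℝ))] at c0
    have c1 : Tendsto (fun s => ∫ η in s..1, n η) (𝓝[>] 0) (𝓝 (∫ η in (0 : ℝ)..1, n η)) :=
      c0.mono_left (nhdsWithin_le_of_mem
        (mem_of_superset (Ioo_mem_nhdsGT zero_lt_one) Ioo_subset_Icc_self))
    refine (tendsto_const_nhds.sub c1).congr' ?_
    filter_upwards [Ioo_mem_nhdsGT (zero_lt_one (α := ℝ))] with t ht
    rw [← hsub t 1 ht.1 ht.2.le]; abel
  refine ⟨_, _, t0, t1, ?_⟩
  rw [← intervalIntegral.integral_interval_add_Ioi ni n1]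
  abel

open ComplexConjugate in
theorem integrable_energy {V w : ℝ → ℂ} (hV : MemLp V 2 (volume.restrict (Ioi (0 : ℝ))))
    (hw : MemLp w 2 (volume.restrict (Ioi (0 : ℝ)))) :
    IntegrableOn (fun η => ‖V η‖ ^ 2) (Ioi 0) ∧
    IntegrableOn (fun η => Real.exp (-2 * η) * ‖V η‖ ^ 2) (Ioi 0) ∧
    IntegrableOn (fun η => (w η * conj (V η)).re) (Ioi 0) := by
  have h1 : IntegrableOn (fun η => ‖V η‖ ^ 2) (Ioi 0) := hV.integrable_norm_pow (by norm_num)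
  have h2 : IntegrableOn (fun η => ‖w η‖ ^ 2) (Ioi 0) := hw.integrable_norm_pow (by norm_num)
  refine ⟨h1, h1.mono' ?_ ?_, (h1.add h2).mono' ?_ ?_⟩
  · exact (by fun_prop : Continuous fun η : ℝ => Real.exp (-2 * η)).aestronglyMeasurable.mul
      h1.aestronglyMeasurable
  · filter_upwards [ae_restrict_mem measurableSet_Ioi] with η hη
    rw [Real.norm_of_nonneg (by positivity)]
    refine mul_le_of_le_one_left (by positivity) ?_
    linarith [one_sub_exp_pos hη]
  · exact Complex.continuous_re.comp_aestronglyMeasurable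
      (hw.1.mul (Complex.continuous_conj.comp_aestronglyMeasurable hV.1))
  · refine Eventually.of_forall fun η => ?_
    refine (Complex.abs_re_le_norm _).trans ?_
    rw [norm_mul, RCLike.norm_conj, Pi.add_apply]
    nlinarith [sq_nonneg (‖w η‖ - ‖V η‖), sq_nonneg (‖w η‖ + ‖V η‖)]

open ComplexConjugate in
/-- The weight `(1 - φ²) |V|²` vanishes at both ends of the half-line, which gives the energy
identity. -/
theorem energy_tendsto {V w : ℝ → ℂ} (hVm : MemLp V 2 (volume.restrict (Ioi (0 : ℝ))))
    (hw : MemLp w 2 (volume : Measure ℝ))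
    (hV : ∀ s t, 0 < s → 0 < t → V t - V s = ∫ η in s..t, (1 - Real.exp (-2 * η))⁻¹ • w η) :
    Tendsto (fun t => (1 - Real.exp (-2 * t)) * ‖V t‖ ^ 2) (𝓝[>] 0) (𝓝 0) ∧
    Tendsto (fun t => (1 - Real.exp (-2 * t)) * ‖V t‖ ^ 2) atTop (𝓝 0) ∧
    ∫ η in Ioi (0 : ℝ), (w η * conj (V η)).re =
      -∫ η in Ioi (0 : ℝ), Real.exp (-2 * η) * ‖V η‖ ^ 2 := by
  set Y : ℝ → ℝ := fun t => (1 - Real.exp (-2 * t)) * ‖V t‖ ^ 2 with hY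
  set n : ℝ → ℝ := fun η => 2 * (Real.exp (-2 * η) * ‖V η‖ ^ 2) + 2 * (w η * conj (V η)).re with hn
  obtain ⟨i1, i2, i3⟩ := integrable_energy hVm (hw.restrict (Ioi (0 : ℝ)))
  have ni : IntegrableOn n (Ioi 0) := (i2.const_mul 2).add (i3.const_mul 2)
  have hsub : ∀ {s t : ℝ}, 0 < s → s ≤ t → Y t - Y s = ∫ η in s..t, n η := fun hs hst =>
    energy_sub (locallyIntegrableOn_div_weight hw) hV hs hst
  obtain ⟨l₀, l₁, t0, t1, hl⟩ := exists_tendsto_of_sub_eq_integral ni fun _ _ => hsub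
  have z1 := eq_zero_of_tendsto_atTop i1 (fun t _ => rfl) (fun t => by positivity) t1
  have z0 := eq_zero_of_tendsto_nhdsGT i1 (fun t _ => rfl) (fun t => by positivity) t0
  refine ⟨z0 ▸ t0, z1 ▸ t1, ?_⟩
  have htot : ∫ η in Ioi (0 : ℝ), n η = 0 := by rw [← hl, z0, z1, sub_zero]
  rw [hn, integral_add (i2.const_mul 2) (i3.const_mul 2), integral_const_mul,
    integral_const_mul] at htot
  linarith

/-! ### The eigenvalue equation for functions -/

/-- The value which the equation `(L - z) v = f` forces on `(1 - φ²) v'`. -/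
def weightedDerivRHS (b : ℝ) (z : ℂ) (v f : ℝ → ℂ) (ξ : ℝ) : ℂ :=
  z * v ξ + f ξ - ((4 - b : ℝ) : ℂ) * (phi ξ * phi' ξ) • v ξ - ((b - 3 : ℝ) : ℂ) * qFun v ξ

/-- `v` solves `(L - z) v = f`, as an equation between square-integrable functions. -/
structure IsSol (b : ℝ) (z : ℂ) (v f : ℝ → ℂ) : Prop where
  memLp : MemLp v 2 (volume : Measure ℝ)
  memLp_source : MemLp f 2 (volume : Measure ℝ)
  isWeightedDeriv : IsWeightedDeriv v (weightedDerivRHS b z v f)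

theorem memLp_weightedDerivRHS (b : ℝ) (z : ℂ) {v f : ℝ → ℂ} (hv : MemLp v 2 (volume : Measure ℝ))
    (hf : MemLp f 2 (volume : Measure ℝ)) :
    MemLp (weightedDerivRHS b z v f) 2 (volume : Measure ℝ) :=
  (((hv.const_mul z).add hf).sub ((memLp_mul hv).const_mul _)).sub ((memLp_qFun hv).const_mul _)

theorem IsSol.memLp_rhs {b : ℝ} {z : ℂ} {v f : ℝ → ℂ} (h : IsSol b z v f) :
    MemLp (weightedDerivRHS b z v f) 2 (volume : Measure ℝ) :=
  memLp_weightedDerivRHS b z h.memLp h.memLp_source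

theorem weightedDeriv_spec (v : dom) : IsWeightedDeriv (v : H) (weightedDeriv v) :=
  v.2.choose_spec

theorem shift_L_apply (b : ℝ) (z : ℂ) (v : (L b).domain) :
    UnboundedSpectrum.shift (L b) z v =
      weightedDeriv v + (((4 - b : ℝ) : ℂ) • mulPhiPhi' (v : H) + Q b (v : H)) - z • (v : H) := rfl

theorem coeFn_mulPhiPhi' (v : H) : mulPhiPhi' v =ᵐ[volume] fun ξ => (phi ξ * phi' ξ) • v ξ :=
  (memLp_mul (Lp.memLp v)).coeFn_toLp

theorem coeFn_qMap (v : H) : qMap v =ᵐ[volume] qFun v := (memLp_qFun (Lp.memLp v)).coeFn_toLp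

theorem coeFn_shift (b : ℝ) (z : ℂ) (v : (L b).domain) :
    (UnboundedSpectrum.shift (L b) z v : H) =ᵐ[volume] fun ξ => weightedDeriv v ξ +
      (((4 - b : ℝ) : ℂ) * (phi ξ * phi' ξ) • (v : H) ξ + ((b - 3 : ℝ) : ℂ) * qFun (v : H) ξ) -
        z * (v : H) ξ := by
  rw [shift_L_apply]
  have e : Q b (v : H) = ((b - 3 : ℝ) : ℂ) • qMap (v : H) := rfl
  rw [e]
  filter_upwards [Lp.coeFn_sub (weightedDeriv v +
      (((4 - b : ℝ) : ℂ) • mulPhiPhi' (v : H) + ((b - 3 : ℝ) : ℂ) • qMap (v : H))) (z • (v : H)),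
    Lp.coeFn_add (weightedDeriv v)
      (((4 - b : ℝ) : ℂ) • mulPhiPhi' (v : H) + ((b - 3 : ℝ) : ℂ) • qMap (v : H)),
    Lp.coeFn_add (((4 - b : ℝ) : ℂ) • mulPhiPhi' (v : H)) (((b - 3 : ℝ) : ℂ) • qMap (v : H)),
    Lp.coeFn_smul ((4 - b : ℝ) : ℂ) (mulPhiPhi' (v : H)),
    Lp.coeFn_smul ((b - 3 : ℝ) : ℂ) (qMap (v : H)), Lp.coeFn_smul z (v : H),
    coeFn_mulPhiPhi' (v : H), coeFn_qMap (v : H)] with ξ h1 h2 h3 h4 h5 h6 h7 h8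
  rw [h1, Pi.sub_apply, h2, Pi.add_apply, h3, Pi.add_apply, h4, h5, h6]
  simp only [Pi.smul_apply, smul_eq_mul]
  rw [h7, h8]

theorem isSol_shift (b : ℝ) (z : ℂ) (v : (L b).domain) :
    IsSol b z (v : H) (UnboundedSpectrum.shift (L b) z v : H) := by
  refine ⟨Lp.memLp _, Lp.memLp _, (weightedDeriv_spec v).congr .rfl ?_⟩
  filter_upwards [coeFn_shift b z v] with ξ h
  rw [weightedDerivRHS, h]
  ring

theorem IsSol.exists_shift_eq {b : ℝ} {z : ℂ} {v f : ℝ → ℂ} (h : IsSol b z v f) :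
    ∃ u : (L b).domain, (u : H) =ᵐ[volume] v ∧
      (UnboundedSpectrum.shift (L b) z u : H) =ᵐ[volume] f := by
  have hv := h.memLp.coeFn_toLp
  have hw : IsWeightedDeriv (h.memLp.toLp v) (h.memLp_rhs.toLp _) :=
    h.isWeightedDeriv.congr hv.symm h.memLp_rhs.coeFn_toLp.symm
  let u : (L b).domain := ⟨h.memLp.toLp v, ⟨_, hw⟩⟩
  refine ⟨u, hv, ?_⟩
  have e : weightedDeriv u = h.memLp_rhs.toLp _ := (weightedDeriv_spec u).unique_Lp hw
  have eq : qFun (u : H) = qFun v := qFun_congr hv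
  have hv' : (u : H) =ᵐ[volume] v := hv
  filter_upwards [coeFn_shift b z u, h.memLp_rhs.coeFn_toLp, hv'] with ξ h1 h2 h3
  rw [h1, e, h2, h3, eq, weightedDerivRHS]
  ring

theorem IsSol.congr {b : ℝ} {z : ℂ} {v v' f f' : ℝ → ℂ} (h : IsSol b z v f) (hv : v =ᵐ[volume] v')
    (hf : f =ᵐ[volume] f') : IsSol b z v' f' := by
  refine ⟨h.memLp.ae_eq hv, h.memLp_source.ae_eq hf, h.isWeightedDeriv.congr hv ?_⟩
  filter_upwards [hv, hf] with ξ h1 h2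
  rw [weightedDerivRHS, weightedDerivRHS, h1, h2, qFun_congr hv]

/-- Reflection `ξ ↦ -ξ` turns `L` into `-L`. -/
theorem IsSol.comp_neg {b : ℝ} {z : ℂ} {v f : ℝ → ℂ} (h : IsSol b z v f) :
    IsSol b (-z) (fun ξ => v (-ξ)) (fun ξ => -f (-ξ)) := by
  refine ⟨memLp_comp_neg h.memLp, (memLp_comp_neg h.memLp_source).neg, ?_⟩
  convert! h.isWeightedDeriv.comp_neg using 1
  funext ξ
  rw [weightedDerivRHS, weightedDerivRHS, qFun_neg, phi_neg, phi'_neg]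
  simp only [mul_neg, neg_smul]
  ring

/-- On `(0, ∞)` the solutions of `(L - z) v = f` are primitives, and the only coupling with
`(-∞, 0)` is through one moment. -/
theorem IsSol.exists_halfLine {b : ℝ} {z : ℂ} {v f : ℝ → ℂ} (h : IsSol b z v f) :
    ∃ V : ℝ → ℂ, (∀ᵐ ξ, ξ ∈ Ioi (0 : ℝ) → v ξ = V ξ) ∧
      MemLp V 2 (volume.restrict (Ioi (0 : ℝ))) ∧
      (∀ s t, 0 < s → 0 < t → V t - V s =
        ∫ η in s..t, (1 - Real.exp (-2 * η))⁻¹ • weightedDerivRHS b z v f η) ∧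
      ∀ᵐ η, 0 < η → weightedDerivRHS b z v f η = (z + (4 - b) * Real.exp (-2 * η)) * V η + f η +
        4 * (b - 3) * Real.exp η * tail v η -
          4 * (b - 3) * Real.exp (-η) * tail (fun η => v (-η)) 0 := by
  obtain ⟨V, h1, h2⟩ := h.isWeightedDeriv.exists_primitive h.memLp h.memLp_rhs
  refine ⟨V, h1, ?_, h2, ?_⟩
  · refine (h.memLp.restrict (Ioi (0 : ℝ))).ae_eq ?_
    rw [EventuallyEq, ae_restrict_iff' measurableSet_Ioi]
    exact h1
  · filter_upwards [h1] with η hη h0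
    rw [weightedDerivRHS, qFun_of_pos h.memLp h0, phi_mul_phi'_of_pos h0, hη h0, Complex.real_smul]
    push_cast
    ring

/-! ### The energy estimate -/

open ComplexConjugate in
/-- The energy estimate on the half-line: by the energy identity, the real part of `∫ f₀ V̄` is
`-∫ (Re z + (5 - b) e^{-2η}) |V|²`, where the integrand has absolute value at least
`(|Re z| - |5 - b|) |V|²`. -/
theorem setIntegral_norm_sq_le {V f₀ w : ℝ → ℂ} {b : ℝ} {z : ℂ}
    (hVm : MemLp V 2 (volume.restrict (Ioi (0 : ℝ)))) (hw : MemLp w 2 (volume : Measure ℝ))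
    (hf : MemLp f₀ 2 (volume : Measure ℝ))
    (hV : ∀ s t, 0 < s → 0 < t → V t - V s = ∫ η in s..t, (1 - Real.exp (-2 * η))⁻¹ • w η)
    (he : ∀ᵐ η, 0 < η → w η = (z + (4 - b) * Real.exp (-2 * η)) * V η + f₀ η) :
    (|z.re| - |5 - b|) * ∫ η in Ioi (0 : ℝ), ‖V η‖ ^ 2 ≤
      ∫ η in Ioi (0 : ℝ), ‖f₀ η‖ * ‖V η‖ := by
  obtain ⟨i1, i2, i3⟩ := integrable_energy hVm (hw.restrict (Ioi (0 : ℝ)))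
  obtain ⟨-, -, j3⟩ := integrable_energy hVm (hf.restrict (Ioi (0 : ℝ)))
  have i4 : IntegrableOn (fun η => ‖f₀ η‖ * ‖V η‖) (Ioi 0) := by
    have := MemLp.integrable_mul (hf.restrict (Ioi (0 : ℝ))).norm hVm.norm
    exact this
  obtain ⟨-, -, he3⟩ := energy_tendsto hVm hw hV
  have e1 : ∫ η in Ioi (0 : ℝ), (f₀ η * conj (V η)).re =
      -∫ η in Ioi (0 : ℝ), (z.re * ‖V η‖ ^ 2 + (5 - b) * (Real.exp (-2 * η) * ‖V η‖ ^ 2)) := by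
    have k1 : ∫ η in Ioi (0 : ℝ), (f₀ η * conj (V η)).re =
        ∫ η in Ioi (0 : ℝ), ((w η * conj (V η)).re -
          (z.re * ‖V η‖ ^ 2 + (4 - b) * (Real.exp (-2 * η) * ‖V η‖ ^ 2))) := by
      refine setIntegral_congr_ae measurableSet_Ioi ?_
      filter_upwards [he] with η h h0
      rw [h h0, add_mul, Complex.add_re, mul_assoc, Complex.mul_conj, Complex.normSq_eq_norm_sq]
      rw [mul_comm (z + _), Complex.re_ofReal_mul, Complex.add_re]
      have : ((4 - b : ℂ) * (Real.exp (-2 * η) : ℂ)).re = (4 - b) * Real.exp (-2 * η) := by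
        rw [← Complex.ofReal_ofNat, ← Complex.ofReal_sub, ← Complex.ofReal_mul, Complex.ofReal_re]
      rw [this]; ring
    rw [k1, integral_sub i3 (g := fun η => z.re * ‖V η‖ ^ 2 + (4 - b) * (Real.exp (-2 * η) * ‖V η‖ ^ 2))
      ((i1.const_mul _).add (i2.const_mul _)), he3,
      integral_add (i1.const_mul _) (i2.const_mul _), integral_add (i1.const_mul _) (i2.const_mul _),
      integral_const_mul, integral_const_mul, integral_const_mul]
    ring
  have e2 : |∫ η in Ioi (0 : ℝ), (f₀ η * conj (V η)).re| ≤
      ∫ η in Ioi (0 : ℝ), ‖f₀ η‖ * ‖V η‖ := by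
    refine (norm_integral_le_integral_norm (G := ℝ) _).trans ?_
    refine integral_mono j3.norm i4 fun η => ?_
    refine (Complex.abs_re_le_norm _).trans ?_
    rw [norm_mul, RCLike.norm_conj]
  refine le_trans ?_ e2
  rw [e1, abs_neg, ← integral_const_mul]
  rcases le_total 0 z.re with hz | hz
  · refine le_trans (setIntegral_mono_on (i1.const_mul _) ((i1.const_mul _).add (i2.const_mul _))
      measurableSet_Ioi fun η hη => ?_) (le_abs_self _)
    rw [abs_of_nonneg hz, Pi.add_apply]
    have h1 := one_sub_exp_pos hη
    have h2 : -|5 - b| ≤ (5 - b) * Real.exp (-2 * η) := by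
      have := neg_abs_le (5 - b)
      nlinarith [Real.exp_pos (-2 * η), abs_nonneg (5 - b)]
    nlinarith [sq_nonneg ‖V η‖]
  · rw [← abs_neg (∫ _ in _, _), ← integral_neg]
    refine le_trans (setIntegral_mono_on (i1.const_mul _) ((i1.const_mul _).add (i2.const_mul _)).neg
      measurableSet_Ioi fun η hη => ?_) (le_abs_self _)
    rw [abs_of_nonpos hz, Pi.neg_apply, Pi.add_apply]
    have h1 := one_sub_exp_pos hη
    have h2 : (5 - b) * Real.exp (-2 * η) ≤ |5 - b| := by
      have := le_abs_self (5 - b)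
      nlinarith [Real.exp_pos (-2 * η), abs_nonneg (5 - b)]
    nlinarith [sq_nonneg ‖V η‖]

theorem integral_eq_Ioi_add_Ioi_neg {N : ℝ → ℝ} (hN : Integrable N) :
    ∫ η, N η = (∫ η in Ioi (0 : ℝ), N η) + ∫ η in Ioi (0 : ℝ), N (-η) := by
  rw [integral_comp_neg_Ioi, neg_zero, add_comm, intervalIntegral.integral_Iic_add_Ioi
    hN.integrableOn hN.integrableOn]

/-- The local part `L₀ = L - Q` satisfies `‖(L₀ - z) v‖ ≥ (|Re z| - |5 - b|) ‖v‖`: the real part of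
`⟨L₀ v, v⟩` is `(5 - b) ∫ φ φ' |v|²`, and `|φ φ'| ≤ 1`. -/
theorem le_norm_shift_sub_Q (b : ℝ) (z : ℂ) (v : (L b).domain) :
    (|z.re| - |5 - b|) * ‖(v : H)‖ ≤ ‖UnboundedSpectrum.shift (L b) z v - Q b (v : H)‖ := by
  set f₀ : H := UnboundedSpectrum.shift (L b) z v - Q b (v : H) with hf₀
  set f : H := UnboundedSpectrum.shift (L b) z v with hf
  have hs := isSol_shift b z v
  have hq : Q b (v : H) = ((b - 3 : ℝ) : ℂ) • qMap (v : H) := rfl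
  have hff : ∀ᵐ η, f₀ η = f η - ((b - 3 : ℝ) : ℂ) * qFun (v : H) η := by
    filter_upwards [Lp.coeFn_sub f (Q b (v : H)), coeFn_qMap (v : H),
      Lp.coeFn_smul ((b - 3 : ℝ) : ℂ) (qMap (v : H))] with η h1 h2 h3
    rw [hf₀, h1, Pi.sub_apply, hq, h3, Pi.smul_apply, h2, smul_eq_mul]
  have half : ∀ {z : ℂ} {v f f₀ : ℝ → ℂ}, IsSol b z v f → MemLp f₀ 2 (volume : Measure ℝ) →
      (∀ᵐ η, f₀ η = f η - ((b - 3 : ℝ) : ℂ) * qFun v η) →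
      (|z.re| - |5 - b|) * ∫ η in Ioi (0 : ℝ), ‖v η‖ ^ 2 ≤
        ∫ η in Ioi (0 : ℝ), ‖f₀ η‖ * ‖v η‖ := by
    intro z v f f₀ hs hm hff
    obtain ⟨V, hV1, hV2, hV3, -⟩ := hs.exists_halfLine
    have := setIntegral_norm_sq_le (b := b) (z := z) hV2 hs.memLp_rhs hm hV3 (by
      filter_upwards [hff, hV1] with η h1 h2 h0
      rw [weightedDerivRHS, phi_mul_phi'_of_pos h0, h1, h2 h0, Complex.real_smul]
      push_cast; ring)
    have c1 : ∫ η in Ioi (0 : ℝ), ‖v η‖ ^ 2 = ∫ η in Ioi (0 : ℝ), ‖V η‖ ^ 2 :=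
      setIntegral_congr_ae measurableSet_Ioi (by
        filter_upwards [hV1] with η h h0; rw [h h0])
    have c2 : ∫ η in Ioi (0 : ℝ), ‖f₀ η‖ * ‖v η‖ = ∫ η in Ioi (0 : ℝ), ‖f₀ η‖ * ‖V η‖ :=
      setIntegral_congr_ae measurableSet_Ioi (by
        filter_upwards [hV1] with η h h0; rw [h h0])
    rw [c1, c2]
    exact this
  have h1 := half hs (Lp.memLp f₀) hff
  have h2 := half (f₀ := fun η => -f₀ (-η)) hs.comp_neg (memLp_comp_neg (Lp.memLp f₀)).neg (by
    have := (Measure.measurePreserving_neg (volume : Measure ℝ)).quasiMeasurePreserving.ae hff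
    filter_upwards [this] with η h
    rw [h, qFun_neg]; ring)
  simp only [Complex.neg_re, abs_neg, norm_neg] at h2
  have n1 : ∫ η, ‖(v : H) η‖ ^ 2 = ‖(v : H)‖ ^ 2 := by
    rw [← inner_self_eq_norm_sq (𝕜 := ℂ) (v : H), L2.inner_def,
      ← integral_re (L2.integrable_inner (v : H) (v : H))]
    simp only [inner_self_eq_norm_sq]
  have n2 : ∫ η, ‖f₀ η‖ * ‖(v : H) η‖ ≤ ‖f₀‖ * ‖(v : H)‖ := by
    have := integral_norm_smul_le (Lp.memLp f₀).norm (Lp.memLp (v : H))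
    simpa [norm_smul, Lp.norm_def] using this
  have s1 := integral_eq_Ioi_add_Ioi_neg ((Lp.memLp (v : H)).integrable_norm_pow (by norm_num))
  have s2 := integral_eq_Ioi_add_Ioi_neg
    (MemLp.integrable_mul (Lp.memLp f₀).norm (Lp.memLp (v : H)).norm)
  simp only [Pi.mul_apply] at s2
  rcases eq_or_lt_of_le (norm_nonneg (v : H)) with h0 | h0
  · rw [← h0, mul_zero]; exact norm_nonneg _
  · refine le_of_mul_le_mul_right ?_ h0
    refine le_trans ?_ n2
    rw [mul_assoc, ← sq, ← n1]
    rw [s1, s2]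
    linarith

/-! ### Closedness, and the resolvent set -/

open ComplexConjugate in
theorem memLp_conj {g : ℝ → ℂ} (hg : MemLp g 2 (volume : Measure ℝ)) :
    MemLp (fun x => conj (g x)) 2 (volume : Measure ℝ) :=
  hg.of_le (Complex.continuous_conj.comp_aestronglyMeasurable hg.1)
    (Eventually.of_forall fun x => (RCLike.norm_conj (g x)).le)

/-- The functional `v ↦ ∫ g v` on `L²`. -/
def pairing (g : ℝ → ℂ) (hg : MemLp g 2 (volume : Measure ℝ)) : H →L[ℂ] ℂ :=
  innerSL ℂ ((memLp_conj hg).toLp _)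

theorem pairing_apply {g : ℝ → ℂ} (hg : MemLp g 2 (volume : Measure ℝ)) (v : H) :
    pairing g hg v = ∫ x, g x * v x := by
  rw [pairing, innerSL_apply_apply, L2.inner_def]
  refine integral_congr_ae ?_
  filter_upwards [(memLp_conj hg).coeFn_toLp] with x hx
  rw [hx, RCLike.inner_apply, starRingEnd_self_apply, mul_comm]

theorem tendsto_integral_smul {f : ℝ → ℝ} (hf : MemLp f 2 (volume : Measure ℝ)) {u : ℕ → H} {v : H}
    (h : Tendsto u atTop (𝓝 v)) :
    Tendsto (fun n => ∫ x, f x • u n x) atTop (𝓝 (∫ x, f x • v x)) := by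
  have hg : MemLp (fun x => (f x : ℂ)) 2 (volume : Measure ℝ) := hf.ofReal
  have := ((pairing _ hg).continuous.tendsto v).comp h
  simpa only [Function.comp_def, pairing_apply, ← Complex.real_smul] using this

theorem isWeightedDeriv_of_tendsto {u w : ℕ → H} {v w' : H}
    (h : ∀ n, IsWeightedDeriv (u n) (w n)) (hu : Tendsto u atTop (𝓝 v))
    (hw : Tendsto w atTop (𝓝 w')) : IsWeightedDeriv v w' := by
  intro ψ hψ hc
  refine tendsto_nhds_unique (tendsto_integral_smul (memLp_test hψ hc) hw) ?_
  exact ((tendsto_integral_smul (memLp_weight_test hψ hc) hu).neg).congr fun n => (h n ψ hψ hc).symm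

theorem norm_mulPhiPhi'_le (v : H) : ‖mulPhiPhi' v‖ ≤ ‖v‖ := by
  refine Lp.norm_le_norm_of_ae_le ?_
  filter_upwards [coeFn_mulPhiPhi' v] with x hx
  rw [hx, norm_smul]
  refine mul_le_of_le_one_left (norm_nonneg _) ?_
  rw [Real.norm_eq_abs, abs_mul, abs_of_nonneg (phi_nonneg x)]
  have := abs_phi'_le x
  nlinarith [phi_nonneg x, phi_le_one x, abs_nonneg (phi' x)]

/-- The bounded part `(4 - b) φ φ' + Q` of the operator. -/
def boundedPart (b : ℝ) : H →L[ℂ] H :=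
  ((4 - b : ℝ) : ℂ) • mulPhiPhi'.mkContinuous 1 (fun v => by
    rw [one_mul]; exact norm_mulPhiPhi'_le v) + ((b - 3 : ℝ) : ℂ) • qCLM

theorem shift_L_eq (b : ℝ) (z : ℂ) (v : (L b).domain) :
    UnboundedSpectrum.shift (L b) z v = weightedDeriv v + boundedPart b (v : H) - z • (v : H) := by
  rw [shift_L_apply, boundedPart]
  simp only [add_apply, smul_apply, LinearMap.mkContinuous_apply, qCLM_apply]
  rfl

/-- The operator `L - z` is closed. -/
theorem exists_shift_eq_of_tendsto {b : ℝ} {z : ℂ} {u : ℕ → (L b).domain} {v f : H}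
    (hu : Tendsto (fun n => (u n : H)) atTop (𝓝 v))
    (hf : Tendsto (fun n => UnboundedSpectrum.shift (L b) z (u n)) atTop (𝓝 f)) :
    ∃ v' : (L b).domain, (v' : H) = v ∧ UnboundedSpectrum.shift (L b) z v' = f := by
  have hw : Tendsto (fun n => (weightedDeriv (u n) : H)) atTop
      (𝓝 (f - boundedPart b v + z • v)) := by
    refine ((hf.sub (((boundedPart b).continuous.tendsto v).comp hu)).add
      (hu.const_smul z)).congr fun n => ?_
    rw [shift_L_eq, Function.comp_apply]; abel
  have h := isWeightedDeriv_of_tendsto (fun n => weightedDeriv_spec (u n)) hu hw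
  let v' : (L b).domain := ⟨v, ⟨_, h⟩⟩
  refine ⟨v', rfl, ?_⟩
  have e : weightedDeriv v' = f - boundedPart b v + z • v := (weightedDeriv_spec v').unique_Lp h
  rw [shift_L_eq, e]
  change f - boundedPart b v + z • v + boundedPart b v - z • v = f
  abel

/-- Outside the closed strip, an injective `L - z` is bounded below: `L₀ - z` is bounded below and
`Q` is compact. -/
theorem exists_norm_le_of_injective {b : ℝ} {z : ℂ} (hz : |5 - b| < |z.re|)
    (hinj : Function.Injective (UnboundedSpectrum.shift (L b) z)) :
    ∃ C : ℝ, ∀ v : (L b).domain, ‖(v : H)‖ ≤ C * ‖UnboundedSpectrum.shift (L b) z v‖ := by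
  by_contra hcon
  push Not at hcon
  -- normalised vectors `e n` with `(L - z) (e n) → 0`
  choose u hu using fun n : ℕ => hcon n
  have hu0 : ∀ n, 0 < ‖(u n : H)‖ := fun n => lt_of_le_of_lt (by positivity) (hu n)
  set e : ℕ → (L b).domain := fun n => ((‖(u n : H)‖⁻¹ : ℝ) : ℂ) • u n with he
  have hcoe : ∀ n, (e n : H) = ((‖(u n : H)‖⁻¹ : ℝ) : ℂ) • (u n : H) := fun n => rfl
  have hnorm : ∀ n, ‖(e n : H)‖ = 1 := fun n => by
    rw [hcoe, norm_smul, Complex.norm_real, norm_inv, norm_norm, inv_mul_cancel₀ (hu0 n).ne']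
  have hsmall : Tendsto (fun n => UnboundedSpectrum.shift (L b) z (e n)) atTop (𝓝 0) := by
    rw [tendsto_zero_iff_norm_tendsto_zero]
    refine squeeze_zero' (Eventually.of_forall fun _ => norm_nonneg _) ?_
      tendsto_one_div_atTop_nhds_zero_nat
    filter_upwards [eventually_gt_atTop 0] with n hn
    have hn' : (0 : ℝ) < n := Nat.cast_pos.2 hn
    rw [he, map_smul, norm_smul, Complex.norm_real, norm_inv, norm_norm, inv_mul_le_iff₀ (hu0 n),
      mul_one_div, le_div_iff₀ hn', mul_comm]
    exact (hu n).le
  -- a subsequence along which the compact part converges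
  obtain ⟨K, hK, hKs⟩ := IsCompactOperator.image_closedBall_subset_compact (f := qCLM.toLinearMap)
    isCompactOperator_qCLM 1
  obtain ⟨q, -, θ, hθ, hq⟩ := hK.tendsto_subseq (x := fun n => qCLM (e n : H)) fun n =>
    hKs ⟨(e n : H), by simp [hnorm n], rfl⟩
  have hQ : Tendsto (fun n => UnboundedSpectrum.shift (L b) z (e (θ n)) - Q b (e (θ n) : H)) atTop
      (𝓝 (0 - ((b - 3 : ℝ) : ℂ) • q)) := by
    refine (hsmall.comp hθ.tendsto_atTop).sub ((hq.const_smul ((b - 3 : ℝ) : ℂ)).congr fun n => ?_)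
    simp only [Function.comp_apply, qCLM_apply]
    rfl
  have hδ : 0 < |z.re| - |5 - b| := sub_pos.2 hz
  -- the lower bound for `L - Q - z` turns convergence of the images into convergence of the vectors
  have hC : CauchySeq fun n => (e (θ n) : H) := by
    rw [Metric.cauchySeq_iff']
    intro ε hε
    obtain ⟨N, hN⟩ := Metric.cauchySeq_iff'.1 hQ.cauchySeq ((|z.re| - |5 - b|) * ε) (by positivity)
    refine ⟨N, fun n hn => ?_⟩
    have h1 := hN n hn
    have h2 := le_norm_shift_sub_Q b z (e (θ n) - e (θ N))
    rw [dist_eq_norm] at h1 ⊢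
    have h3 : UnboundedSpectrum.shift (L b) z (e (θ n) - e (θ N)) -
        Q b ((e (θ n) - e (θ N) : (L b).domain) : H) =
        UnboundedSpectrum.shift (L b) z (e (θ n)) - Q b (e (θ n) : H) -
          (UnboundedSpectrum.shift (L b) z (e (θ N)) - Q b (e (θ N) : H)) := by
      rw [map_sub, AddSubgroupClass.coe_sub, map_sub]; abel
    rw [h3] at h2
    exact lt_of_mul_lt_mul_left (h2.trans_lt h1) hδ.le
  obtain ⟨v, hv⟩ := cauchySeq_tendsto_of_complete hC
  obtain ⟨v', hv', hs⟩ := exists_shift_eq_of_tendsto hv (hsmall.comp hθ.tendsto_atTop)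
  have hv0 : v' = 0 := hinj (by rw [hs, map_zero])
  have : ‖v‖ = 1 := tendsto_nhds_unique hv.norm (by simp [hnorm])
  rw [← hv', hv0] at this
  simp at this

/-- The range is closed, since `L` is closed and `L - z` is bounded below. -/
theorem mem_resolventSet_of_injective_of_denseRange {b : ℝ} {z : ℂ} (hz : |5 - b| < |z.re|)
    (hinj : Function.Injective (UnboundedSpectrum.shift (L b) z))
    (hd : DenseRange (UnboundedSpectrum.shift (L b) z)) :
    z ∈ UnboundedSpectrum.resolventSet (L b) := by
  obtain ⟨C, hC⟩ := exists_norm_le_of_injective hz hinj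
  refine ⟨⟨hinj, fun f => ?_⟩, C, hC⟩
  obtain ⟨g, hg, hgf⟩ := mem_closure_iff_seq_limit.1 (hd f)
  choose u hu using hg
  have hg' : Tendsto (fun n => UnboundedSpectrum.shift (L b) z (u n)) atTop (𝓝 f) := by
    simpa only [hu] using hgf
  have hC' : CauchySeq fun n => (u n : H) := by
    rw [Metric.cauchySeq_iff']
    intro ε hε
    obtain ⟨N, hN⟩ := Metric.cauchySeq_iff'.1 hg'.cauchySeq (ε / (|C| + 1)) (by positivity)
    refine ⟨N, fun n hn => ?_⟩
    have h1 := hN n hn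
    have h2 := hC (u n - u N)
    rw [dist_eq_norm] at h1 ⊢
    rw [map_sub, AddSubgroupClass.coe_sub] at h2
    rw [lt_div_iff₀ (by positivity)] at h1
    nlinarith [norm_nonneg (UnboundedSpectrum.shift (L b) z (u n) -
      UnboundedSpectrum.shift (L b) z (u N)), le_abs_self C]
  obtain ⟨v, hv⟩ := cauchySeq_tendsto_of_complete hC'
  obtain ⟨v', -, hs⟩ := exists_shift_eq_of_tendsto hv hg'
  exact ⟨v', hs⟩

/-! ### Powers of `x = e^{-2ξ}` and `1 - x` -/

/-- The function `x^p (1 - x)^q` of `x = e^{-2ξ}`, for `ξ > 0`. It is a function of `ξ`;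
derivatives with respect to `x` appear through `d/dξ = -2 x d/dx`. -/
def xpow (p q : ℂ) (ξ : ℝ) : ℂ :=
  Complex.exp (-2 * p * ξ) * Complex.exp (q * Real.log (1 - Real.exp (-2 * ξ)))

theorem xpow_ne_zero (p q : ℂ) (ξ : ℝ) : xpow p q ξ ≠ 0 :=
  mul_ne_zero (Complex.exp_ne_zero _) (Complex.exp_ne_zero _)

theorem xpow_mul (p q p' q' : ℂ) (ξ : ℝ) :
    xpow p q ξ * xpow p' q' ξ = xpow (p + p') (q + q') ξ := by
  simp only [xpow]
  rw [mul_mul_mul_comm, ← Complex.exp_add, ← Complex.exp_add]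
  congr 2 <;> ring

theorem xpow_zero (ξ : ℝ) : xpow 0 0 ξ = 1 := by simp [xpow]

theorem xpow_one_zero (ξ : ℝ) : xpow 1 0 ξ = Real.exp (-2 * ξ) := by simp [xpow]

theorem xpow_zero_one {ξ : ℝ} (hξ : 0 < ξ) : xpow 0 1 ξ = 1 - Real.exp (-2 * ξ) := by
  have := Real.exp_log (one_sub_exp_pos hξ)
  rw [xpow, mul_zero, zero_mul, Complex.exp_zero, one_mul, one_mul, ← Complex.ofReal_exp, this]
  push_cast; ring

theorem norm_xpow (p q : ℂ) {ξ : ℝ} (hξ : 0 < ξ) :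
    ‖xpow p q ξ‖ = Real.exp (-2 * p.re * ξ) * (1 - Real.exp (-2 * ξ)) ^ q.re := by
  rw [xpow, norm_mul, Complex.norm_exp, Complex.norm_exp, Real.rpow_def_of_pos (one_sub_exp_pos hξ)]
  simp [mul_comm]

theorem hasDerivAt_xpow (p q : ℂ) {ξ : ℝ} (hξ : 0 < ξ) :
    HasDerivAt (xpow p q)
      (-2 * (p - q * (Real.exp (-2 * ξ) / (1 - Real.exp (-2 * ξ)))) * xpow p q ξ) ξ := by
  have d1 : HasDerivAt (fun ξ : ℝ => -2 * p * (ξ : ℂ)) (-2 * p * 1) ξ :=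
    (Complex.ofRealCLM.hasDerivAt (x := ξ)).const_mul _
  have d2 := ((hasDerivAt_one_sub_exp ξ).log (one_sub_exp_pos hξ).ne').ofReal_comp.const_mul q
  have := d1.cexp.mul d2.cexp
  convert! this using 1
  rw [xpow]
  push_cast
  ring

theorem continuousOn_xpow (p q : ℂ) : ContinuousOn (xpow p q) (Ioi 0) := fun _ hξ =>
  (hasDerivAt_xpow p q hξ).continuousAt.continuousWithinAt

theorem hasDerivAt_ofReal_exp (ξ : ℝ) :
    HasDerivAt (fun ξ : ℝ => (Real.exp (-2 * ξ) : ℂ)) (-2 * Real.exp (-2 * ξ)) ξ := by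
  have := ((hasDerivAt_one_sub_exp ξ).const_sub 1).ofReal_comp
  convert! this using 1
  · funext y; push_cast; ring
  · push_cast; ring

theorem one_sub_ofReal_exp_ne_zero {ξ : ℝ} (hξ : 0 < ξ) : (1 - Real.exp (-2 * ξ) : ℂ) ≠ 0 := by
  rw [← xpow_zero_one hξ]; exact xpow_ne_zero _ _ _

theorem ofReal_exp_ne_zero (t : ℝ) : (Real.exp t : ℂ) ≠ 0 :=
  Complex.ofReal_ne_zero.2 (Real.exp_pos t).ne'

/-! ### Primitives on the half-line -/

theorem hasDerivAt_of_eq_integral {V g : ℝ → ℂ} (hg : ContinuousOn g (Ioi 0))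
    (hV : ∀ s t, 0 < s → 0 < t → V t - V s = ∫ η in s..t, g η) {ξ : ℝ} (hξ : 0 < ξ) :
    HasDerivAt V (g ξ) ξ := by
  have hm : Ioi (0 : ℝ) ∈ 𝓝 ξ := Ioi_mem_nhds hξ
  have h := intervalIntegral.integral_hasDerivAt_right (f := g) (a := ξ) (b := ξ)
    IntervalIntegrable.refl
    (hg.stronglyMeasurableAtFilter_nhdsWithin measurableSet_Ioi ξ |>.filter_mono
      (nhdsWithin_eq_nhds.2 hm).ge) (hg.continuousAt hm)
  refine (h.const_add (V ξ)).congr_of_eventuallyEq ?_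
  filter_upwards [hm] with t ht
  rw [← hV ξ t hξ ht]; ring

theorem eq_of_hasDerivAt_zero {F : ℝ → ℂ} (h : ∀ ξ, 0 < ξ → HasDerivAt F 0 ξ) {s t : ℝ}
    (hs : 0 < s) (ht : 0 < t) : F s = F t :=
  isOpen_Ioi.is_const_of_deriv_eq_zero isPreconnected_Ioi
    (fun x hx => (h x hx).differentiableAt.differentiableWithinAt) (fun x hx => (h x hx).deriv) hs ht

theorem tail_sub_tail {v V : ℝ → ℂ} (hv : MemLp v 2 (volume : Measure ℝ))
    (hV : ∀ᵐ ξ, ξ ∈ Ioi (0 : ℝ) → v ξ = V ξ) {s t : ℝ} (hs : 0 < s) (ht : 0 < t) :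
    tail v t - tail v s = ∫ η in s..t, -(Real.exp (-3 * η) • V η) := by
  have h := intervalIntegral.integral_interval_add_Ioi (integrableOn_tail hv hs.le)
    (integrableOn_tail hv ht.le)
  have e : ∫ η in s..t, Real.exp (-3 * η) • V η = ∫ η in s..t, Real.exp (-3 * η) • v η := by
    refine intervalIntegral.integral_congr_ae ?_
    filter_upwards [hV] with η hη h0
    rw [hη ((lt_min hs ht).trans h0.1)]
  rw [intervalIntegral.integral_neg, e, tail, tail, ← h]
  ring

theorem hasDerivAt_tail {v V : ℝ → ℂ} (hv : MemLp v 2 (volume : Measure ℝ))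
    (hV : ∀ᵐ ξ, ξ ∈ Ioi (0 : ℝ) → v ξ = V ξ) (hc : ContinuousOn V (Ioi 0)) {ξ : ℝ} (hξ : 0 < ξ) :
    HasDerivAt (tail v) (-(Real.exp (-3 * ξ) • V ξ)) ξ :=
  hasDerivAt_of_eq_integral (g := fun ξ => -(Real.exp (-3 * ξ) • V ξ))
    (((by fun_prop : Continuous fun ξ : ℝ => Real.exp (-3 * ξ)).continuousOn.smul hc).neg)
    (fun _ _ hs ht => tail_sub_tail hv hV hs ht) hξ

theorem norm_tail_le {v : ℝ → ℂ} (hv : MemLp v 2 (volume : Measure ℝ)) {ξ : ℝ} (hξ : 0 ≤ ξ) :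
    ‖tail v ξ‖ ≤ Real.exp (-2 * ξ) * ∫ η, ‖phi η • v η‖ := by
  have h := (integrable_smul_of_memLp memLp_phi hv).norm
  refine (norm_integral_le_integral_norm _).trans ?_
  rw [← integral_const_mul]
  refine le_trans (setIntegral_mono_on (integrableOn_tail hv hξ).norm
    (h.const_mul (Real.exp (-2 * ξ))).integrableOn measurableSet_Ioi fun η hη => ?_)
    (setIntegral_le_integral (h.const_mul _) (Eventually.of_forall fun η => by positivity))
  have h0 : ξ < η := hη
  rw [norm_smul, norm_smul, ← mul_assoc]
  refine mul_le_mul_of_nonneg_right ?_ (norm_nonneg _)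
  rw [Real.norm_of_nonneg (Real.exp_pos _).le, Real.norm_of_nonneg (phi_nonneg _), phi,
    abs_of_pos (hξ.trans_lt h0), ← Real.exp_add, Real.exp_le_exp]
  linarith

/-! ### Solutions of the homogeneous equation on the half-line -/

/-- With `x = e^{-2ξ}`, `d/dξ = -2 x d/dx` and primes for derivatives in `x`, the hypotheses are
`x (1 - x) u' + ((z - 1) / 2 + (5 - b) / 2 x) u + (b - 3) W = (b - 3) A x` and `W' = u`.
Differentiating twice in `x` removes the nonlocal term `W` and leaves the first order equation
`x (1 - x) u''' + ((z + 3) / 2 - (b + 3) / 2 x) u'' = 0`, whose solutions are multiples of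
`x^{-(z + 3) / 2} (1 - x)^{(z - b) / 2}`. The functions `u₁` and `u₂` are `u'` and `u''`; the
formulas for them carry bounds on `u` and `W` over to `u''`. -/
theorem exists_secondDeriv_eq {b : ℝ} {z A : ℂ} {u W : ℝ → ℂ}
    (hu : ∀ ξ, 0 < ξ → HasDerivAt u (2 * (((z - 1) / 2 + (5 - b) / 2 * Real.exp (-2 * ξ)) * u ξ +
      (b - 3) * (W ξ - Real.exp (-2 * ξ) * A)) / (1 - Real.exp (-2 * ξ))) ξ)
    (hW : ∀ ξ, 0 < ξ → HasDerivAt W (-2 * Real.exp (-2 * ξ) * u ξ) ξ) :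
    ∃ u₁ u₂ : ℝ → ℂ, ∃ K : ℂ,
      (∀ ξ, u₁ ξ = ((b - 3) * (A * Real.exp (-2 * ξ) - W ξ) -
        ((z - 1) / 2 + (5 - b) / 2 * Real.exp (-2 * ξ)) * u ξ) /
          (Real.exp (-2 * ξ) * (1 - Real.exp (-2 * ξ)))) ∧
      (∀ ξ, u₂ ξ = ((b - 3) * (A - u ξ) - (5 - b) / 2 * u ξ -
        ((z - 1) / 2 + (5 - b) / 2 * Real.exp (-2 * ξ)) * u₁ ξ -
          (1 - 2 * Real.exp (-2 * ξ)) * u₁ ξ) /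
          (Real.exp (-2 * ξ) * (1 - Real.exp (-2 * ξ)))) ∧
      (∀ ξ, 0 < ξ → HasDerivAt u (-2 * Real.exp (-2 * ξ) * u₁ ξ) ξ) ∧
      (∀ ξ, 0 < ξ → HasDerivAt u₁ (-2 * Real.exp (-2 * ξ) * u₂ ξ) ξ) ∧
      ∀ ξ, 0 < ξ → u₂ ξ = K * xpow (-(z + 3) / 2) ((z - b) / 2) ξ := by
  obtain ⟨u₁, h1⟩ : ∃ u₁ : ℝ → ℂ, ∀ ξ, u₁ ξ = ((b - 3) * (A * Real.exp (-2 * ξ) - W ξ) -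
        ((z - 1) / 2 + (5 - b) / 2 * Real.exp (-2 * ξ)) * u ξ) /
          (Real.exp (-2 * ξ) * (1 - Real.exp (-2 * ξ))) := ⟨_, fun _ => rfl⟩
  obtain ⟨u₂, h2⟩ : ∃ u₂ : ℝ → ℂ, ∀ ξ, u₂ ξ = ((b - 3) * (A - u ξ) - (5 - b) / 2 * u ξ -
        ((z - 1) / 2 + (5 - b) / 2 * Real.exp (-2 * ξ)) * u₁ ξ -
          (1 - 2 * Real.exp (-2 * ξ)) * u₁ ξ) /
          (Real.exp (-2 * ξ) * (1 - Real.exp (-2 * ξ))) := ⟨_, fun _ => rfl⟩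
  have d0 : ∀ ξ, 0 < ξ → HasDerivAt u (-2 * Real.exp (-2 * ξ) * u₁ ξ) ξ := fun ξ hξ => by
    convert! hu ξ hξ using 1
    rw [h1]
    have n1 := one_sub_ofReal_exp_ne_zero hξ
    have n2 := ofReal_exp_ne_zero (-2 * ξ)
    generalize (Real.exp (-2 * ξ) : ℂ) = E at *
    field_simp
    ring
  have dE := hasDerivAt_ofReal_exp
  have d1 : ∀ ξ, 0 < ξ → HasDerivAt u₁ (-2 * Real.exp (-2 * ξ) * u₂ ξ) ξ := fun ξ hξ => by
    have n1 := one_sub_ofReal_exp_ne_zero hξ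
    have n2 := ofReal_exp_ne_zero (-2 * ξ)
    have := (((((dE ξ).const_mul A).sub (hW ξ hξ)).const_mul (b - 3 : ℂ)).sub
      ((((dE ξ).const_mul ((5 - b) / 2 : ℂ)).const_add ((z - 1) / 2)).mul (d0 ξ hξ))).div
        ((dE ξ).mul ((dE ξ).const_sub 1)) (mul_ne_zero n2 n1)
    have e := h1 ξ
    convert! this using 1
    · funext ξ; rw [h1]; rfl
    · simp only [Pi.sub_apply, Pi.mul_apply]
      rw [h2]
      rw [eq_div_iff (mul_ne_zero n2 n1)] at e
      have e' : (b - 3) * (A * (Real.exp (-2 * ξ) : ℂ) - W ξ) =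
        ((z - 1) / 2 + (5 - b) / 2 * Real.exp (-2 * ξ)) * u ξ +
          u₁ ξ * (Real.exp (-2 * ξ) * (1 - Real.exp (-2 * ξ))) := by linear_combination -e
      rw [e']
      generalize (Real.exp (-2 * ξ) : ℂ) = E at *
      field_simp
      ring
  -- the first order equation for the second derivative
  have d2 : ∀ ξ, 0 < ξ → HasDerivAt u₂ (2 * ((z - 1) / 2 + 2 - (b + 3) / 2 * Real.exp (-2 * ξ)) /
      (1 - Real.exp (-2 * ξ)) * u₂ ξ) ξ := fun ξ hξ => by
    have n1 := one_sub_ofReal_exp_ne_zero hξ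
    have n2 := ofReal_exp_ne_zero (-2 * ξ)
    have := ((((((d0 ξ hξ).const_sub A).const_mul (b - 3 : ℂ)).sub
      ((d0 ξ hξ).const_mul ((5 - b) / 2 : ℂ))).sub
      ((((dE ξ).const_mul ((5 - b) / 2 : ℂ)).const_add ((z - 1) / 2)).mul (d1 ξ hξ))).sub
      ((((dE ξ).const_mul 2).const_sub 1).mul (d1 ξ hξ))).div
        ((dE ξ).mul ((dE ξ).const_sub 1)) (mul_ne_zero n2 n1)
    have e := h2 ξ
    convert! this using 1
    · funext ξ; rw [h2]; rfl
    · simp only [Pi.sub_apply, Pi.mul_apply]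
      rw [eq_div_iff (mul_ne_zero n2 n1)] at e
      rw [← e]
      generalize (Real.exp (-2 * ξ) : ℂ) = E at *
      field_simp
      ring
  have d3 : ∀ ξ, 0 < ξ → HasDerivAt (fun ξ => u₂ ξ * xpow ((z + 3) / 2) ((b - z) / 2) ξ) 0 ξ :=
    fun ξ hξ => by
      convert! (d2 ξ hξ).mul (hasDerivAt_xpow ((z + 3) / 2) ((b - z) / 2) hξ) using 1
      have n1 := one_sub_ofReal_exp_ne_zero hξ
      generalize (Real.exp (-2 * ξ) : ℂ) = E at *
      field_simp
      ring
  refine ⟨u₁, u₂, u₂ 1 * xpow ((z + 3) / 2) ((b - z) / 2) 1, h1, h2, d0, d1, fun ξ hξ => ?_⟩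
  have := eq_of_hasDerivAt_zero d3 hξ one_pos
  rw [← this, mul_assoc, xpow_mul]
  have e : xpow ((z + 3) / 2 + -(z + 3) / 2) ((b - z) / 2 + (z - b) / 2) ξ = 1 := by
    rw [← xpow_zero ξ]; congr 1 <;> ring
  rw [e, mul_one]

/-- For a source that is continuous on `(0, ∞)`, the solutions are differentiable there, and
`(1 - φ²) |v|²` vanishes at both ends. -/
theorem IsSol.exists_deriv {b : ℝ} {z : ℂ} {v f g : ℝ → ℂ} (h : IsSol b z v f)
    (hg : ContinuousOn g (Ioi 0)) (hfg : ∀ᵐ ξ, ξ ∈ Ioi (0 : ℝ) → f ξ = g ξ) :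
    ∃ V : ℝ → ℂ, (∀ᵐ ξ, ξ ∈ Ioi (0 : ℝ) → v ξ = V ξ) ∧ ContinuousOn V (Ioi 0) ∧
      (∀ ξ, 0 < ξ → HasDerivAt V (((z + (4 - b) * Real.exp (-2 * ξ)) * V ξ + g ξ +
        4 * (b - 3) * Real.exp ξ * tail v ξ -
          4 * (b - 3) * Real.exp (-ξ) * tail (fun η => v (-η)) 0) / (1 - Real.exp (-2 * ξ))) ξ) ∧
      Tendsto (fun t => (1 - Real.exp (-2 * t)) * ‖V t‖ ^ 2) (𝓝[>] 0) (𝓝 0) ∧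
      Tendsto (fun t => (1 - Real.exp (-2 * t)) * ‖V t‖ ^ 2) atTop (𝓝 0) := by
  obtain ⟨V, h1, h2, h3, h4⟩ := h.exists_halfLine
  have hc : ContinuousOn V (Ioi 0) := continuousOn_of_eq_integral
    (g := fun η => (1 - Real.exp (-2 * η))⁻¹ • weightedDerivRHS b z v f η)
    (locallyIntegrableOn_div_weight h.memLp_rhs) h3
  obtain ⟨k1, k2, -⟩ := energy_tendsto h2 h.memLp_rhs h3
  have ht : ContinuousOn (tail v) (Ioi 0) := fun ξ hξ =>
    (hasDerivAt_tail h.memLp h1 hc hξ).continuousAt.continuousWithinAt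
  refine ⟨V, h1, hc, fun ξ hξ => ?_, k1, k2⟩
  refine hasDerivAt_of_eq_integral (g := fun ξ => ((z + (4 - b) * Real.exp (-2 * ξ)) * V ξ + g ξ +
        4 * (b - 3) * Real.exp ξ * tail v ξ -
          4 * (b - 3) * Real.exp (-ξ) * tail (fun η => v (-η)) 0) / (1 - Real.exp (-2 * ξ)))
    ?_ (fun s t hs ht => ?_) hξ
  · refine ContinuousOn.div (ContinuousOn.sub (ContinuousOn.add (ContinuousOn.add
      (ContinuousOn.mul ?_ hc) hg) (ContinuousOn.mul ?_ ht)) ?_) ?_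
      fun ξ hξ => one_sub_ofReal_exp_ne_zero hξ
    all_goals
      refine Continuous.continuousOn ?_
      fun_prop
  · rw [h3 s t hs ht]
    refine intervalIntegral.integral_congr_ae ?_
    filter_upwards [h4, hfg] with η h4 h5 hη
    have h0 : 0 < η := (lt_min hs ht).trans hη.1
    rw [h4 h0, h5 h0, Complex.real_smul]
    push_cast
    rw [inv_mul_eq_div]

theorem tendsto_exp_neg_mul_atTop {a : ℝ} (ha : a < 0) :
    Tendsto (fun ξ : ℝ => (Real.exp (a * ξ) : ℂ)) atTop (𝓝 0) := by
  have : Tendsto (fun ξ : ℝ => Real.exp (a * ξ)) atTop (𝓝 0) :=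
    Real.tendsto_exp_atBot.comp (tendsto_id.const_mul_atTop_of_neg ha)
  exact_mod_cast (Complex.continuous_ofReal.tendsto 0).comp this

theorem tendsto_one_sub_exp_atTop :
    Tendsto (fun t : ℝ => 1 - Real.exp (-2 * t)) atTop (𝓝 1) := by
  have := (tendsto_const_nhds (x := (1 : ℝ))).sub (Real.tendsto_exp_atBot.comp
    ((tendsto_id (α := ℝ)).const_mul_atTop_of_neg (show (-2 : ℝ) < 0 by norm_num)))
  rwa [sub_zero] at this

theorem tendsto_one_sub_exp_zero :
    Tendsto (fun t : ℝ => 1 - Real.exp (-2 * t)) (𝓝[>] 0) (𝓝 0) := by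
  have : Continuous fun t : ℝ => 1 - Real.exp (-2 * t) := by fun_prop
  have := (this.tendsto 0).mono_left (nhdsWithin_le_nhds (s := Ioi 0))
  simpa using this

theorem eq_zero_of_tendsto_xpow_atTop {K p q : ℂ} (hp : p.re ≤ 0)
    (h : Tendsto (fun ξ => K * xpow p q ξ) atTop (𝓝 0)) : K = 0 := by
  have l1 : Tendsto (fun t : ℝ => ‖K‖ * (1 - Real.exp (-2 * t)) ^ q.re) atTop (𝓝 (‖K‖ * 1)) := by
    have := (tendsto_one_sub_exp_atTop.rpow_const (p := q.re) (Or.inl one_ne_zero)).const_mul ‖K‖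
    rwa [Real.one_rpow] at this
  have l2 : Tendsto (fun t : ℝ => ‖K‖ * (1 - Real.exp (-2 * t)) ^ q.re) atTop (𝓝 0) := by
    refine squeeze_zero' ?_ ?_ (tendsto_zero_iff_norm_tendsto_zero.1 h)
    · filter_upwards [eventually_gt_atTop 0] with t ht
      have := one_sub_exp_pos ht
      positivity
    · filter_upwards [eventually_gt_atTop 0] with t ht
      have := one_sub_exp_pos ht
      rw [norm_mul, norm_xpow p q ht]
      refine mul_le_mul_of_nonneg_left (le_mul_of_one_le_left (by positivity) ?_) (norm_nonneg _)
      exact Real.one_le_exp (by nlinarith)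
  have := tendsto_nhds_unique l1 l2
  rwa [mul_one, norm_eq_zero] at this

theorem eq_zero_of_tendsto_xpow_zero {K p q : ℂ} (hq : q.re ≤ 0)
    (h : Tendsto (fun ξ => K * xpow p q ξ) (𝓝[>] 0) (𝓝 0)) : K = 0 := by
  have l1 : Tendsto (fun t : ℝ => ‖K‖ * Real.exp (-2 * p.re * t)) (𝓝[>] 0) (𝓝 ‖K‖) := by
    have : Continuous fun t : ℝ => ‖K‖ * Real.exp (-2 * p.re * t) := by fun_prop
    have := (this.tendsto 0).mono_left (nhdsWithin_le_nhds (s := Ioi 0))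
    simpa using this
  have l2 : Tendsto (fun t : ℝ => ‖K‖ * Real.exp (-2 * p.re * t)) (𝓝[>] 0) (𝓝 0) := by
    refine squeeze_zero' (Eventually.of_forall fun t => by positivity) ?_
      (tendsto_zero_iff_norm_tendsto_zero.1 h)
    filter_upwards [self_mem_nhdsWithin] with t ht
    have := one_sub_exp_pos ht
    rw [norm_mul, norm_xpow p q ht]
    refine mul_le_mul_of_nonneg_left (le_mul_of_one_le_right (by positivity) ?_) (norm_nonneg _)
    exact Real.one_le_rpow_of_pos_of_le_one_of_nonpos this
      (by linarith [Real.exp_pos (-2 * t)]) hq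
  rw [← norm_eq_zero]
  exact tendsto_nhds_unique l1 l2

/-- A solution of `(L - z) v = 0` is a multiple of `e^{-ξ}` on `(0, ∞)` if `Re z ≥ 0`, by its
behaviour at infinity, and if `Re z ≤ b - 5`, by its behaviour at zero. -/
theorem IsSol.exists_eq_exp {b : ℝ} {z : ℂ} {v : ℝ → ℂ} (h : IsSol b z v 0)
    (hz : 0 ≤ z.re ∨ z.re ≤ b - 5) :
    ∃ d : ℂ, (∀ᵐ ξ, ξ ∈ Ioi (0 : ℝ) → v ξ = 2 * d * Real.exp (-ξ)) ∧
      d * (1 + z) = 2 * (b - 3) * tail (fun η => v (-η)) 0 := by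
  obtain ⟨V, hV, hc, hd, h0, hi⟩ := h.exists_deriv (g := 0) continuousOn_const
    (Eventually.of_forall fun _ _ => rfl)
  have hW : ∀ ξ, 0 < ξ → HasDerivAt (tail v) (-(Real.exp (-3 * ξ) • V ξ)) ξ :=
    fun ξ hξ => hasDerivAt_tail h.memLp hV hc hξ
  set A := tail (fun η => v (-η)) 0 with hA
  set W := tail v with hWdef
  obtain ⟨u, hu⟩ : ∃ u : ℝ → ℂ, ∀ ξ, u ξ = Real.exp (-ξ) * V ξ / 2 := ⟨_, fun _ => rfl⟩
  have hW' : ∀ ξ, 0 < ξ → HasDerivAt W (-2 * Real.exp (-2 * ξ) * u ξ) ξ := fun ξ hξ => by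
    convert! hW ξ hξ using 1
    rw [hu, Complex.real_smul, show -3 * ξ = -2 * ξ + -ξ by ring, Real.exp_add]
    push_cast; ring
  have hu' : ∀ ξ, 0 < ξ → HasDerivAt u (2 * (((z - 1) / 2 + (5 - b) / 2 * Real.exp (-2 * ξ)) * u ξ +
      (b - 3) * (W ξ - Real.exp (-2 * ξ) * A)) / (1 - Real.exp (-2 * ξ))) ξ := fun ξ hξ => by
    have d := (((hasDerivAt_neg ξ).exp.ofReal_comp).mul (hd ξ hξ)).div_const 2
    have n1 := one_sub_ofReal_exp_ne_zero hξ
    have n2 := ofReal_exp_ne_zero (-ξ)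
    have e1 : (Real.exp ξ : ℂ) = (Real.exp (-ξ) : ℂ)⁻¹ := by
      rw [Real.exp_neg]; push_cast; rw [inv_inv]
    have e2 : (Real.exp (-2 * ξ) : ℂ) = (Real.exp (-ξ) : ℂ) ^ 2 := by
      rw [show -2 * ξ = -ξ + -ξ by ring, Real.exp_add]; push_cast; ring
    convert! d using 1
    · funext ξ; rw [hu]; rfl
    · rw [hu]
      simp only [Complex.ofReal_mul]
      rw [e2] at n1
      rw [e1, e2]
      generalize (Real.exp (-ξ) : ℂ) = y at *
      simp only [Pi.zero_apply]
      field_simp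
      push_cast
      ring
  obtain ⟨u₁, u₂, K, e1, e2, d0, d1, hK⟩ := exists_secondDeriv_eq hu' hW'
  have lE := tendsto_exp_neg_mul_atTop (a := -2) (by norm_num)
  have lV : Tendsto V atTop (𝓝 0) := by
    have l2 := (hi.div tendsto_one_sub_exp_atTop (by norm_num)).sqrt
    rw [zero_div, Real.sqrt_zero] at l2
    refine tendsto_zero_iff_norm_tendsto_zero.2 (l2.congr' ?_)
    filter_upwards [eventually_gt_atTop 0] with t ht
    rw [Pi.div_apply, mul_div_cancel_left₀ _ (one_sub_exp_pos ht).ne', Real.sqrt_sq (norm_nonneg _)]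
  have ly := tendsto_exp_neg_mul_atTop (a := -1) (by norm_num)
  simp only [neg_one_mul] at ly
  have lP : Tendsto (fun ξ : ℝ => (Real.exp ξ : ℂ) * W ξ) atTop (𝓝 0) := by
    refine squeeze_zero_norm' (a := fun ξ => ‖(Real.exp (-ξ) : ℂ)‖ * ∫ η, ‖phi η • v η‖) ?_ ?_
    · filter_upwards [eventually_gt_atTop 0] with ξ hξ
      have := norm_tail_le h.memLp hξ.le
      rw [norm_mul, Complex.norm_real, Complex.norm_real, Real.norm_of_nonneg (Real.exp_pos _).le,
        Real.norm_of_nonneg (Real.exp_pos _).le]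
      refine (mul_le_mul_of_nonneg_left this (Real.exp_pos _).le).trans_eq ?_
      rw [← mul_assoc, ← Real.exp_add]; congr 2; ring
    · simpa using ly.norm.mul_const (∫ η, ‖phi η • v η‖)
  have lW : Tendsto W atTop (𝓝 0) := by
    have := ly.mul lP
    rw [mul_zero] at this
    refine this.congr fun ξ => ?_
    rw [← mul_assoc, ← Complex.ofReal_mul, ← Real.exp_add, neg_add_cancel, Real.exp_zero,
      Complex.ofReal_one, one_mul]
  have lu : Tendsto u atTop (𝓝 0) := by
    have := (ly.mul lV).div_const 2
    rw [mul_zero, zero_div] at this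
    exact this.congr fun ξ => (hu ξ).symm
  have l1E : Tendsto (fun ξ : ℝ => 1 - (Real.exp (-2 * ξ) : ℂ)) atTop (𝓝 (1 - 0)) :=
    lE.const_sub 1
  have sq : ∀ ξ : ℝ, (Real.exp (-2 * ξ) : ℂ) = (Real.exp (-ξ) : ℂ) ^ 2 := fun ξ => by
    rw [show -2 * ξ = -ξ + -ξ by ring, Real.exp_add]; push_cast; ring
  -- at one of the ends `u₂` is too small for a nonzero multiple of `xpow _ _`
  have K0 : K = 0 := by
    -- at infinity `V → 0` gives `y³ u₂ → 0` with `y = x^{1/2}`; at zero `s V → 0` with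
    -- `s = (1 - x)^{1/2}` gives `s⁵ u₂ → 0`
    rcases hz with hz | hz
    · have l1 : Tendsto (fun ξ : ℝ => (Real.exp (-ξ) : ℂ) * u₁ ξ) atTop (𝓝 0) := by
        have := ((((ly.const_mul A).sub lP).const_mul (b - 3 : ℂ)).sub
          ((((lE.const_mul ((5 - b) / 2 : ℂ)).const_add ((z - 1) / 2)).mul
            (lV.div_const 2)))).div l1E (by norm_num)
        refine Tendsto.congr' ?_ (this.trans_eq ?_)
        · filter_upwards [eventually_gt_atTop 0] with ξ hξ
          have n1 := one_sub_ofReal_exp_ne_zero hξ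
          have n2 := ofReal_exp_ne_zero (-ξ)
          have e0 : (Real.exp ξ : ℂ) = (Real.exp (-ξ) : ℂ)⁻¹ := by
            rw [Real.exp_neg]; push_cast; rw [inv_inv]
          simp only [Pi.div_apply]
          rw [e1, hu, e0]
          rw [sq] at n1 ⊢
          generalize (Real.exp (-ξ) : ℂ) = y at *
          field_simp
        · simp
      have l2 : Tendsto (fun ξ : ℝ => (Real.exp (-ξ) : ℂ) ^ 3 * u₂ ξ) atTop (𝓝 0) := by
        have := (((((lu.const_sub A).const_mul (b - 3 : ℂ)).sub
          (lu.const_mul ((5 - b) / 2 : ℂ))).mul ly).sub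
          ((((lE.const_mul ((5 - b) / 2 : ℂ)).const_add ((z - 1) / 2)).add
            ((lE.const_mul 2).const_sub 1)).mul l1)).div l1E (by norm_num)
        refine Tendsto.congr' ?_ (this.trans_eq ?_)
        · filter_upwards [eventually_gt_atTop 0] with ξ hξ
          have n1 := one_sub_ofReal_exp_ne_zero hξ
          have n2 := ofReal_exp_ne_zero (-ξ)
          simp only [Pi.div_apply]
          rw [e2]
          rw [sq] at n1 ⊢
          generalize (Real.exp (-ξ) : ℂ) = y at *
          field_simp
          ring
        · simp
      refine eq_zero_of_tendsto_xpow_atTop (p := -z / 2) (q := (z - b) / 2) ?_ (l2.congr' ?_)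
      · rw [Complex.div_ofNat_re, Complex.neg_re]; linarith
      · filter_upwards [eventually_gt_atTop 0] with ξ hξ
        have : (Real.exp (-ξ) : ℂ) ^ 3 = xpow (3 / 2) 0 ξ := by
          rw [xpow, zero_mul, Complex.exp_zero, mul_one, Complex.ofReal_exp, ← Complex.exp_nat_mul]
          congr 1; push_cast; ring
        rw [hK ξ hξ, this, mul_left_comm, xpow_mul]
        congr 2 <;> ring
    · set s : ℝ → ℂ := xpow 0 (1 / 2) with hs
      have ns : ∀ ξ, 0 < ξ → ‖s ξ‖ = √(1 - Real.exp (-2 * ξ)) := fun ξ hξ => by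
        rw [hs, norm_xpow 0 (1 / 2) hξ, Real.sqrt_eq_rpow]; simp
      have s2 : ∀ ξ, 0 < ξ → 1 - (Real.exp (-2 * ξ) : ℂ) = s ξ ^ 2 := fun ξ hξ => by
        rw [hs, pow_two, xpow_mul, ← xpow_zero_one hξ]; congr 1 <;> norm_num
      have s0 : ∀ ξ, s ξ ≠ 0 := fun ξ => xpow_ne_zero _ _ _
      have ls : Tendsto s (𝓝[>] 0) (𝓝 0) := by
        have := tendsto_one_sub_exp_zero.sqrt
        rw [Real.sqrt_zero] at this
        refine tendsto_zero_iff_norm_tendsto_zero.2 (this.congr' ?_)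
        filter_upwards [self_mem_nhdsWithin] with ξ hξ using (ns ξ hξ).symm
      have lsV : Tendsto (fun ξ => s ξ * V ξ) (𝓝[>] 0) (𝓝 0) := by
        have := h0.sqrt
        rw [Real.sqrt_zero] at this
        refine tendsto_zero_iff_norm_tendsto_zero.2 (this.congr' ?_)
        filter_upwards [self_mem_nhdsWithin] with ξ hξ
        rw [norm_mul, ns ξ hξ, Real.sqrt_mul (one_sub_exp_pos hξ).le, Real.sqrt_sq (norm_nonneg _)]
      have lsW : Tendsto (fun ξ => s ξ * W ξ) (𝓝[>] 0) (𝓝 0) := by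
        refine squeeze_zero_norm' (a := fun ξ => ‖s ξ‖ * ∫ η, ‖phi η • v η‖) ?_ ?_
        · filter_upwards [self_mem_nhdsWithin] with ξ hξ
          have hξ' : (0 : ℝ) < ξ := hξ
          rw [norm_mul]
          refine mul_le_mul_of_nonneg_left ((norm_tail_le h.memLp hξ'.le).trans ?_) (norm_nonneg _)
          refine mul_le_of_le_one_left (integral_nonneg fun _ => norm_nonneg _) ?_
          rw [Real.exp_le_one_iff]; linarith
        · simpa using ls.norm.mul_const (∫ η, ‖phi η • v η‖)
      have lE1 : Tendsto (fun ξ : ℝ => (Real.exp (-2 * ξ) : ℂ)) (𝓝[>] 0) (𝓝 1) := by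
        have : Continuous fun ξ : ℝ => (Real.exp (-2 * ξ) : ℂ) := by fun_prop
        have := (this.tendsto 0).mono_left (nhdsWithin_le_nhds (s := Ioi 0))
        simpa using this
      have ly1 : Tendsto (fun ξ : ℝ => (Real.exp (-ξ) : ℂ)) (𝓝[>] 0) (𝓝 1) := by
        have : Continuous fun ξ : ℝ => (Real.exp (-ξ) : ℂ) := by fun_prop
        have := (this.tendsto 0).mono_left (nhdsWithin_le_nhds (s := Ioi 0))
        simpa using this
      have lsu : Tendsto (fun ξ => s ξ * u ξ) (𝓝[>] 0) (𝓝 0) := by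
        have := (ly1.mul lsV).div_const 2
        rw [mul_zero, zero_div] at this
        exact this.congr fun ξ => by rw [hu]; ring
      have l1 : Tendsto (fun ξ : ℝ => s ξ ^ 3 * u₁ ξ) (𝓝[>] 0) (𝓝 0) := by
        have := (((((lE1.const_mul A).mul ls).sub lsW).const_mul (b - 3 : ℂ)).sub
          ((((lE1.const_mul ((5 - b) / 2 : ℂ)).const_add ((z - 1) / 2)).mul lsu))).div lE1
            one_ne_zero
        refine Tendsto.congr' ?_ (this.trans_eq ?_)
        · filter_upwards [self_mem_nhdsWithin] with ξ hξ
          have n2 := ofReal_exp_ne_zero (-2 * ξ)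
          simp only [Pi.div_apply]
          rw [e1, s2 ξ hξ]
          have := s0 ξ
          generalize (Real.exp (-2 * ξ) : ℂ) = E at *
          field_simp
        · simp
      have l2 : Tendsto (fun ξ : ℝ => s ξ ^ 5 * u₂ ξ) (𝓝[>] 0) (𝓝 0) := by
        have := (((((ls.pow 2).mul ((ls.const_mul A).sub lsu)).const_mul (b - 3 : ℂ)).sub
          (((ls.pow 2).mul lsu).const_mul ((5 - b) / 2 : ℂ))).sub
          ((((lE1.const_mul ((5 - b) / 2 : ℂ)).const_add ((z - 1) / 2)).add
            ((lE1.const_mul 2).const_sub 1)).mul l1)).div lE1 one_ne_zero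
        refine Tendsto.congr' ?_ (this.trans_eq ?_)
        · filter_upwards [self_mem_nhdsWithin] with ξ hξ
          have n2 := ofReal_exp_ne_zero (-2 * ξ)
          simp only [Pi.div_apply]
          rw [e2, s2 ξ hξ]
          have := s0 ξ
          generalize (Real.exp (-2 * ξ) : ℂ) = E at *
          field_simp
          ring
        · simp
      refine eq_zero_of_tendsto_xpow_zero (p := -(z + 3) / 2) (q := (z - b + 5) / 2) ?_
        (l2.congr' ?_)
      · rw [Complex.div_ofNat_re]
        simp only [Complex.add_re, Complex.sub_re, Complex.ofReal_re, Complex.re_ofNat]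
        linarith
      · filter_upwards [self_mem_nhdsWithin] with ξ hξ
        have : s ξ ^ 5 = xpow 0 (5 / 2) ξ := by
          simp only [hs, pow_succ, pow_zero, one_mul, xpow_mul]
          congr 1 <;> norm_num
        rw [hK ξ hξ, this, mul_left_comm, xpow_mul]
        congr 2 <;> ring
  subst K0
  simp only [zero_mul] at hK
  -- hence `u` is affine in `x`, and it vanishes at `x = 0`
  have du : ∀ ξ, 0 < ξ → u₁ ξ = u₁ 1 := fun ξ hξ => eq_of_hasDerivAt_zero (fun ξ hξ => by
    have := d1 ξ hξ
    rwa [hK ξ hξ, mul_zero] at this) hξ one_pos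
  have eu : ∀ ξ, 0 < ξ → u ξ = u₁ 1 * Real.exp (-2 * ξ) := by
    have c : ∀ ξ, 0 < ξ → u ξ - u₁ 1 * Real.exp (-2 * ξ) = u 1 - u₁ 1 * Real.exp (-2 * 1) :=
      fun ξ hξ => eq_of_hasDerivAt_zero (F := fun ξ => u ξ - u₁ 1 * Real.exp (-2 * ξ))
        (fun ξ hξ => by
          convert! (d0 ξ hξ).sub ((hasDerivAt_ofReal_exp ξ).const_mul (u₁ 1)) using 1
          rw [du ξ hξ]; ring) hξ one_pos
    have l := lu.sub (lE.const_mul (u₁ 1))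
    rw [mul_zero, sub_zero] at l
    have := tendsto_nhds_unique (tendsto_const_nhds.congr' (by
      filter_upwards [eventually_gt_atTop 0] with ξ hξ; rw [c ξ hξ])) l
    intro ξ hξ
    rw [← sub_eq_zero, c ξ hξ, this]
  have eW : ∀ ξ, 0 < ξ → W ξ = u₁ 1 * Real.exp (-2 * ξ) ^ 2 / 2 := by
    have c : ∀ ξ, 0 < ξ → W ξ - u₁ 1 * Real.exp (-2 * ξ) ^ 2 / 2 =
        W 1 - u₁ 1 * Real.exp (-2 * 1) ^ 2 / 2 :=
      fun ξ hξ => eq_of_hasDerivAt_zero (F := fun ξ : ℝ => W ξ - u₁ 1 * (Real.exp (-2 * ξ) : ℂ) ^ 2 / 2)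
        (fun ξ hξ => by
          convert! (hW' ξ hξ).sub
            ((((hasDerivAt_ofReal_exp ξ).pow 2).const_mul (u₁ 1)).div_const 2) using 1
          rw [eu ξ hξ]; push_cast; ring) hξ one_pos
    have l := lW.sub (((lE.pow 2).const_mul (u₁ 1)).div_const 2)
    have := tendsto_nhds_unique (tendsto_const_nhds.congr' (by
      filter_upwards [eventually_gt_atTop 0] with ξ hξ; rw [c ξ hξ])) l
    intro ξ hξ
    rw [← sub_eq_zero, c ξ hξ, this]
    simp
  refine ⟨u₁ 1, ?_, ?_⟩
  · filter_upwards [hV] with ξ h1 h0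
    rw [h1 h0]
    have := hu ξ
    rw [eu ξ h0, sq] at this
    have n2 := ofReal_exp_ne_zero (-ξ)
    refine mul_left_cancel₀ n2 ?_
    linear_combination -2 * this
  -- the equation for `u = d x`, `W = d x² / 2` at `ξ = 1` determines `d`
  · have := e1 1
    rw [eu 1 one_pos, eW 1 one_pos, eq_div_iff (mul_ne_zero (ofReal_exp_ne_zero _)
      (one_sub_ofReal_exp_ne_zero one_pos))] at this
    refine mul_left_cancel₀ (ofReal_exp_ne_zero (-2 * 1)) ?_
    linear_combination 2 * this

/-! ### Injectivity of `L - z` -/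

theorem tail_congr {v w : ℝ → ℂ} (h : ∀ᵐ ξ, ξ ∈ Ioi (0 : ℝ) → v ξ = w ξ) {ξ : ℝ} (hξ : 0 ≤ ξ) :
    tail v ξ = tail w ξ :=
  setIntegral_congr_ae measurableSet_Ioi (by
    filter_upwards [h] with η hη h0
    rw [hη (hξ.trans_lt h0)])

theorem tail_exp (d : ℂ) (ξ : ℝ) :
    tail (fun η => 2 * d * Real.exp (-η)) ξ = d / 2 * Real.exp (-4 * ξ) := by
  have : ∀ η : ℝ, Real.exp (-3 * η) • (2 * d * (Real.exp (-η) : ℂ)) =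
      2 * d * (Real.exp (-4 * η) : ℝ) := fun η => by
    rw [Complex.real_smul, show -4 * η = -3 * η + -η by ring, Real.exp_add]
    push_cast; ring
  simp only [tail, this]
  rw [integral_const_mul, integral_complex_ofReal, integral_exp_mul_Ioi (by norm_num)]
  push_cast
  ring

/-- On each half-line an element of the kernel is a multiple of `e^{-|ξ|}`, and the two factors
solve a linear system with determinant `-(z² + (b - 2)(b - 4))`. -/
theorem injective_shift {b : ℝ} {z : ℂ} (hz : z ^ 2 ≠ -((b - 2) * (b - 4) : ℝ))
    (hz' : ¬ (0 < |z.re| ∧ |z.re| < 5 - b)) :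
    Function.Injective (UnboundedSpectrum.shift (L b) z) := by
  rw [← LinearMap.ker_eq_bot, LinearMap.ker_eq_bot']
  intro v hv
  have h : IsSol b z (v : H) 0 := (isSol_shift b z v).congr .rfl (by
    rw [hv]; exact Lp.coeFn_zero ℂ 2 volume)
  have h' : IsSol b (-z) (fun ξ => (v : H) (-ξ)) 0 := by
    have := h.comp_neg
    simp only [Pi.zero_apply, neg_zero] at this
    exact this
  have hz1 : 0 ≤ z.re ∨ z.re ≤ b - 5 := by
    by_contra! hc
    exact hz' ⟨abs_pos.2 hc.1.ne, by rw [abs_of_neg hc.1]; linarith⟩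
  have hz2 : 0 ≤ (-z).re ∨ (-z).re ≤ b - 5 := by
    by_contra! hc
    rw [Complex.neg_re] at hc
    exact hz' ⟨abs_pos.2 (by linarith), by rw [abs_of_pos (by linarith)]; linarith⟩
  obtain ⟨d, hd, e⟩ := h.exists_eq_exp hz1
  obtain ⟨d', hd', e'⟩ := h'.exists_eq_exp hz2
  simp only [neg_neg] at e'
  rw [tail_congr hd' le_rfl, tail_exp, mul_zero, Real.exp_zero] at e
  rw [tail_congr hd le_rfl, tail_exp, mul_zero, Real.exp_zero] at e'
  push_cast at e e' hz
  have hdet : -(z ^ 2 + (b - 2) * (b - 4)) ≠ (0 : ℂ) := fun h => hz (by linear_combination -h)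
  have d0 : d = 0 := (mul_eq_zero.1 (show -(z ^ 2 + (b - 2) * (b - 4)) * d = 0 by
    linear_combination (1 - z) * e + (b - 3) * e')).resolve_left hdet
  have d0' : d' = 0 := (mul_eq_zero.1 (show -(z ^ 2 + (b - 2) * (b - 4)) * d' = 0 by
    linear_combination (1 + z) * e' + (b - 3) * e)).resolve_left hdet
  refine Subtype.ext (Lp.ext ?_)
  have hneg := (Measure.measurePreserving_neg (volume : Measure ℝ)).quasiMeasurePreserving.ae hd'
  refine EventuallyEq.trans ?_ (Lp.coeFn_zero ℂ 2 volume).symm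
  filter_upwards [hd, hneg, Measure.ae_ne volume (0 : ℝ)] with ξ h1 h2 h3
  rcases lt_or_gt_of_ne h3 with h | h
  · have := h2 (by simpa using h)
    simpa [d0'] using this
  · simpa [d0] using h1 h

/-! ### Assembling solutions from the two half-lines -/

/-- The function equal to `V` on `(0, ∞)` and to the reflection of `W` on `(-∞, 0]`. -/
def glue (V W : ℝ → ℂ) (ξ : ℝ) : ℂ := if 0 < ξ then V ξ else W (-ξ)

theorem glue_of_pos (V W : ℝ → ℂ) {ξ : ℝ} (hξ : 0 < ξ) : glue V W ξ = V ξ := if_pos hξ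

theorem glue_neg_of_pos (V W : ℝ → ℂ) {ξ : ℝ} (hξ : 0 < ξ) : glue V W (-ξ) = W ξ := by
  rw [glue, if_neg (by linarith), neg_neg]

theorem memLp_glue {V W : ℝ → ℂ} (hV : MemLp V 2 (volume.restrict (Ioi (0 : ℝ))))
    (hW : MemLp W 2 (volume.restrict (Ioi (0 : ℝ)))) : MemLp (glue V W) 2 (volume : Measure ℝ) := by
  refine MemLp.ae_eq ?_ (((memLp_indicator_iff_restrict measurableSet_Ioi).2 hV).add
    (memLp_comp_neg ((memLp_indicator_iff_restrict measurableSet_Ioi).2 hW)))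
  filter_upwards [Measure.ae_ne volume (0 : ℝ)] with ξ h
  rcases lt_or_gt_of_ne h with h | h
  · simp [glue, h, not_lt.2 h.le]
  · simp [glue, h, not_lt.2 h.le]

theorem tail_glue (V W : ℝ → ℂ) {ξ : ℝ} (hξ : 0 ≤ ξ) : tail (glue V W) ξ = tail V ξ :=
  tail_congr (Eventually.of_forall fun _ h => glue_of_pos V W h) hξ

theorem tail_glue_neg (V W : ℝ → ℂ) {ξ : ℝ} (hξ : 0 ≤ ξ) :
    tail (fun η => glue V W (-η)) ξ = tail W ξ :=
  tail_congr (Eventually.of_forall fun _ h => glue_neg_of_pos V W h) hξ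

/-- `V` solves `(L - z) v = F` on `(0, ∞)`; the number `P` stands for `(b - 3)` times the moment
`tail (fun η => v (-η)) 0` of the other half of `v`, which is prescribed only when two half-line
solutions are glued. -/
structure IsHalfSol (b : ℝ) (z P : ℂ) (V F : ℝ → ℂ) : Prop where
  memLp : MemLp V 2 (volume.restrict (Ioi (0 : ℝ)))
  memLp_source : MemLp F 2 (volume.restrict (Ioi (0 : ℝ)))
  tendsto : Tendsto (fun ξ => (1 - Real.exp (-2 * ξ)) • V ξ) (𝓝[>] 0) (𝓝 0)
  hasDerivAt : ∀ ξ, 0 < ξ → HasDerivAt V (((z + (4 - b) * Real.exp (-2 * ξ)) * V ξ + F ξ +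
    4 * (b - 3) * Real.exp ξ * tail V ξ - 4 * Real.exp (-ξ) * P) / (1 - Real.exp (-2 * ξ))) ξ

theorem IsHalfSol.congr_P {b : ℝ} {z P P' : ℂ} {V F : ℝ → ℂ} (h : IsHalfSol b z P V F)
    (hP : P = P') : IsHalfSol b z P' V F := hP ▸ h

theorem hasDerivAt_comp_neg {V : ℝ → ℂ} {V' : ℂ} {ξ : ℝ} (h : HasDerivAt V V' (-ξ)) :
    HasDerivAt (fun ξ => V (-ξ)) (-V') ξ := by
  have := HasDerivAt.scomp (h := fun ξ : ℝ => -ξ) ξ h (hasDerivAt_neg ξ)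
  simpa [Function.comp_def] using this

/-- The left half of `L v = z v + f` is a half-line equation for `-z`, by reflection. -/
theorem isSol_glue {b : ℝ} {z : ℂ} {V W F G : ℝ → ℂ}
    (hV : IsHalfSol b z ((b - 3) * tail W 0) V F) (hW : IsHalfSol b (-z) ((b - 3) * tail V 0) W G) :
    IsSol b z (glue V W) (glue F fun ξ => -G ξ) := by
  have hm := memLp_glue hV.memLp hW.memLp
  have hf := memLp_glue hV.memLp_source (W := fun ξ => -G ξ) hW.memLp_source.neg
  set v := glue V W with hv
  set f := glue F fun ξ => -G ξ with hfdef
  refine ⟨hm, hf, isWeightedDeriv_of_hasDerivAt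
    (v' := fun ξ => ((1 - phi ξ ^ 2 : ℝ) : ℂ)⁻¹ * weightedDerivRHS b z v f ξ) hm
    (memLp_weightedDerivRHS b z hm hf) (fun ξ hξ => ?_) (fun ξ hξ => ?_) ?_⟩
  · rcases lt_or_gt_of_ne hξ with h | h
    · obtain ⟨η, rfl⟩ : ∃ η, ξ = -η := ⟨-ξ, by ring⟩
      have h0 : 0 < η := by linarith
      have d := hasDerivAt_comp_neg (ξ := -η) (V := W) (by rw [neg_neg]; exact hW.hasDerivAt η h0)
      refine (d.congr_of_eventuallyEq ?_).congr_deriv ?_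
      · filter_upwards [Iio_mem_nhds h] with x hx
        rw [hv, glue, if_neg (not_lt.2 (le_of_lt hx))]
      · have q : qFun v (-η) = -qFun (fun η => v (-η)) η := by rw [qFun_neg, neg_neg]
        rw [weightedDerivRHS, q, qFun_of_pos (memLp_comp_neg hm) h0, phi_neg, phi'_neg,
          phi_sq_of_pos h0.le, mul_neg, phi_mul_phi'_of_pos h0, hv, hfdef, tail_glue_neg V W h0.le,
          glue_neg_of_pos _ _ h0, glue_neg_of_pos _ _ h0, Complex.real_smul]
        simp only [neg_neg]
        rw [tail_glue V W le_rfl, div_eq_inv_mul]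
        push_cast
        ring
    · refine ((hV.hasDerivAt ξ h).congr_of_eventuallyEq ?_).congr_deriv ?_
      · filter_upwards [Ioi_mem_nhds h] with x hx
        exact glue_of_pos V W hx
      · rw [weightedDerivRHS, qFun_of_pos hm h, phi_mul_phi'_of_pos h, phi_sq_of_pos (le_of_lt h),
          hv, hfdef, tail_glue V W (le_of_lt h), tail_glue_neg V W le_rfl, glue_of_pos _ _ h,
          glue_of_pos _ _ h, Complex.real_smul, div_eq_inv_mul]
        push_cast
        ring
  · have : (1 - phi ξ ^ 2 : ℝ) ≠ 0 := by
      have : phi ξ < 1 := by rw [phi, Real.exp_lt_one_iff]; simpa using hξ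
      have := phi_nonneg ξ
      nlinarith
    rw [Complex.real_smul, mul_inv_cancel_left₀ (Complex.ofReal_ne_zero.2 this)]
  · rw [← Set.Iio_union_Ioi, nhdsWithin_union] 
    refine Tendsto.sup ?_ ?_
    · have t : Tendsto (fun x : ℝ => -x) (𝓝[<] 0) (𝓝[>] 0) := by
        have := tendsto_neg_nhdsLT (a := (0 : ℝ))
        rwa [neg_zero] at this
      have := hW.tendsto.comp t
      refine this.congr' ?_
      filter_upwards [self_mem_nhdsWithin] with x hx
      have hx' : x < 0 := hx
      rw [Function.comp_apply, hv, glue, if_neg (not_lt.2 hx'.le), ← phi_sq_of_pos (by linarith),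
        phi_neg]
    · refine hV.tendsto.congr' ?_
      filter_upwards [self_mem_nhdsWithin] with x hx
      have hx' : 0 < x := hx
      rw [hv, glue_of_pos V W hx', phi_sq_of_pos hx'.le]

theorem integrableOn_tail_of_restrict {V : ℝ → ℂ} (hV : MemLp V 2 (volume.restrict (Ioi (0 : ℝ))))
    {ξ : ℝ} (hξ : 0 ≤ ξ) : IntegrableOn (fun η => Real.exp (-3 * η) • V η) (Ioi ξ) :=
  (integrableOn_tail (memLp_glue hV hV) hξ).congr_fun (fun η hη => by
    simp only [glue_of_pos V V (hξ.trans_lt hη)]) measurableSet_Ioi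

theorem IsHalfSol.add {b : ℝ} {z P P' : ℂ} {V V' F F' : ℝ → ℂ} (h : IsHalfSol b z P V F)
    (h' : IsHalfSol b z P' V' F') : IsHalfSol b z (P + P') (V + V') (F + F') where
  memLp := h.memLp.add h'.memLp
  memLp_source := h.memLp_source.add h'.memLp_source
  tendsto := by simpa [smul_add] using h.tendsto.add h'.tendsto
  hasDerivAt ξ hξ := by
    refine ((h.hasDerivAt ξ hξ).add (h'.hasDerivAt ξ hξ)).congr_deriv ?_
    have : tail (V + V') ξ = tail V ξ + tail V' ξ := by
      simp only [tail, Pi.add_apply, smul_add]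
      exact integral_add (integrableOn_tail_of_restrict h.memLp hξ.le)
        (integrableOn_tail_of_restrict h'.memLp hξ.le)
    rw [this]
    simp only [Pi.add_apply]
    ring

theorem tail_const_mul (V : ℝ → ℂ) (K : ℂ) (ξ : ℝ) : tail (fun η => K * V η) ξ = K * tail V ξ := by
  rw [tail, tail, ← integral_const_mul]
  simp only [mul_smul_comm]

theorem IsHalfSol.const_mul {b : ℝ} {z P : ℂ} {V F : ℝ → ℂ} (h : IsHalfSol b z P V F) (K : ℂ) :
    IsHalfSol b z (K * P) (fun ξ => K * V ξ) (fun ξ => K * F ξ) where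
  memLp := h.memLp.const_mul K
  memLp_source := h.memLp_source.const_mul K
  tendsto := by simpa [mul_left_comm] using h.tendsto.const_mul K
  hasDerivAt ξ hξ := by
    refine ((h.hasDerivAt ξ hξ).const_mul K).congr_deriv ?_
    rw [tail_const_mul]
    ring

/-- The multiples of `e^{-ξ}` solve the homogeneous equation on the half-line, for suitable `P`. -/
theorem isHalfSol_exp (b : ℝ) (z d : ℂ) :
    IsHalfSol b z (d * (1 + z) / 2) (fun ξ => 2 * d * Real.exp (-ξ)) 0 where
  memLp := by
    refine ((memLp_phi.ofReal (K := ℂ)).const_mul (2 * d)).restrict (Ioi (0 : ℝ)) |>.ae_eq ?_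
    filter_upwards [ae_restrict_mem measurableSet_Ioi] with ξ hξ
    rw [phi, abs_of_pos (show 0 < ξ from hξ)]
    rfl
  memLp_source := MemLp.zero'
  tendsto := by
    have : Continuous fun ξ : ℝ => (1 - Real.exp (-2 * ξ)) • (2 * d * (Real.exp (-ξ) : ℂ)) := by
      fun_prop
    have := (this.tendsto 0).mono_left (nhdsWithin_le_nhds (s := Ioi 0))
    simpa using this
  hasDerivAt ξ hξ := by
    refine (((hasDerivAt_neg ξ).exp.ofReal_comp).const_mul (2 * d)).congr_deriv ?_
    have n1 := one_sub_ofReal_exp_ne_zero hξ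
    have n2 := ofReal_exp_ne_zero (-ξ)
    have e1 : (Real.exp ξ : ℂ) = (Real.exp (-ξ) : ℂ)⁻¹ := by
      rw [Real.exp_neg]; push_cast; rw [inv_inv]
    have e2 : (Real.exp (-2 * ξ) : ℂ) = (Real.exp (-ξ) : ℂ) ^ 2 := by
      rw [← Complex.ofReal_pow, ← Real.exp_nat_mul]; congr 2; push_cast; ring
    have e4 : (Real.exp (-4 * ξ) : ℂ) = (Real.exp (-ξ) : ℂ) ^ 4 := by
      rw [← Complex.ofReal_pow, ← Real.exp_nat_mul]; congr 2; push_cast; ring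
    rw [tail_exp, e4, e1]
    rw [e2] at n1 ⊢
    generalize hy : Real.exp (-ξ) = y at *
    simp only [Pi.zero_apply]
    push_cast
    field_simp
    ring

/-! ### Integrating twice on the half-line -/

theorem exists_hasDerivAt_eq {g : ℝ → ℂ} (hg : ContinuousOn g (Ioi 0)) :
    ∃ f : ℝ → ℂ, ∀ ξ, 0 < ξ → HasDerivAt f (g ξ) ξ := by
  have hi : ∀ {s t : ℝ}, 0 < s → 0 < t → IntervalIntegrable g volume s t := fun hs ht =>
    intervalIntegrable_of_locallyIntegrableOn_Ioi (hg.locallyIntegrableOn measurableSet_Ioi) hs ht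
  refine ⟨fun ξ => ∫ η in (1 : ℝ)..ξ, g η, fun ξ hξ => hasDerivAt_of_eq_integral hg
    (fun s t hs ht => ?_) hξ⟩
  exact intervalIntegral.integral_interval_sub_left (hi one_pos ht) (hi one_pos hs)

theorem norm_sub_le_of_norm_deriv_le {f f' : ℝ → ℂ} {G G' : ℝ → ℝ} {s t : ℝ} (hs : 0 < s)
    (hst : s ≤ t) (hf : ∀ ξ, 0 < ξ → HasDerivAt f (f' ξ) ξ)
    (hG : ∀ ξ, 0 < ξ → HasDerivAt G (G' ξ) ξ) (h : ∀ ξ ∈ Icc s t, ‖f' ξ‖ ≤ G' ξ) :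
    ‖f t - f s‖ ≤ G t - G s := by
  refine image_norm_le_of_norm_deriv_right_le_deriv_boundary' (f := fun x => f x - f s)
    (f' := f') (B := fun x => G x - G s) (B' := G') (a := s) (b := t)
    (fun x hx => ?_) (fun x hx => ?_) (by simp) (fun x hx => ?_) (fun x hx => ?_)
    (fun x hx => h x (Ico_subset_Icc_self hx)) (right_mem_Icc.2 hst)
  · exact ((hf x (hs.trans_le hx.1)).sub_const _).continuousAt.continuousWithinAt
  · exact ((hf x (hs.trans_le hx.1)).sub_const _).hasDerivWithinAt
  · exact ((hG x (hs.trans_le hx.1)).sub_const _).continuousAt.continuousWithinAt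
  · exact ((hG x (hs.trans_le hx.1)).sub_const _).hasDerivWithinAt

theorem hasDerivAt_exp_mul_div {a : ℝ} (ha : a ≠ 0) (C ξ : ℝ) :
    HasDerivAt (fun ξ => C / a * Real.exp (a * ξ)) (C * Real.exp (a * ξ)) ξ := by
  convert! (((hasDerivAt_id ξ).const_mul a).exp).const_mul (C / a) using 1
  field_simp
  simp

theorem exists_norm_le_exp {f f' : ℝ → ℂ} {C a : ℝ} (ha : 0 < a)
    (hf : ∀ ξ, 0 < ξ → HasDerivAt f (f' ξ) ξ) (h : ∀ ξ, 1 ≤ ξ → ‖f' ξ‖ ≤ C * Real.exp (a * ξ)) :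
    ∃ C', ∀ ξ, 1 ≤ ξ → ‖f ξ‖ ≤ C' * Real.exp (a * ξ) := by
  have hC : 0 ≤ C := nonneg_of_mul_nonneg_left ((norm_nonneg _).trans (h 1 le_rfl)) (Real.exp_pos _)
  refine ⟨‖f 1‖ + C / a, fun ξ hξ => ?_⟩
  have h1 := norm_sub_le_of_norm_deriv_le one_pos hξ hf
    (fun ξ _ => hasDerivAt_exp_mul_div ha.ne' C ξ) fun η hη => h η hη.1
  have h2 : ‖f ξ‖ ≤ ‖f ξ - f 1‖ + ‖f 1‖ := by simpa using norm_add_le (f ξ - f 1) (f 1)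
  have h3 : 1 ≤ Real.exp (a * ξ) := Real.one_le_exp (by positivity)
  have h4 : 0 ≤ C / a * Real.exp (a * 1) := by positivity
  nlinarith [norm_nonneg (f 1)]

theorem exists_norm_sub_le_exp {f f' : ℝ → ℂ} {C a : ℝ} (ha : a < 0)
    (hf : ∀ ξ, 0 < ξ → HasDerivAt f (f' ξ) ξ) (h : ∀ ξ, 1 ≤ ξ → ‖f' ξ‖ ≤ C * Real.exp (a * ξ)) :
    ∃ l C', ∀ ξ, 1 ≤ ξ → ‖f ξ - l‖ ≤ C' * Real.exp (a * ξ) := by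
  have hC : 0 ≤ C := nonneg_of_mul_nonneg_left ((norm_nonneg _).trans (h 1 le_rfl)) (Real.exp_pos _)
  have key : ∀ s t, 1 ≤ s → s ≤ t → ‖f s - f t‖ ≤ C / -a * Real.exp (a * s) := fun s t hs hst => by
    have h1 := norm_sub_le_of_norm_deriv_le (one_pos.trans_le hs) hst hf
      (fun ξ _ => hasDerivAt_exp_mul_div ha.ne C ξ) fun η hη => h η (hs.trans hη.1)
    have h2 : 0 ≤ C / -a * Real.exp (a * t) :=
      mul_nonneg (div_nonneg hC (by linarith)) (Real.exp_pos _).le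
    rw [norm_sub_rev]
    rw [div_neg] at h2 ⊢
    linarith
  have hlim : Tendsto (fun x : ℝ => C / -a * Real.exp (a * x)) atTop (𝓝 0) := by
    simpa using (Real.tendsto_exp_atBot.comp
      ((tendsto_id (α := ℝ)).const_mul_atTop_of_neg ha)).const_mul (C / -a)
  have hcau : CauchySeq fun n : ℕ => f (n + 1) := by
    refine cauchySeq_of_le_tendsto_0' (fun n : ℕ => C / -a * Real.exp (a * (n + 1)))
      (fun n m hnm => ?_) ?_
    · rw [dist_eq_norm]
      exact key _ _ (by simp) (by simpa using hnm)
    · exact hlim.comp (tendsto_atTop_add_const_right _ _ tendsto_natCast_atTop_atTop)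
  obtain ⟨l, hl⟩ := cauchySeq_tendsto_of_complete hcau
  refine ⟨l, C / -a, fun ξ hξ => ?_⟩
  refine le_of_tendsto ((tendsto_const_nhds.sub hl).norm) ?_
  filter_upwards [(tendsto_atTop_add_const_right _ (1 : ℝ)
    (tendsto_natCast_atTop_atTop (R := ℝ))).eventually_ge_atTop ξ] with n hn
  exact key _ _ hξ hn

theorem exists_norm_le_rpow {f f' : ℝ → ℂ} {C r : ℝ} (hr : r < -1)
    (hf : ∀ ξ, 0 < ξ → HasDerivAt f (f' ξ) ξ) (h : ∀ ξ ∈ Ioc (0 : ℝ) 1, ‖f' ξ‖ ≤ C * ξ ^ r) :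
    ∃ C', ∀ ξ ∈ Ioc (0 : ℝ) 1, ‖f ξ‖ ≤ C' * ξ ^ (r + 1) := by
  have hC : 0 ≤ C := by
    have := (norm_nonneg _).trans (h 1 ⟨one_pos, le_rfl⟩)
    rwa [Real.one_rpow, mul_one] at this
  refine ⟨‖f 1‖ + C / -(r + 1), fun ξ hξ => ?_⟩
  have hr0 : r + 1 ≠ 0 := by linarith
  have h1 := norm_sub_le_of_norm_deriv_le (G := fun ξ => C / (r + 1) * ξ ^ (r + 1))
    (G' := fun ξ => C * ξ ^ r) hξ.1 hξ.2 hf (fun ξ hξ => by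
      convert! (Real.hasDerivAt_rpow_const (p := r + 1) (Or.inl hξ.ne')).const_mul (C / (r + 1)) using 1
      rw [add_sub_cancel_right]; field_simp) fun η hη => h η ⟨hξ.1.trans_le hη.1, hη.2⟩
  rw [Real.one_rpow, mul_one, norm_sub_rev] at h1
  have h2 : ‖f ξ‖ ≤ ‖f ξ - f 1‖ + ‖f 1‖ := by simpa using norm_add_le (f ξ - f 1) (f 1)
  have h3 : 1 ≤ ξ ^ (r + 1) :=
    Real.one_le_rpow_of_pos_of_le_one_of_nonpos hξ.1 hξ.2 (by linarith)
  have h4 : C / (r + 1) ≤ 0 := div_nonpos_of_nonneg_of_nonpos hC (by linarith)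
  rw [div_neg]
  nlinarith [norm_nonneg (f 1)]

/-- Two integrations with respect to `x = e^{-2ξ}`: functions `u`, `u₁` with `u' = u₁` and
`u₁' = h`, derivatives in `x`, such that `u` vanishes at infinity. The exponents `a` and `r`
measure the growth of `h` at infinity and at `0`; each integration gains a factor `x` at infinity
and a factor `ξ` at `0`. -/
theorem exists_second_primitive {h : ℝ → ℂ} {C a r : ℝ} (hc : ContinuousOn h (Ioi 0)) (ha : 0 < a)
    (ha' : a < 1) (hr : r < -2)
    (hi : ∀ ξ, 1 ≤ ξ → ‖(Real.exp (-2 * ξ) : ℂ) * h ξ‖ ≤ C * Real.exp (a * ξ))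
    (h0 : ∀ ξ ∈ Ioc (0 : ℝ) 1, ‖h ξ‖ ≤ C * ξ ^ r) :
    ∃ (u u₁ : ℝ → ℂ) (C' : ℝ),
      (∀ ξ, 0 < ξ → HasDerivAt u (-2 * Real.exp (-2 * ξ) * u₁ ξ) ξ) ∧
      (∀ ξ, 0 < ξ → HasDerivAt u₁ (-2 * Real.exp (-2 * ξ) * h ξ) ξ) ∧
      (∀ ξ, 1 ≤ ξ → ‖u₁ ξ‖ ≤ C' * Real.exp (a * ξ)) ∧
      (∀ ξ, 1 ≤ ξ → ‖u ξ‖ ≤ C' * Real.exp ((a - 2) * ξ)) ∧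
      ∀ ξ ∈ Ioc (0 : ℝ) 1, ‖u ξ‖ ≤ C' * ξ ^ (r + 2) := by
  have hE : ContinuousOn (fun ξ : ℝ => -2 * (Real.exp (-2 * ξ) : ℂ)) (Ioi 0) :=
    Continuous.continuousOn (by fun_prop)
  have hE1 : ∀ ξ : ℝ, 0 < ξ → ‖(Real.exp (-2 * ξ) : ℂ)‖ ≤ 1 := fun ξ hξ => by
    rw [Complex.norm_real, Real.norm_of_nonneg (Real.exp_pos _).le, Real.exp_le_one_iff]; linarith
  obtain ⟨u₁, d1⟩ := exists_hasDerivAt_eq (g := fun ξ => -2 * Real.exp (-2 * ξ) * h ξ) (hE.mul hc)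
  obtain ⟨C₁, b1⟩ := exists_norm_le_exp (C := 2 * C) ha d1 fun ξ hξ => by
    rw [mul_assoc, norm_mul, norm_neg, Complex.norm_ofNat, mul_assoc]
    exact mul_le_mul_of_nonneg_left (hi ξ hξ) two_pos.le
  obtain ⟨C₂, b2⟩ := exists_norm_le_rpow (C := 2 * C) (r := r) (by linarith) d1 fun ξ hξ => by
    rw [mul_assoc, norm_mul, norm_neg, Complex.norm_ofNat, mul_assoc, norm_mul]
    refine mul_le_mul_of_nonneg_left ?_ two_pos.le
    exact (mul_le_of_le_one_left (norm_nonneg _) (hE1 ξ hξ.1)).trans (h0 ξ hξ)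
  have c1 : ContinuousOn u₁ (Ioi 0) := fun ξ hξ => (d1 ξ hξ).continuousAt.continuousWithinAt
  obtain ⟨u, d⟩ := exists_hasDerivAt_eq (g := fun ξ => -2 * Real.exp (-2 * ξ) * u₁ ξ) (hE.mul c1)
  obtain ⟨l, C₃, b3⟩ := exists_norm_sub_le_exp (C := 2 * C₁) (a := a - 2) (by linarith) d
    fun ξ hξ => by
      rw [mul_assoc, norm_mul, norm_neg, Complex.norm_ofNat, mul_assoc]
      refine mul_le_mul_of_nonneg_left ?_ two_pos.le
      rw [norm_mul, Complex.norm_real, Real.norm_of_nonneg (Real.exp_pos _).le,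
        show (a - 2) * ξ = -2 * ξ + a * ξ by ring, Real.exp_add, mul_left_comm]
      exact mul_le_mul_of_nonneg_left (b1 ξ hξ) (Real.exp_pos _).le
  have d' : ∀ ξ, 0 < ξ → HasDerivAt (fun ξ => u ξ - l) (-2 * Real.exp (-2 * ξ) * u₁ ξ) ξ :=
    fun ξ hξ => (d ξ hξ).sub_const l
  obtain ⟨C₄, b4⟩ := exists_norm_le_rpow (C := 2 * C₂) (r := r + 1) (by linarith) d' fun ξ hξ => by
    rw [mul_assoc, norm_mul, norm_neg, Complex.norm_ofNat, mul_assoc, norm_mul]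
    refine mul_le_mul_of_nonneg_left ?_ two_pos.le
    exact (mul_le_of_le_one_left (norm_nonneg _) (hE1 ξ hξ.1)).trans (b2 ξ hξ)
  refine ⟨fun ξ => u ξ - l, u₁, max C₁ (max C₃ C₄), d', d1, fun ξ hξ => ?_, fun ξ hξ => ?_,
    fun ξ hξ => ?_⟩
  · refine (b1 ξ hξ).trans ?_
    gcongr
    exact le_max_left _ _
  · refine (b3 ξ hξ).trans ?_
    gcongr
    exact (le_max_left _ _).trans (le_max_right _ _)
  · refine (b4 ξ hξ).trans ?_
    rw [show r + 1 + 1 = r + 2 by ring]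
    have := hξ.1
    gcongr
    exact (le_max_right _ _).trans (le_max_right _ _)

theorem memLp_of_norm_le {V : ℝ → ℂ} {C a r : ℝ} (hc : ContinuousOn V (Ioi 0)) (ha : a < 0)
    (hr : -1 / 2 < r) (hi : ∀ ξ, 1 ≤ ξ → ‖V ξ‖ ≤ C * Real.exp (a * ξ))
    (h0 : ∀ ξ ∈ Ioc (0 : ℝ) 1, ‖V ξ‖ ≤ C * ξ ^ r) : MemLp V 2 (volume.restrict (Ioi (0 : ℝ))) := by
  have hm : AEStronglyMeasurable V (volume.restrict (Ioi (0 : ℝ))) :=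
    hc.aestronglyMeasurable measurableSet_Ioi
  rw [memLp_two_iff_integrable_sq_norm hm, ← Ioc_union_Ioi_eq_Ioi (zero_le_one (α := ℝ))]
  refine IntegrableOn.union (?_ : IntegrableOn _ _ _) (?_ : IntegrableOn _ _ _)
  · have hI : IntegrableOn (fun ξ : ℝ => C ^ 2 * ξ ^ (2 * r)) (Ioc 0 1) := by
      have := (intervalIntegral.intervalIntegrable_rpow' (a := 0) (b := 1) (r := 2 * r)
        (by linarith)).const_mul (C ^ 2)
      rwa [intervalIntegrable_iff_integrableOn_Ioc_of_le zero_le_one] at this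
    refine hI.mono' ((hm.mono_measure (Measure.restrict_mono Ioc_subset_Ioi_self le_rfl)).norm.pow 2)
      ?_
    filter_upwards [ae_restrict_mem measurableSet_Ioc] with ξ hξ
    rw [Real.norm_of_nonneg (sq_nonneg _)]
    refine (pow_le_pow_left₀ (norm_nonneg _) (h0 ξ hξ) 2).trans_eq ?_
    rw [mul_pow, ← Real.rpow_natCast, ← Real.rpow_natCast, ← Real.rpow_mul hξ.1.le]
    push_cast; ring_nf
  · have hI : IntegrableOn (fun ξ : ℝ => C ^ 2 * Real.exp (2 * a * ξ)) (Ioi 1) :=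
      (integrableOn_exp_mul_Ioi (by linarith) 1).const_mul _
    refine hI.mono' ((hm.mono_measure
      (Measure.restrict_mono (Ioi_subset_Ioi zero_le_one) le_rfl)).norm.pow 2) ?_
    filter_upwards [ae_restrict_mem measurableSet_Ioi] with ξ hξ
    rw [Real.norm_of_nonneg (sq_nonneg _)]
    refine (pow_le_pow_left₀ (norm_nonneg _) (hi ξ (le_of_lt hξ)) 2).trans_eq ?_
    rw [mul_pow, ← Real.exp_nat_mul]
    push_cast; ring_nf

/-! ### Growth of `x^p (1 - x)^q` at the two ends -/

theorem exists_norm_le_of_isBigO_atTop {f : ℝ → ℂ} {a : ℝ} (hf : ContinuousOn f (Ioi 0))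
    (h : f =O[atTop] fun ξ => Real.exp (a * ξ)) :
    ∃ C, ∀ ξ, 1 ≤ ξ → ‖f ξ‖ ≤ C * Real.exp (a * ξ) := by
  obtain ⟨C, hC⟩ := h.bound
  obtain ⟨N, hN⟩ := eventually_atTop.1 hC
  have hc : ContinuousOn (fun ξ => ‖f ξ‖ / Real.exp (a * ξ)) (Icc 1 N) :=
    (hf.mono fun x hx => one_pos.trans_le hx.1).norm.div (by fun_prop)
      fun ξ _ => (Real.exp_pos _).ne'
  obtain ⟨C', hC'⟩ := isCompact_Icc.exists_bound_of_continuousOn hc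
  refine ⟨max C C', fun ξ hξ => ?_⟩
  rw [← div_le_iff₀ (Real.exp_pos _)]
  rcases le_total N ξ with h | h
  · refine le_trans ?_ (le_max_left _ _)
    rw [div_le_iff₀ (Real.exp_pos _)]
    simpa using hN ξ h
  · exact ((le_abs_self _).trans (hC' ξ ⟨hξ, h⟩)).trans (le_max_right _ _)

theorem exists_norm_le_of_isBigO_zero {f : ℝ → ℂ} {r : ℝ} (hf : ContinuousOn f (Ioi 0))
    (h : f =O[𝓝[>] 0] fun ξ => ξ ^ r) :
    ∃ C, ∀ ξ ∈ Ioc (0 : ℝ) 1, ‖f ξ‖ ≤ C * ξ ^ r := by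
  obtain ⟨C, hC⟩ := h.bound
  obtain ⟨s, hs, hN⟩ := mem_nhdsGT_iff_exists_Ioo_subset.1 hC
  have hs' : (0 : ℝ) < s := hs
  have hc : ContinuousOn (fun ξ => ‖f ξ‖ / ξ ^ r) (Icc s 1) :=
    (hf.mono fun x hx => hs'.trans_le hx.1).norm.div
      (continuousOn_id.rpow_const fun x hx => Or.inl (hs'.trans_le hx.1).ne')
      fun ξ hx => (Real.rpow_pos_of_pos (hs'.trans_le hx.1) _).ne'
  obtain ⟨C', hC'⟩ := isCompact_Icc.exists_bound_of_continuousOn hc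
  refine ⟨max C C', fun ξ hξ => ?_⟩
  have hp := Real.rpow_pos_of_pos hξ.1 r
  rw [← div_le_iff₀ hp]
  rcases lt_or_ge ξ s with h | h
  · refine le_trans ?_ (le_max_left _ _)
    rw [div_le_iff₀ hp]
    simpa [abs_of_pos hp] using hN ⟨hξ.1, h⟩
  · exact ((le_abs_self _).trans (hC' ξ ⟨h, hξ.2⟩)).trans (le_max_right _ _)

theorem xpow_isBigO_atTop (p q : ℂ) {a : ℝ} (ha : -2 * p.re ≤ a) :
    xpow p q =O[atTop] fun ξ => Real.exp (a * ξ) := by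
  have l := tendsto_one_sub_exp_atTop.rpow_const (p := q.re) (Or.inl one_ne_zero)
  rw [Real.one_rpow] at l
  refine IsBigO.of_bound 2 ?_
  filter_upwards [eventually_gt_atTop 0, l.eventually_le_const one_lt_two] with ξ h0 h1
  rw [norm_xpow p q h0, Real.norm_of_nonneg (Real.exp_pos _).le, mul_comm]
  refine mul_le_mul h1 ?_ (Real.exp_pos _).le two_pos.le
  rw [Real.exp_le_exp]
  nlinarith

theorem tendsto_one_sub_exp_div : Tendsto (fun ξ : ℝ => (1 - Real.exp (-2 * ξ)) / ξ) (𝓝[>] 0) (𝓝 2) := by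
  have h := (hasDerivAt_one_sub_exp 0).tendsto_slope_zero_right
  simp only [mul_zero, Real.exp_zero, sub_self, sub_zero, zero_add, mul_one, smul_eq_mul] at h
  exact h.congr fun ξ => by rw [inv_mul_eq_div]

theorem xpow_isBigO_zero (p q : ℂ) {r : ℝ} (hr : r ≤ q.re) :
    xpow p q =O[𝓝[>] 0] fun ξ => ξ ^ r := by
  have l := tendsto_one_sub_exp_div.rpow_const (p := q.re) (Or.inl two_ne_zero)
  have l' : Tendsto (fun ξ : ℝ => Real.exp (-2 * p.re * ξ)) (𝓝[>] 0) (𝓝 1) := by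
    have : Continuous fun ξ : ℝ => Real.exp (-2 * p.re * ξ) := by fun_prop
    have := (this.tendsto 0).mono_left (nhdsWithin_le_nhds (s := Ioi 0))
    simpa using this
  have l2 := (l'.mul l).isBigO_one ℝ
  have h1 : (fun ξ : ℝ => ξ ^ q.re) =O[𝓝[>] 0] fun ξ => ξ ^ r := by
    refine IsBigO.of_bound 1 ?_
    filter_upwards [Ioc_mem_nhdsGT (one_pos (α := ℝ))] with ξ hξ
    have := Real.rpow_le_rpow_of_exponent_ge hξ.1 hξ.2 hr
    have p1 := Real.rpow_pos_of_pos hξ.1 q.re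
    have p2 := Real.rpow_pos_of_pos hξ.1 r
    rwa [Real.norm_of_nonneg p1.le, Real.norm_of_nonneg p2.le, one_mul]
  refine (IsBigO.congr' (l2.mul h1) ?_ (by simp) : (fun ξ => ‖xpow p q ξ‖) =O[_] _).of_norm_left
  filter_upwards [self_mem_nhdsWithin] with ξ hξ
  have hξ' : 0 < ξ := hξ
  rw [norm_xpow p q hξ, Real.div_rpow (one_sub_exp_pos hξ).le hξ'.le, mul_assoc,
    div_mul_cancel₀ _ (Real.rpow_pos_of_pos hξ' _).ne']

/-! ### Solving the equation on the half-line -/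

theorem hasDerivAt_tail_of_restrict {V : ℝ → ℂ} (hV : MemLp V 2 (volume.restrict (Ioi (0 : ℝ))))
    (hc : ContinuousOn V (Ioi 0)) {ξ : ℝ} (hξ : 0 < ξ) :
    HasDerivAt (tail V) (-(Real.exp (-3 * ξ) • V ξ)) ξ := by
  refine (hasDerivAt_tail (memLp_glue hV hV) (Eventually.of_forall fun ξ h => glue_of_pos V V h) hc
    hξ).congr_of_eventuallyEq ?_
  filter_upwards [Ioi_mem_nhds hξ] with η hη
  exact (tail_glue V V (le_of_lt hη)).symm

theorem tendsto_tail_atTop {V : ℝ → ℂ} (hV : MemLp V 2 (volume.restrict (Ioi (0 : ℝ)))) :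
    Tendsto (tail V) atTop (𝓝 0) := by
  refine squeeze_zero_norm' (a := fun ξ => ‖(Real.exp (-2 * ξ) : ℂ)‖ * ∫ η, ‖phi η • glue V V η‖)
    ?_ ?_
  · filter_upwards [eventually_gt_atTop 0] with ξ hξ
    rw [← tail_glue V V hξ.le, Complex.norm_real, Real.norm_of_nonneg (Real.exp_pos _).le]
    exact norm_tail_le (memLp_glue hV hV) hξ.le
  · simpa using ((tendsto_exp_neg_mul_atTop (a := -2) (by norm_num)).norm).mul_const
      (∫ η, ‖phi η • glue V V η‖)

theorem tendsto_zero_of_norm_le_exp {f : ℝ → ℂ} {C a : ℝ} (ha : a < 0)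
    (h : ∀ ξ, 1 ≤ ξ → ‖f ξ‖ ≤ C * Real.exp (a * ξ)) : Tendsto f atTop (𝓝 0) := by
  refine squeeze_zero_norm' (a := fun ξ => C * Real.exp (a * ξ)) ?_ ?_
  · filter_upwards [eventually_ge_atTop 1] with ξ hξ using h ξ hξ
  · simpa using (Real.tendsto_exp_atBot.comp
      ((tendsto_id (α := ℝ)).const_mul_atTop_of_neg ha)).const_mul C

/-- Variation of constants for the first order equation satisfied by `u''`: if
`k' = ρ G''` with `ρ = x^{(z + 1) / 2} (1 - x)^{(b - 2 - z) / 2}`, then `u'' = k / (x (1 - x) ρ)`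
gives a solution with source `-4 e^ξ G`, as soon as `k` vanishes near the ends at which
`1 / (x (1 - x) ρ)` is too large. Primes are derivatives with respect to `x`; `G₁` and `G₂` are `G'`
and `G''`. -/
theorem exists_isHalfSol {b : ℝ} {z : ℂ} {k G G₁ G₂ : ℝ → ℂ} {C : ℝ}
    (hG : ∀ ξ, 0 < ξ → HasDerivAt G (-2 * Real.exp (-2 * ξ) * G₁ ξ) ξ)
    (hG₁ : ∀ ξ, 0 < ξ → HasDerivAt G₁ (-2 * Real.exp (-2 * ξ) * G₂ ξ) ξ)
    (hk : ∀ ξ, 0 < ξ → HasDerivAt k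
      (-2 * Real.exp (-2 * ξ) * xpow ((z + 1) / 2) ((b - 2 - z) / 2) ξ * G₂ ξ) ξ)
    (hGm : MemLp (fun ξ => -4 * Real.exp ξ * G ξ) 2 (volume.restrict (Ioi (0 : ℝ))))
    (hGi : Tendsto G atTop (𝓝 0)) (hC : ∀ ξ, 0 < ξ → ‖k ξ‖ ≤ C)
    (hi : z.re < 0 ∨ ∀ᶠ ξ in atTop, k ξ = 0) (h0 : b - 5 < z.re ∨ ∀ᶠ ξ in 𝓝[>] 0, k ξ = 0) :
    ∃ (u u₁ : ℝ → ℂ) (P : ℂ),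
      (∀ ξ, 0 < ξ → HasDerivAt u (-2 * Real.exp (-2 * ξ) * u₁ ξ) ξ) ∧
      (∀ ξ, 0 < ξ → HasDerivAt u₁
        (-2 * Real.exp (-2 * ξ) * (xpow (-(z + 3) / 2) ((z - b) / 2) ξ * k ξ)) ξ) ∧
      IsHalfSol b z P (fun ξ => 2 * Real.exp ξ * u ξ) (fun ξ => -4 * Real.exp ξ * G ξ) := by
  set h₀ := xpow (-(z + 3) / 2) ((z - b) / 2) with hh₀
  set ρ := xpow ((z + 1) / 2) ((b - 2 - z) / 2) with hρ
  have kc : ContinuousOn k (Ioi 0) := fun ξ hξ => (hk ξ hξ).continuousAt.continuousWithinAt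
  have hc : ContinuousOn (fun ξ => h₀ ξ * k ξ) (Ioi 0) := (continuousOn_xpow _ _).mul kc
  -- growth of `u''` at the two ends
  obtain ⟨a, a0, a1, ha⟩ : ∃ a : ℝ, 0 < a ∧ a < 1 ∧
      (fun ξ : ℝ => (Real.exp (-2 * ξ) : ℂ) * (h₀ ξ * k ξ)) =O[atTop] fun ξ => Real.exp (a * ξ) := by
    rcases hi with hi | hi
    · refine ⟨max (z.re + 1) (1 / 2), by positivity, max_lt (by linarith) (by norm_num), ?_⟩
      have e : ∀ ξ : ℝ, (Real.exp (-2 * ξ) : ℂ) * (h₀ ξ * k ξ) =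
          xpow (-(z + 1) / 2) ((z - b) / 2) ξ * k ξ := fun ξ => by
        rw [← xpow_one_zero, ← mul_assoc, hh₀, xpow_mul]; congr 2 <;> ring
      simp only [e]
      have k1 : k =O[atTop] fun _ => (1 : ℝ) := IsBigO.of_bound C (by
        filter_upwards [eventually_gt_atTop 0] with ξ hξ
        simpa using hC ξ hξ)
      simpa using (xpow_isBigO_atTop (-(z + 1) / 2) ((z - b) / 2)
        (a := max (z.re + 1) (1 / 2)) (by
          rw [Complex.div_ofNat_re, Complex.neg_re, Complex.add_re, Complex.one_re]
          refine le_trans (le_of_eq ?_) (le_max_left _ _)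
          ring)).mul k1
    · refine ⟨1 / 2, by norm_num, by norm_num, ?_⟩
      refine (isBigO_zero _ _).congr' ?_ EventuallyEq.rfl
      filter_upwards [hi] with ξ h
      simp [h]
  obtain ⟨r, r0, r1, hr⟩ : ∃ r : ℝ, r < -2 ∧ -5 / 2 < r ∧
      (fun ξ : ℝ => h₀ ξ * k ξ) =O[𝓝[>] 0] fun ξ => ξ ^ r := by
    rcases h0 with h0 | h0
    · refine ⟨min ((z.re - b) / 2) (-9 / 4), min_lt_of_right_lt (by norm_num),
        lt_min (by linarith) (by norm_num), ?_⟩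
      have k1 : k =O[𝓝[>] 0] fun _ => (1 : ℝ) := IsBigO.of_bound C (by
        filter_upwards [self_mem_nhdsWithin] with ξ hξ
        simpa using hC ξ hξ)
      have := (xpow_isBigO_zero (-(z + 3) / 2) ((z - b) / 2)
        (r := min ((z.re - b) / 2) (-9 / 4)) (by
          rw [Complex.div_ofNat_re, Complex.sub_re, Complex.ofReal_re]
          exact min_le_left _ _)).mul k1
      simp only [mul_one] at this
      exact this
    · refine ⟨-9 / 4, by norm_num, by norm_num, ?_⟩
      refine (isBigO_zero _ _).congr' ?_ EventuallyEq.rfl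
      filter_upwards [h0] with ξ h
      simp [h]
  have hEc : Continuous fun ξ : ℝ => (Real.exp (-2 * ξ) : ℂ) := by fun_prop
  obtain ⟨C₁, hC₁⟩ := exists_norm_le_of_isBigO_atTop (hEc.continuousOn.mul hc) ha
  obtain ⟨C₂, hC₂⟩ := exists_norm_le_of_isBigO_zero hc hr
  obtain ⟨u, u₁, C', d0, d1, b1, bu, bu0⟩ := exists_second_primitive (C := max C₁ C₂) hc a0 a1 r0
    (fun ξ hξ => (hC₁ ξ hξ).trans (by gcongr; exact le_max_left _ _))
    (fun ξ hξ => (hC₂ ξ hξ).trans (by have := hξ.1; gcongr; exact le_max_right _ _))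
  have uc : ContinuousOn u (Ioi 0) := fun ξ hξ => (d0 ξ hξ).continuousAt.continuousWithinAt
  set V : ℝ → ℂ := fun ξ => 2 * Real.exp ξ * u ξ with hV
  have nV : ∀ ξ, ‖V ξ‖ = 2 * Real.exp ξ * ‖u ξ‖ := fun ξ => by
    rw [hV, norm_mul, norm_mul, Complex.norm_real, Complex.norm_ofNat,
      Real.norm_of_nonneg (Real.exp_pos _).le]
  have Vc : ContinuousOn V (Ioi 0) := (Continuous.continuousOn (by fun_prop)).mul uc
  have hC'0 : 0 ≤ C' := nonneg_of_mul_nonneg_left ((norm_nonneg _).trans (bu 1 le_rfl))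
    (Real.exp_pos _)
  have bV0 : ∀ ξ ∈ Ioc (0 : ℝ) 1, ‖V ξ‖ ≤ 2 * Real.exp 1 * C' * ξ ^ (r + 2) := fun ξ hξ => by
    rw [nV, mul_assoc _ C']
    have := hξ.1
    exact mul_le_mul (by gcongr; exact hξ.2) (bu0 ξ hξ) (norm_nonneg _) (by positivity)
  have Vm : MemLp V 2 (volume.restrict (Ioi (0 : ℝ))) := by
    refine memLp_of_norm_le (C := 2 * Real.exp 1 * C') (a := a - 1) (r := r + 2) Vc
      (by linarith) (by linarith) (fun ξ hξ => ?_) bV0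
    rw [nV]
    calc 2 * Real.exp ξ * ‖u ξ‖ ≤ 2 * Real.exp ξ * (C' * Real.exp ((a - 2) * ξ)) :=
          mul_le_mul_of_nonneg_left (bu ξ hξ) (by positivity)
      _ = 2 * 1 * C' * Real.exp ((a - 1) * ξ) := by
          rw [show (a - 1) * ξ = ξ + (a - 2) * ξ by ring, Real.exp_add]; ring
      _ ≤ _ := by gcongr; exact Real.one_le_exp zero_le_one
  have V0 : Tendsto (fun ξ => (1 - Real.exp (-2 * ξ)) • V ξ) (𝓝[>] 0) (𝓝 0) := by
    have o : V =O[𝓝[>] 0] fun ξ => ξ ^ (r + 2) := IsBigO.of_bound (2 * Real.exp 1 * C') (by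
      filter_upwards [Ioc_mem_nhdsGT (one_pos (α := ℝ))] with ξ hξ
      rw [Real.norm_of_nonneg (Real.rpow_nonneg hξ.1.le _)]
      exact bV0 ξ hξ)
    have o1 : (fun ξ : ℝ => 1 - Real.exp (-2 * ξ)) =O[𝓝[>] 0] fun ξ => ξ := by
      refine IsBigO.of_bound 2 ?_
      filter_upwards [self_mem_nhdsWithin] with ξ hξ
      have hξ' : 0 < ξ := hξ
      rw [Real.norm_of_nonneg (one_sub_exp_pos hξ).le, Real.norm_of_nonneg hξ'.le]
      linarith [Real.add_one_le_exp (-2 * ξ)]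
    have o2 := o1.smul o
    have t : Tendsto (fun ξ : ℝ => ξ ^ (r + 3)) (𝓝[>] 0) (𝓝 0) := by
      have := (Real.continuousAt_rpow_const 0 (r + 3) (Or.inr (by linarith))).tendsto
      rw [Real.zero_rpow (by linarith)] at this
      exact this.mono_left nhdsWithin_le_nhds
    refine o2.trans_tendsto (t.congr' ?_)
    filter_upwards [self_mem_nhdsWithin] with ξ hξ
    have hξ' : 0 < ξ := hξ
    rw [smul_eq_mul, mul_comm, ← Real.rpow_add_one hξ'.ne']
    congr 1; ring
  have dW : ∀ ξ, 0 < ξ → HasDerivAt (tail V) (-2 * Real.exp (-2 * ξ) * u ξ) ξ := fun ξ hξ => by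
    refine (hasDerivAt_tail_of_restrict Vm Vc hξ).congr_deriv ?_
    rw [hV, Complex.real_smul, show -3 * ξ = -2 * ξ + -ξ by ring, Real.exp_add, Real.exp_neg]
    have := ofReal_exp_ne_zero ξ
    push_cast at this ⊢
    field_simp
  have dE := hasDerivAt_ofReal_exp
  -- `T₁` is the derivative in `x` of `T u - G`; it is constant by the choice of `u''`
  obtain ⟨T₁, hT₁⟩ : ∃ T₁ : ℝ → ℂ, ∀ ξ, T₁ ξ = (1 - 2 * Real.exp (-2 * ξ)) * u₁ ξ +
      Real.exp (-2 * ξ) * (1 - Real.exp (-2 * ξ)) * (h₀ ξ * k ξ) + (5 - b) / 2 * u ξ +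
      ((z - 1) / 2 + (5 - b) / 2 * Real.exp (-2 * ξ)) * u₁ ξ + (b - 3) * u ξ - G₁ ξ :=
    ⟨_, fun _ => rfl⟩
  have dT₁ : ∀ ξ, 0 < ξ → HasDerivAt T₁ 0 ξ := fun ξ hξ => by
    have n1 := one_sub_ofReal_exp_ne_zero hξ
    have n2 := ofReal_exp_ne_zero (-2 * ξ)
    have hone : h₀ ξ * ρ ξ * (Real.exp (-2 * ξ) * (1 - Real.exp (-2 * ξ))) = 1 := by
      rw [← xpow_one_zero, hh₀, hρ, xpow_mul, xpow_one_zero, ← xpow_zero_one hξ, ← xpow_one_zero,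
        xpow_mul, xpow_mul]
      convert! xpow_zero ξ using 2 <;> ring
    have := (((((((dE ξ).const_mul 2).const_sub 1).mul (d1 ξ hξ)).add
      (((dE ξ).mul ((dE ξ).const_sub 1)).mul
        ((hasDerivAt_xpow (-(z + 3) / 2) ((z - b) / 2) hξ).mul (hk ξ hξ)))).add
      ((d0 ξ hξ).const_mul ((5 - b) / 2 : ℂ))).add
      ((((dE ξ).const_mul ((5 - b) / 2 : ℂ)).const_add ((z - 1) / 2)).mul (d1 ξ hξ))).add
      ((d0 ξ hξ).const_mul (b - 3 : ℂ)) |>.sub (hG₁ ξ hξ)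
    convert! this using 1
    · funext ξ; rw [hT₁]; rfl
    · simp only [Pi.mul_apply]
      rw [← hh₀]
      generalize (Real.exp (-2 * ξ) : ℂ) = E at *
      field_simp
      linear_combination (2 * E * G₂ ξ) * hone
  have hP : ∀ ξ, 0 < ξ → T₁ ξ = T₁ 1 := fun ξ hξ => eq_of_hasDerivAt_zero dT₁ hξ one_pos
  -- hence `T u - G - T₁ x` is constant, and it vanishes at infinity
  obtain ⟨T, hT⟩ : ∃ T : ℝ → ℂ, ∀ ξ, T ξ = Real.exp (-2 * ξ) * (1 - Real.exp (-2 * ξ)) * u₁ ξ +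
      ((z - 1) / 2 + (5 - b) / 2 * Real.exp (-2 * ξ)) * u ξ + (b - 3) * tail V ξ - G ξ -
        T₁ 1 * Real.exp (-2 * ξ) := ⟨_, fun _ => rfl⟩
  have dT : ∀ ξ, 0 < ξ → HasDerivAt T 0 ξ := fun ξ hξ => by
    have := ((((((dE ξ).mul ((dE ξ).const_sub 1)).mul (d1 ξ hξ)).add
      ((((dE ξ).const_mul ((5 - b) / 2 : ℂ)).const_add ((z - 1) / 2)).mul (d0 ξ hξ))).add
      ((dW ξ hξ).const_mul (b - 3 : ℂ))).sub (hG ξ hξ)).sub ((dE ξ).const_mul (T₁ 1))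
    convert! this using 1
    · funext ξ; rw [hT]; rfl
    · simp only [Pi.mul_apply]
      rw [← hP ξ hξ, hT₁]
      ring
  have lE := tendsto_exp_neg_mul_atTop (a := -2) (by norm_num)
  have lT : Tendsto T atTop (𝓝 0) := by
    have lu : Tendsto u atTop (𝓝 0) := tendsto_zero_of_norm_le_exp (a := a - 2) (by linarith) bu
    have lu1 : Tendsto (fun ξ : ℝ => (Real.exp (-2 * ξ) : ℂ) * u₁ ξ) atTop (𝓝 0) :=
      tendsto_zero_of_norm_le_exp (C := C') (a := a - 2) (by linarith) fun ξ hξ => by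
        rw [norm_mul, Complex.norm_real, Real.norm_of_nonneg (Real.exp_pos _).le,
          show (a - 2) * ξ = -2 * ξ + a * ξ by ring, Real.exp_add, mul_left_comm]
        exact mul_le_mul_of_nonneg_left (b1 ξ hξ) (Real.exp_pos _).le
    have := ((((lu1.mul (lE.const_sub 1)).add
      (((lE.const_mul ((5 - b) / 2 : ℂ)).const_add ((z - 1) / 2)).mul lu)).add
      ((tendsto_tail_atTop Vm).const_mul (b - 3 : ℂ))).sub hGi).sub (lE.const_mul (T₁ 1))
    refine (this.congr fun ξ => ?_).trans_eq (by simp)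
    rw [hT]; ring
  have T0 : ∀ ξ, 0 < ξ → T ξ = 0 := fun ξ hξ => by
    refine tendsto_nhds_unique (tendsto_const_nhds.congr' ?_) lT
    filter_upwards [eventually_gt_atTop 0] with η hη using eq_of_hasDerivAt_zero dT hξ hη
  refine ⟨u, u₁, T₁ 1, d0, d1, Vm, hGm, V0, fun ξ hξ => ?_⟩
  have n1 := one_sub_ofReal_exp_ne_zero hξ
  have n2 := ofReal_exp_ne_zero ξ
  have e := T0 ξ hξ
  rw [hT] at e
  refine ((((Real.hasDerivAt_exp ξ).ofReal_comp).const_mul 2).mul (d0 ξ hξ)).congr_deriv ?_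
  rw [eq_div_iff n1]
  have e2 : (Real.exp (-ξ) : ℂ) = Real.exp ξ * Real.exp (-2 * ξ) := by
    rw [← Complex.ofReal_mul, ← Real.exp_add]; congr 2; ring
  simp only [hV] at e
  rw [e2]
  linear_combination (-4 * (Real.exp ξ : ℂ)) * e

/-! ### Eigenvectors -/

theorem tail_add {V W : ℝ → ℂ} (hV : MemLp V 2 (volume.restrict (Ioi (0 : ℝ))))
    (hW : MemLp W 2 (volume.restrict (Ioi (0 : ℝ)))) {ξ : ℝ} (hξ : 0 ≤ ξ) :
    tail (V + W) ξ = tail V ξ + tail W ξ := by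
  simp only [tail, Pi.add_apply, smul_add]
  exact integral_add (integrableOn_tail_of_restrict hV hξ) (integrableOn_tail_of_restrict hW hξ)

theorem eq_zero_of_glue_ae_eq_zero {V W : ℝ → ℂ} (hV : ContinuousOn V (Ioi 0))
    (hW : ContinuousOn W (Ioi 0)) (h : glue V W =ᵐ[volume] 0) {ξ : ℝ} (hξ : 0 < ξ) :
    V ξ = 0 ∧ W ξ = 0 := by
  have h1 : V =ᵐ[volume.restrict (Ioi (0 : ℝ))] 0 := by
    rw [EventuallyEq, ae_restrict_iff' measurableSet_Ioi]
    filter_upwards [h] with η h h0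
    rw [← glue_of_pos V W h0, h]
  have h2 : W =ᵐ[volume.restrict (Ioi (0 : ℝ))] 0 := by
    rw [EventuallyEq, ae_restrict_iff' measurableSet_Ioi]
    have := (Measure.measurePreserving_neg (volume : Measure ℝ)).quasiMeasurePreserving.ae h
    filter_upwards [this] with η h h0
    rw [← glue_neg_of_pos V W h0, h]
    rfl
  exact ⟨Measure.eqOn_open_of_ae_eq h1 isOpen_Ioi hV continuousOn_const hξ,
    Measure.eqOn_open_of_ae_eq h2 isOpen_Ioi hW continuousOn_const hξ⟩

theorem IsHalfSol.continuousOn {b : ℝ} {z P : ℂ} {V F : ℝ → ℂ} (h : IsHalfSol b z P V F) :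
    ContinuousOn V (Ioi 0) := fun ξ hξ => (h.hasDerivAt ξ hξ).continuousAt.continuousWithinAt

theorem mem_pointSpectrum_iff_exists_isSol {b : ℝ} {z : ℂ} :
    z ∈ UnboundedSpectrum.pointSpectrum (L b) ↔
      ∃ v : ℝ → ℂ, IsSol b z v 0 ∧ ¬ v =ᵐ[volume] 0 := by
  constructor
  · rintro ⟨v, hv, h⟩
    refine ⟨(v : H), (isSol_shift b z v).congr .rfl ?_, fun h0 => hv ?_⟩
    · have : UnboundedSpectrum.shift (L b) z v = 0 := sub_eq_zero.2 h
      rw [this]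
      exact Lp.coeFn_zero ℂ 2 volume
    · exact Lp.ext (h0.trans (Lp.coeFn_zero ℂ 2 volume).symm)
  · rintro ⟨v, hv, h⟩
    obtain ⟨u, hu, hu'⟩ := hv.exists_shift_eq
    refine ⟨u, fun h0 => h ?_, ?_⟩
    · rw [h0] at hu
      exact hu.symm.trans (Lp.coeFn_zero ℂ 2 volume)
    · exact sub_eq_zero.1 (Lp.ext (hu'.trans (Lp.coeFn_zero ℂ 2 volume).symm))

theorem neg_mem_pointSpectrum {b : ℝ} {z : ℂ} (h : z ∈ UnboundedSpectrum.pointSpectrum (L b)) :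
    -z ∈ UnboundedSpectrum.pointSpectrum (L b) := by
  rw [mem_pointSpectrum_iff_exists_isSol] at h ⊢
  obtain ⟨v, hv, h⟩ := h
  refine ⟨fun ξ => v (-ξ), ?_, fun h0 => h ?_⟩
  · have := hv.comp_neg
    simp only [Pi.zero_apply, neg_zero] at this
    exact this
  · have := (Measure.measurePreserving_neg (volume : Measure ℝ)).quasiMeasurePreserving.ae h0
    filter_upwards [this] with ξ hξ
    simpa using hξ

/-- If `z² = -(b - 2)(b - 4)`, then `L - z` annihilates a function which is a multiple of
`e^{-|ξ|}` on each half-line. -/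
theorem mem_pointSpectrum_of_sq_eq {b : ℝ} {z : ℂ} (hz : z ^ 2 = -((b - 2) * (b - 4)))
    (hz1 : 1 + z ≠ 0) : z ∈ UnboundedSpectrum.pointSpectrum (L b) := by
  have h := isSol_glue
    ((isHalfSol_exp b z (b - 3)).congr_P (P' := (b - 3) * tail (fun ξ => 2 * (1 + z) * Real.exp (-ξ)) 0)
      (by rw [tail_exp, mul_zero, Real.exp_zero]; push_cast; ring))
    ((isHalfSol_exp b (-z) (1 + z)).congr_P
      (P' := (b - 3) * tail (fun ξ => 2 * ((b : ℂ) - 3) * Real.exp (-ξ)) 0)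
      (by
        rw [tail_exp, mul_zero, Real.exp_zero]; push_cast
        linear_combination -hz / 2))
  refine mem_pointSpectrum_iff_exists_isSol.2 ⟨_, h.congr .rfl (Eventually.of_forall fun ξ => ?_),
    fun h0 => ?_⟩
  · simp [glue]
  · have := (eq_zero_of_glue_ae_eq_zero (isHalfSol_exp b z (b - 3)).continuousOn
      (isHalfSol_exp b (-z) (1 + z)).continuousOn h0 one_pos).2
    exact mul_ne_zero (mul_ne_zero two_ne_zero hz1) (ofReal_exp_ne_zero _) this

theorem exists_ne_zero_of_two_equations (a₁ a₂ a₃ b₁ b₂ b₃ : ℂ) :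
    ∃ x y w : ℂ, (x ≠ 0 ∨ y ≠ 0 ∨ w ≠ 0) ∧ a₁ * x + a₂ * y + a₃ * w = 0 ∧
      b₁ * x + b₂ * y + b₃ * w = 0 := by
  let M : Matrix (Fin 2) (Fin 3) ℂ := !![a₁, a₂, a₃; b₁, b₂, b₃]
  have hk : LinearMap.ker M.mulVecLin ≠ ⊥ := LinearMap.ker_ne_bot_of_finrank_lt (by simp)
  obtain ⟨v, hv, h0⟩ := Submodule.exists_mem_ne_zero_of_ne_bot hk
  have hv' : M.mulVec v = 0 := hv
  have h1 := congrFun hv' 0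
  have h2 := congrFun hv' 1
  simp [M, Matrix.mulVec, dotProduct, Fin.sum_univ_three] at h1 h2
  refine ⟨v 0, v 1, v 2, ?_, h1, h2⟩
  by_contra! hc
  exact h0 (by ext i; fin_cases i <;> simp [hc])

/-- For `b - 5 < Re z < 0` the half-line solution with
`u'' = x^{-(z + 3) / 2} (1 - x)^{(z - b) / 2}` is square-integrable. A combination of it with
multiples of `e^{-|ξ|}` on the two half-lines satisfies the two coupling conditions: three unknowns
for two equations. -/
theorem mem_pointSpectrum_of_neg {b : ℝ} {z : ℂ} (hz : z.re < 0) (hz' : b - 5 < z.re) :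
    z ∈ UnboundedSpectrum.pointSpectrum (L b) := by
  obtain ⟨u, u₁, P, d0, d1, hV⟩ := exists_isHalfSol (b := b) (z := z) (k := fun _ => 1) (G := 0)
    (G₁ := 0) (G₂ := 0) (C := 1) (fun ξ _ => by simp)
    (fun ξ _ => by simp)
    (fun ξ _ => by simpa using hasDerivAt_const ξ (1 : ℂ)) (by simp) tendsto_const_nhds
    (fun _ _ => by simp) (Or.inl hz) (Or.inl hz')
  set V : ℝ → ℂ := fun ξ => 2 * Real.exp ξ * u ξ with hVdef
  obtain ⟨K, γ, γ', hne, e1, e2⟩ := exists_ne_zero_of_two_equations P ((1 + z) / 2) (-(b - 3) / 2)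
    ((b - 3) * tail V 0) ((b - 3) / 2) (-(1 - z) / 2)
  have hR := (hV.const_mul K).add (isHalfSol_exp b z γ)
  have hL := isHalfSol_exp b (-z) γ'
  have hsol := isSol_glue
    (hR.congr_P (P' := (b - 3) * tail (fun ξ => 2 * γ' * Real.exp (-ξ)) 0) (by
      rw [tail_exp, mul_zero, Real.exp_zero]; push_cast
      linear_combination e1))
    (hL.congr_P (P' := (b - 3) * tail ((fun ξ => K * V ξ) + fun ξ => 2 * γ * Real.exp (-ξ)) 0) (by
      rw [tail_add (hV.const_mul K).memLp (isHalfSol_exp b z γ).memLp le_rfl, tail_exp,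
        tail_const_mul, mul_zero, Real.exp_zero]
      push_cast
      linear_combination -e2))
  refine mem_pointSpectrum_iff_exists_isSol.2
    ⟨_, hsol.congr .rfl (Eventually.of_forall fun ξ => ?_), fun h0 => ?_⟩
  · simp [glue]
  have hz0 := fun ξ (hξ : 0 < ξ) => eq_zero_of_glue_ae_eq_zero hR.continuousOn hL.continuousOn h0 hξ
  have hγ' : γ' = 0 := by
    have := (hz0 1 one_pos).2
    simpa using this
  -- the eigenfunction is not zero: two derivatives in `x` single out the coefficient `K`
  have f0 : ∀ ξ : ℝ, 0 < ξ → K * u ξ + γ * Real.exp (-2 * ξ) = 0 := fun ξ hξ => by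
    have := (hz0 ξ hξ).1
    simp only [Pi.add_apply, hVdef] at this
    have e : (Real.exp (-ξ) : ℂ) = Real.exp ξ * Real.exp (-2 * ξ) := by
      rw [← Complex.ofReal_mul, ← Real.exp_add]; congr 2; ring
    rw [e] at this
    refine mul_left_cancel₀ (ofReal_exp_ne_zero ξ) ?_
    linear_combination this / 2
  have f1 : ∀ ξ : ℝ, 0 < ξ → K * u₁ ξ + γ = 0 := fun ξ hξ => by
    have d := (((d0 ξ hξ).const_mul K).add ((hasDerivAt_ofReal_exp ξ).const_mul γ)).unique
      ((hasDerivAt_const ξ (0 : ℂ)).congr_of_eventuallyEq (by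
        filter_upwards [Ioi_mem_nhds hξ] with η hη using f0 η hη))
    refine mul_left_cancel₀ (ofReal_exp_ne_zero (-2 * ξ)) ?_
    linear_combination -d / 2
  have f2 : K = 0 := by
    have d := (((d1 1 one_pos).const_mul K).add_const γ).unique
      ((hasDerivAt_const 1 (0 : ℂ)).congr_of_eventuallyEq (by
        filter_upwards [Ioi_mem_nhds one_pos] with η hη using f1 η hη))
    have h1 := ofReal_exp_ne_zero (-2 * 1)
    have h2 := xpow_ne_zero (-(z + 3) / 2) ((z - b) / 2) 1
    refine (mul_eq_zero.1 d).resolve_right ?_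
    exact mul_ne_zero (mul_ne_zero (by norm_num) h1) (mul_ne_zero h2 one_ne_zero)
  have hγ : γ = 0 := by simpa [f2] using f1 1 one_pos
  simp [f2, hγ, hγ'] at hne

theorem mem_pointSpectrum_of_abs_re_lt {b : ℝ} {z : ℂ} (hz : 0 < |z.re|) (hz' : |z.re| < 5 - b) :
    z ∈ UnboundedSpectrum.pointSpectrum (L b) := by
  rcases lt_or_gt_of_ne (abs_pos.1 hz) with h | h
  · rw [abs_of_neg h] at hz'
    exact mem_pointSpectrum_of_neg h (by linarith)
  · rw [abs_of_pos h] at hz'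
    have := neg_mem_pointSpectrum (mem_pointSpectrum_of_neg (b := b) (z := -z) (by simpa using h)
      (by rw [Complex.neg_re]; linarith))
    rwa [neg_neg] at this

/-! ### Range of `L - z`: sources supported in `(0, ∞)` -/

/-- The derivative of `x^p (1 - x)^q` with respect to `x`. -/
def xpowDeriv (p q : ℂ) (ξ : ℝ) : ℂ :=
  xpow (p - 1) (q - 1) ξ * (p - (p + q) * Real.exp (-2 * ξ))

/-- The second derivative of `x^p (1 - x)^q` with respect to `x`. -/
def xpowDeriv₂ (p q : ℂ) (ξ : ℝ) : ℂ :=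
  xpow (p - 2) (q - 2) ξ * (p * (p - 1) - 2 * p * (p + q - 1) * Real.exp (-2 * ξ) +
    (p + q) * (p + q - 1) * Real.exp (-2 * ξ) ^ 2)

theorem xpow_sub_one (p q : ℂ) {ξ : ℝ} (hξ : 0 < ξ) :
    xpow p q ξ = xpow (p - 1) (q - 1) ξ * (Real.exp (-2 * ξ) * (1 - Real.exp (-2 * ξ))) := by
  rw [← xpow_zero_one hξ, ← xpow_one_zero, xpow_mul, xpow_mul]
  congr 1 <;> ring

theorem hasDerivAt_xpow' (p q : ℂ) {ξ : ℝ} (hξ : 0 < ξ) :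
    HasDerivAt (xpow p q) (-2 * Real.exp (-2 * ξ) * xpowDeriv p q ξ) ξ := by
  refine (hasDerivAt_xpow p q hξ).congr_deriv ?_
  have n1 := one_sub_ofReal_exp_ne_zero hξ
  rw [xpowDeriv, xpow_sub_one p q hξ]
  generalize (Real.exp (-2 * ξ) : ℂ) = E at *
  field_simp
  ring

theorem hasDerivAt_xpowDeriv (p q : ℂ) {ξ : ℝ} (hξ : 0 < ξ) :
    HasDerivAt (xpowDeriv p q) (-2 * Real.exp (-2 * ξ) * xpowDeriv₂ p q ξ) ξ := by
  have := (hasDerivAt_xpow (p - 1) (q - 1) hξ).mul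
    (((hasDerivAt_ofReal_exp ξ).const_mul (p + q)).const_sub p)
  refine this.congr_deriv ?_
  have n1 := one_sub_ofReal_exp_ne_zero hξ
  rw [xpowDeriv₂, xpow_sub_one (p - 1) (q - 1) hξ, sub_sub p, sub_sub q, one_add_one_eq_two]
  generalize (Real.exp (-2 * ξ) : ℂ) = E at *
  field_simp
  ring_nf

theorem continuousOn_xpowDeriv₂ (p q : ℂ) : ContinuousOn (xpowDeriv₂ p q) (Ioi 0) :=
  (continuousOn_xpow _ _).mul (Continuous.continuousOn (by fun_prop))

theorem hasDerivAt_of_contDiff {G : ℝ → ℂ} (hG : ContDiff ℝ ∞ G) (ξ : ℝ) :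
    HasDerivAt G (-2 * Real.exp (-2 * ξ) * (-(Real.exp (2 * ξ) / 2) * deriv G ξ)) ξ := by
  refine ((hG.differentiable (by simp)) ξ).hasDerivAt.congr_deriv ?_
  have : (Real.exp (-2 * ξ) : ℂ) * Real.exp (2 * ξ) = 1 := by
    rw [← Complex.ofReal_mul, ← Real.exp_add]; simp
  linear_combination -(deriv G ξ) * this

/-- The source `-4 e^ξ G` is attained for every test function `G`, or for those that satisfy one
condition: `k = ρ G' - ρ' G + ∫ G ρ''` is constant near each end, and the constant of integration
can be chosen so that `k` vanishes near one given end. It vanishes near both if and only if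
`∫ G ρ'' dx = 0`. -/
theorem exists_isHalfSol_of_contDiff {b : ℝ} {z : ℂ} {G : ℝ → ℂ} (hG : ContDiff ℝ ∞ G)
    (hc : HasCompactSupport G) (hs : tsupport G ⊆ Ioi 0)
    (h : z.re < 0 ∨ b - 5 < z.re ∨ ∫ ξ, G ξ *
      (Real.exp (-2 * ξ) * xpowDeriv₂ ((z + 1) / 2) ((b - 2 - z) / 2) ξ) = 0) :
    ∃ (V : ℝ → ℂ) (P : ℂ), IsHalfSol b z P V (fun ξ => -4 * Real.exp ξ * G ξ) := by
  obtain ⟨s₀, t₀, hs₀, hst₀, hsub₀⟩ := exists_Icc_of_tsupport_subset_Ioi hc hs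
  obtain ⟨s, rfl⟩ : ∃ s, s₀ = 2 * s := ⟨s₀ / 2, by ring⟩
  obtain ⟨t, rfl⟩ : ∃ t, t₀ = t - 1 := ⟨t₀ + 1, by ring⟩
  have hs0 : 0 < s := by linarith
  have hst : s ≤ t := by linarith
  have hsub : tsupport G ⊆ Ioo s t := fun x hx =>
    ⟨by linarith [(hsub₀ hx).1], by linarith [(hsub₀ hx).2]⟩
  set p := (z + 1) / 2 with hp
  set q := (b - 2 - z) / 2 with hq
  set G₁ : ℝ → ℂ := fun ξ => -(Real.exp (2 * ξ) / 2) * deriv G ξ with hG₁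
  have cG₁ : ContDiff ℝ ∞ G₁ := by
    have h1 : ContDiff ℝ ∞ fun ξ : ℝ => -((Real.exp (2 * ξ) : ℂ) / 2) :=
      ((Complex.ofRealCLM.contDiff.comp (Real.contDiff_exp.comp (contDiff_const.mul contDiff_id))).div_const
        2).neg
    exact h1.mul ((contDiff_infty_iff_deriv.1 hG).2)
  have zG : ∀ ξ, ξ ∉ Ioo s t → G ξ = 0 := fun ξ hξ =>
    image_eq_zero_of_notMem_tsupport fun h => hξ (hsub h)
  have zG₁ : ∀ ξ, ξ ∉ Ioo s t → G₁ ξ = 0 := fun ξ hξ => by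
    have : deriv G ξ = 0 := image_eq_zero_of_notMem_tsupport fun h =>
      hξ (hsub (tsupport_deriv_subset h))
    rw [hG₁]; simp [this]
  have c2 : ContinuousOn (fun ξ : ℝ => -2 * (Real.exp (-2 * ξ) : ℂ) * (G ξ * xpowDeriv₂ p q ξ)) (Ioi 0) :=
    (Continuous.continuousOn (by fun_prop)).mul
      (hG.continuous.continuousOn.mul (continuousOn_xpowDeriv₂ p q))
  -- `m` is a primitive of `G ρ''` with respect to `x`
  obtain ⟨m, hm⟩ := exists_hasDerivAt_eq c2
  have hm0 : ∀ ξ, 0 < ξ → ξ ≤ s → m ξ = m s := fun ξ h0 h1 => by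
    refine (constant_of_has_deriv_right_zero (f := m) (a := ξ) (b := s)
      (fun x hx => (hm x (h0.trans_le hx.1)).continuousAt.continuousWithinAt) (fun x hx => ?_) s
      ⟨h1, le_rfl⟩).symm
    have := (hm x (h0.trans_le hx.1)).hasDerivWithinAt (s := Ici x)
    rwa [zG x fun h => (hx.2.trans h.1).false, zero_mul, mul_zero] at this
  have hmt : ∀ ξ, t ≤ ξ → m ξ = m t := fun ξ h1 => by
    refine constant_of_has_deriv_right_zero (f := m) (a := t) (b := ξ)
      (fun x hx => (hm x (hs0.trans_le (hst.trans hx.1))).continuousAt.continuousWithinAt)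
      (fun x hx => ?_) ξ ⟨h1, le_rfl⟩
    have := (hm x (hs0.trans_le (hst.trans hx.1))).hasDerivWithinAt (s := Ici x)
    rwa [zG x fun h => (hx.1.trans_lt h.2).false, zero_mul, mul_zero] at this
  have hc0 : ∃ c : ℂ, (z.re < 0 ∨ m t = c) ∧ (b - 5 < z.re ∨ m s = c) := by
    rcases h with h | h | h
    · exact ⟨m s, Or.inl h, Or.inr rfl⟩
    · exact ⟨m t, Or.inr rfl, Or.inl h⟩
    · refine ⟨m s, Or.inr ?_, Or.inr rfl⟩
      have h1 := intervalIntegral.integral_eq_sub_of_hasDerivAt (a := s) (b := t)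
        (fun x hx => hm x (by rw [uIcc_of_le hst] at hx; exact hs0.trans_le hx.1))
        (ContinuousOn.intervalIntegrable (c2.mono fun x hx => by
          rw [uIcc_of_le hst] at hx; exact hs0.trans_le hx.1))
      rw [intervalIntegral.integral_eq_integral_of_support_subset (fun x hx => by
        by_contra hn
        refine hx ?_
        simp only [zG x fun h => hn ⟨h.1, h.2.le⟩, zero_mul, mul_zero])] at h1
      rw [← sub_eq_zero, ← h1, ← mul_zero (-2 : ℂ), ← h, ← integral_const_mul]
      congr 1
      funext x
      ring
  obtain ⟨c, hct, hcs⟩ := hc0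
  set k : ℝ → ℂ := fun ξ => xpow p q ξ * G₁ ξ - G ξ * xpowDeriv p q ξ + (m ξ - c) with hk
  have dk : ∀ ξ, 0 < ξ → HasDerivAt k (-2 * Real.exp (-2 * ξ) * xpow p q ξ *
      (-(Real.exp (2 * ξ) / 2) * deriv G₁ ξ)) ξ := fun ξ hξ => by
    refine ((((hasDerivAt_xpow' p q hξ).mul (hasDerivAt_of_contDiff cG₁ ξ)).sub
      ((hasDerivAt_of_contDiff hG ξ).mul (hasDerivAt_xpowDeriv p q hξ))).add
      ((hm ξ hξ).sub_const c)).congr_deriv ?_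
    rw [hG₁]
    ring
  have k0 : ∀ ξ, 0 < ξ → ξ ≤ s → k ξ = m s - c := fun ξ h0 h1 => by
    have hn : ξ ∉ Ioo s t := fun h => (h1.trans_lt h.1).false
    simp only [hk, zG ξ hn, zG₁ ξ hn, hm0 ξ h0 h1]; ring
  have kt : ∀ ξ, t < ξ → k ξ = m t - c := fun ξ h1 => by
    have hn : ξ ∉ Ioo s t := fun h => (h1.trans h.2).false
    simp only [hk, zG ξ hn, zG₁ ξ hn, hmt ξ h1.le]; ring
  obtain ⟨C, hC⟩ := isCompact_Icc.exists_bound_of_continuousOn (f := k) (s := Icc s t)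
    fun ξ hξ => (dk ξ (hs0.trans_le hξ.1)).continuousAt.continuousWithinAt
  have cF : Continuous fun ξ : ℝ => -4 * (Real.exp ξ : ℂ) * G ξ := by
    have := hG.continuous
    fun_prop
  obtain ⟨u, u₁, P, -, -, hV⟩ := exists_isHalfSol (b := b) (z := z) (k := k) (G := G) (G₁ := G₁)
    (G₂ := fun ξ => -(Real.exp (2 * ξ) / 2) * deriv G₁ ξ)
    (C := max C (max ‖m s - c‖ ‖m t - c‖)) (fun ξ _ => hasDerivAt_of_contDiff hG ξ)
    (fun ξ _ => hasDerivAt_of_contDiff cG₁ ξ) dk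
    ((cF.memLp_of_hasCompactSupport hc.mul_left).restrict _)
    (tendsto_const_nhds.congr' (by
      filter_upwards [eventually_gt_atTop t] with ξ hξ
      exact (zG ξ fun h => (hξ.trans h.2).false).symm))
    (fun ξ hξ => by
      rcases le_or_gt ξ s with h1 | h1
      · rw [k0 ξ hξ h1]
        exact (le_max_left _ _).trans (le_max_right _ _)
      rcases le_or_gt ξ t with h2 | h2
      · exact (hC ξ ⟨h1.le, h2⟩).trans (le_max_left _ _)
      · rw [kt ξ h2]
        exact (le_max_right _ _).trans (le_max_right _ _))
    (hct.imp id fun h => by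
      filter_upwards [eventually_gt_atTop t] with ξ hξ
      rw [kt ξ hξ, h, sub_self])
    (hcs.imp id fun h => by
      filter_upwards [Ioc_mem_nhdsGT hs0] with ξ hξ
      rw [k0 ξ hξ.1 hξ.2, h, sub_self])
  exact ⟨_, P, hV⟩

/-- Multiples of `e^{-|ξ|}` on each half-line correct the coupling between the two half-lines: the
factors solve a linear system with determinant `1 - z² - (b - 3)² = -(z² + (b - 2)(b - 4))`. -/
theorem IsHalfSol.exists_isSol {b : ℝ} {z P : ℂ} {V F : ℝ → ℂ} (h : IsHalfSol b z P V F)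
    (hz : z ^ 2 ≠ -((b - 2) * (b - 4) : ℝ)) : ∃ v, IsSol b z v (glue F 0) := by
  have hD : (1 - z ^ 2) - ((b : ℂ) - 3) ^ 2 ≠ 0 := fun h0 => hz (by
    push_cast; linear_combination -h0)
  set D := (1 - z ^ 2) - ((b : ℂ) - 3) ^ 2 with hDdef
  set w := tail V 0 with hw
  obtain ⟨γ, hγ⟩ : ∃ γ : ℂ, γ = (-2 * P * (1 - z) + 2 * (b - 3) ^ 2 * w) / D := ⟨_, rfl⟩
  obtain ⟨γ', hγ'⟩ : ∃ γ : ℂ, γ = (2 * (1 + z) * (b - 3) * w - 2 * P * (b - 3)) / D := ⟨_, rfl⟩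
  rw [eq_div_iff hD] at hγ hγ'
  have hR := h.add (isHalfSol_exp b z γ)
  have hsol := isSol_glue
    (hR.congr_P (P' := (b - 3) * tail (fun ξ => 2 * γ' * Real.exp (-ξ)) 0) (by
      rw [tail_exp, mul_zero, Real.exp_zero]; push_cast
      refine mul_left_cancel₀ hD ?_
      linear_combination (1 + z) / 2 * hγ - (b - 3) / 2 * hγ' + P * hDdef))
    ((isHalfSol_exp b (-z) γ').congr_P
      (P' := (b - 3) * tail (V + fun ξ => 2 * γ * Real.exp (-ξ)) 0) (by
      rw [tail_add h.memLp (isHalfSol_exp b z γ).memLp le_rfl, tail_exp, mul_zero, Real.exp_zero]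
      push_cast
      refine mul_left_cancel₀ hD ?_
      linear_combination (1 - z) / 2 * hγ' - (b - 3) / 2 * hγ - (b - 3) * w * hDdef))
  exact ⟨_, hsol.congr .rfl (Eventually.of_forall fun ξ => by simp [glue])⟩

/-! ### Density of the range -/

theorem exists_shift_eq_of_contDiff {b : ℝ} {z : ℂ} {G : ℝ → ℂ}
    (hz : z ^ 2 ≠ -((b - 2) * (b - 4) : ℝ)) (hG : ContDiff ℝ ∞ G)
    (hc : HasCompactSupport G) (hs : tsupport G ⊆ Ioi 0)
    (h : z.re < 0 ∨ b - 5 < z.re ∨ ∫ ξ, G ξ *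
      (Real.exp (-2 * ξ) * xpowDeriv₂ ((z + 1) / 2) ((b - 2 - z) / 2) ξ) = 0) :
    ∃ u : (L b).domain, (UnboundedSpectrum.shift (L b) z u : H) =ᵐ[volume]
      fun ξ => -4 * Real.exp ξ * G ξ := by
  obtain ⟨V, P, hV⟩ := exists_isHalfSol_of_contDiff hG hc hs h
  obtain ⟨v, hv⟩ := hV.exists_isSol hz
  obtain ⟨u, -, hu⟩ := hv.exists_shift_eq
  refine ⟨u, hu.trans (Eventually.of_forall fun ξ => ?_)⟩
  by_cases h0 : 0 < ξ
  · exact glue_of_pos _ _ h0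
  · have : G ξ = 0 := image_eq_zero_of_notMem_tsupport fun h => h0 (hs h)
    simp [glue, h0, this]

/-- A function annihilated by all test functions on `(0, ∞)` that annihilate `σ` is a multiple of
`σ`. -/
theorem exists_ae_eq_const_mul {θ σ : ℝ → ℂ} (hθ : LocallyIntegrableOn θ (Ioi 0))
    (hσ : LocallyIntegrableOn σ (Ioi 0))
    (h : ∀ G : ℝ → ℂ, ContDiff ℝ ∞ G → HasCompactSupport G → tsupport G ⊆ Ioi 0 →
      ∫ ξ, G ξ * σ ξ = 0 → ∫ ξ, G ξ * θ ξ = 0) :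
    ∃ C : ℂ, ∀ᵐ ξ, ξ ∈ Ioi (0 : ℝ) → θ ξ = C * σ ξ := by
  have hi : ∀ {f : ℝ → ℂ} (_ : LocallyIntegrableOn f (Ioi 0)) {ψ : ℝ → ℝ} (_ : ContDiff ℝ ∞ ψ)
      (_ : HasCompactSupport ψ) (_ : tsupport ψ ⊆ Ioi 0), Integrable fun ξ => (ψ ξ : ℂ) * f ξ := by
    intro f hf ψ h1 h2 h3
    simpa only [Complex.real_smul] using
      integrable_smul_of_tsupport_subset hf h1.continuous h2 h3
  obtain ⟨C, hC⟩ : ∃ C : ℂ, ∀ ψ : ℝ → ℝ, ContDiff ℝ ∞ ψ → HasCompactSupport ψ →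
      tsupport ψ ⊆ Ioi 0 → ∫ ξ, (ψ ξ : ℂ) * θ ξ = C * ∫ ξ, (ψ ξ : ℂ) * σ ξ := by
    have cast : ∀ {ψ : ℝ → ℝ}, ContDiff ℝ ∞ ψ → ContDiff ℝ ∞ fun ξ => (ψ ξ : ℂ) := fun h =>
      Complex.ofRealCLM.contDiff.comp h
    have castc : ∀ {ψ : ℝ → ℝ}, HasCompactSupport ψ → HasCompactSupport fun ξ => (ψ ξ : ℂ) :=
      fun h => h.comp_left Complex.ofReal_zero
    have casts : ∀ {ψ : ℝ → ℝ}, tsupport (fun ξ => (ψ ξ : ℂ)) ⊆ tsupport ψ := fun {ψ} =>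
      closure_mono fun x hx h0 => hx (by simp [h0])
    by_cases h0 : ∃ ψ : ℝ → ℝ, ContDiff ℝ ∞ ψ ∧ HasCompactSupport ψ ∧ tsupport ψ ⊆ Ioi 0 ∧
        ∫ ξ, (ψ ξ : ℂ) * σ ξ ≠ 0
    · obtain ⟨ψ₀, a1, a2, a3, a4⟩ := h0
      refine ⟨(∫ ξ, (ψ₀ ξ : ℂ) * θ ξ) / ∫ ξ, (ψ₀ ξ : ℂ) * σ ξ, fun ψ h1 h2 h3 => ?_⟩
      set c := (∫ ξ, (ψ ξ : ℂ) * σ ξ) / ∫ ξ, (ψ₀ ξ : ℂ) * σ ξ with hc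
      have e : ∀ {f : ℝ → ℂ} (_ : LocallyIntegrableOn f (Ioi 0)),
          ∫ ξ, ((ψ ξ : ℂ) - c * ψ₀ ξ) * f ξ =
            (∫ ξ, (ψ ξ : ℂ) * f ξ) - c * ∫ ξ, (ψ₀ ξ : ℂ) * f ξ := fun {f} hf => by
        rw [← integral_const_mul, ← integral_sub (hi hf h1 h2 h3) ((hi hf a1 a2 a3).const_mul c)]
        congr 1; funext ξ; ring
      have k := h (fun ξ => (ψ ξ : ℂ) - c * ψ₀ ξ)
        ((cast h1).sub (contDiff_const.mul (cast a1)))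
        ((castc h2).sub (castc a2).mul_left)
        ((tsupport_sub _ _).trans (union_subset (casts.trans h3)
          ((tsupport_mul_subset_right).trans (casts.trans a3))))
        (by rw [e hσ, hc, div_mul_cancel₀ _ a4, sub_self])
      rw [e hθ, sub_eq_zero] at k
      rw [k, hc]; ring
    · push Not at h0
      refine ⟨0, fun ψ h1 h2 h3 => ?_⟩
      rw [zero_mul]
      exact h _ (cast h1) (castc h2) (casts.trans h3) (h0 ψ h1 h2 h3)
  refine ⟨C, ?_⟩
  have := isOpen_Ioi.ae_eq_zero_of_integral_contDiff_smul_eq_zero (μ := (volume : Measure ℝ))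
    (f := fun ξ => θ ξ - C * σ ξ)
    (hθ.sub (hσ.continuousOn_smul isOpen_Ioi.isLocallyClosed (continuousOn_const (c := C))))
    fun ψ h1 h2 h3 => by
      have e : ∀ ξ, ψ ξ • (θ ξ - C * σ ξ) = (ψ ξ : ℂ) * θ ξ - C * ((ψ ξ : ℂ) * σ ξ) := fun ξ => by
        rw [Complex.real_smul]; ring
      simp only [e]
      rw [integral_sub (hi hθ h1 h2 h3) ((hi hσ h1 h2 h3).const_mul C), integral_const_mul,
        hC ψ h1 h2 h3, sub_self]
  filter_upwards [this] with ξ h h0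
  exact sub_eq_zero.1 (h h0)

/-- The density `x^{3/2} ρ''` of the functional which annihilates the right half of the equation,
where `ρ = x^{(z + 1) / 2} (1 - x)^{(b - 2 - z) / 2}`. The factor `x^{3/2}` comes from
`f = -4 x^{-1/2} G` and from `dx = -2 x dξ`. -/
def annihilator (b : ℝ) (z : ℂ) (ξ : ℝ) : ℂ :=
  Real.exp (-3 * ξ) * xpowDeriv₂ ((z + 1) / 2) ((b - 2 - z) / 2) ξ

theorem annihilator_eq (b : ℝ) (z : ℂ) (ξ : ℝ) :
    annihilator b z ξ = xpow (z / 2) ((b - 6 - z) / 2) ξ *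
      ((z + 1) / 2 * ((z + 1) / 2 - 1) - 2 * ((z + 1) / 2) * ((b - 1) / 2 - 1) * Real.exp (-2 * ξ) +
        (b - 1) / 2 * ((b - 1) / 2 - 1) * Real.exp (-2 * ξ) ^ 2) := by
  have : (Real.exp (-3 * ξ) : ℂ) = xpow (3 / 2) 0 ξ := by
    rw [xpow, zero_mul, Complex.exp_zero, mul_one, Complex.ofReal_exp]
    congr 1; push_cast; ring
  rw [annihilator, xpowDeriv₂, this, ← mul_assoc, xpow_mul]
  congr 1
  · congr 1 <;> ring
  · ring

theorem continuousOn_annihilator (b : ℝ) (z : ℂ) : ContinuousOn (annihilator b z) (Ioi 0) :=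
  (Continuous.continuousOn (by fun_prop)).mul (continuousOn_xpowDeriv₂ _ _)

/-- On the lines `Re z = 0` and `Re z = b - 5` the function `x^{3/2} ρ''` just fails to be
square-integrable, at infinity and at `0` respectively. -/
theorem not_memLp_annihilator {b : ℝ} {z : ℂ} (hz : z.re = 0 ∨ z.re = b - 5) :
    ¬ MemLp (annihilator b z) 2 (volume.restrict (Ioi (0 : ℝ))) := by
  intro h
  have hN := h.integrable_norm_pow (by norm_num)
  have nrm : ∀ ξ, 0 < ξ → (1 - Real.exp (-2 * ξ)) * ‖annihilator b z ξ‖ ^ 2 =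
      Real.exp (-2 * z.re * ξ) * (1 - Real.exp (-2 * ξ)) ^ (b - 5 - z.re) *
      ‖((z + 1) / 2 * ((z + 1) / 2 - 1) - 2 * ((z + 1) / 2) * ((b - 1) / 2 - 1) * Real.exp (-2 * ξ) +
        (b - 1) / 2 * ((b - 1) / 2 - 1) * Real.exp (-2 * ξ) ^ 2 : ℂ)‖ ^ 2 := fun ξ hξ => by
    have hp := one_sub_exp_pos hξ
    rw [annihilator_eq, norm_mul, norm_xpow _ _ hξ, mul_pow, mul_pow, ← Real.exp_nat_mul,
      ← Real.rpow_natCast, ← Real.rpow_mul hp.le]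
    have e1 : ((2 : ℕ) : ℝ) * (-2 * (z / 2).re * ξ) = -2 * z.re * ξ := by
      rw [Complex.div_ofNat_re]; push_cast; ring
    have e2 : ((b - 6 - z) / 2).re * ((2 : ℕ) : ℝ) = (b - 5 - z.re) - 1 := by
      rw [Complex.div_ofNat_re]
      simp only [Complex.sub_re, Complex.ofReal_re, Complex.re_ofNat]
      push_cast; ring
    rw [e1, e2, Real.rpow_sub_one hp.ne']
    generalize 1 - Real.exp (-2 * ξ) = y at *
    field_simp
  rcases hz with hz | hz
  · have l : Tendsto (fun ξ => (1 - Real.exp (-2 * ξ)) * ‖annihilator b z ξ‖ ^ 2) atTop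
        (𝓝 (‖(z + 1) / 2 * ((z + 1) / 2 - 1)‖ ^ 2)) := by
      have lE := tendsto_exp_neg_mul_atTop (a := -2) (by norm_num)
      have l1 := tendsto_one_sub_exp_atTop.rpow_const (p := b - 5 - z.re) (Or.inl one_ne_zero)
      have l2 := (((lE.const_mul (2 * ((z + 1) / 2) * (((b : ℂ) - 1) / 2 - 1))).const_sub
        ((z + 1) / 2 * ((z + 1) / 2 - 1))).add
        ((lE.pow 2).const_mul (((b : ℂ) - 1) / 2 * (((b : ℂ) - 1) / 2 - 1)))).norm.pow 2
      refine ((l1.mul l2).congr' ?_).trans_eq (by simp)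
      filter_upwards [eventually_gt_atTop 0] with ξ hξ
      rw [nrm ξ hξ, hz]
      simp
    have := eq_zero_of_tendsto_atTop hN (fun _ _ => rfl) (fun _ => by positivity) l
    rw [sq_eq_zero_iff, norm_eq_zero] at this
    -- the leading coefficient is zero only for `z = ± 1`
    have := congrArg Complex.re (show z ^ 2 = 1 by linear_combination 4 * this)
    simp [sq, hz] at this
    nlinarith [mul_self_nonneg z.im]
  · have l : Tendsto (fun ξ => (1 - Real.exp (-2 * ξ)) * ‖annihilator b z ξ‖ ^ 2) (𝓝[>] 0)
        (𝓝 (‖(b - 2 - z) / 2 * ((b - 2 - z) / 2 - 1)‖ ^ 2)) := by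
      have : Continuous fun ξ : ℝ => Real.exp (-2 * z.re * ξ) *
        ‖((z + 1) / 2 * ((z + 1) / 2 - 1) - 2 * ((z + 1) / 2) * ((b - 1) / 2 - 1) *
          Real.exp (-2 * ξ) + (b - 1) / 2 * ((b - 1) / 2 - 1) * Real.exp (-2 * ξ) ^ 2 : ℂ)‖ ^ 2 := by
        fun_prop
      have := (this.tendsto 0).mono_left (nhdsWithin_le_nhds (s := Ioi 0))
      refine (this.congr' ?_).trans_eq ?_
      · filter_upwards [self_mem_nhdsWithin] with ξ hξ
        rw [nrm ξ hξ, hz, sub_self, Real.rpow_zero, mul_one]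
      · simp only [mul_zero, Real.exp_zero, one_mul, Complex.ofReal_one]
        congr 3; ring
    have := eq_zero_of_tendsto_nhdsGT hN (fun _ _ => rfl) (fun _ => by positivity) l
    rw [sq_eq_zero_iff, norm_eq_zero, mul_eq_zero] at this
    rcases this with h | h
    · have := congrArg Complex.re h
      rw [Complex.div_ofNat_re] at this
      simp [hz] at this
      linarith
    · have := congrArg Complex.re h
      rw [Complex.sub_re, Complex.div_ofNat_re] at this
      simp [hz] at this
      linarith

/-- A square-integrable functional that annihilates the range vanishes on `(0, ∞)`: it annihilates
all test functions, or else it is a multiple of `annihilator b z`, and this is then not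
square-integrable. -/
theorem ae_eq_zero_of_integral_mul_shift_eq_zero {b : ℝ} {z : ℂ} {κ : ℝ → ℂ}
    (hκ : MemLp κ 2 (volume : Measure ℝ)) (hz : z ^ 2 ≠ -((b - 2) * (b - 4) : ℝ))
    (hz' : ¬ (0 < z.re ∧ z.re < b - 5))
    (h : ∀ u : (L b).domain, ∫ ξ, κ ξ * UnboundedSpectrum.shift (L b) z u ξ = 0) :
    ∀ᵐ ξ, ξ ∈ Ioi (0 : ℝ) → κ ξ = 0 := by
  have hli : LocallyIntegrableOn (fun ξ => Real.exp ξ • κ ξ) (Ioi 0) :=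
    LocallyIntegrableOn.continuousOn_smul isOpen_Ioi.isLocallyClosed
      ((hκ.locallyIntegrable (by norm_num)).locallyIntegrableOn _) Real.continuous_exp.continuousOn
  have key : ∀ G : ℝ → ℂ, ContDiff ℝ ∞ G → HasCompactSupport G → tsupport G ⊆ Ioi 0 →
      (z.re < 0 ∨ b - 5 < z.re ∨ ∫ ξ, G ξ *
      (Real.exp (-2 * ξ) * xpowDeriv₂ ((z + 1) / 2) ((b - 2 - z) / 2) ξ) = 0) →
      ∫ ξ, G ξ * Real.exp ξ • κ ξ = 0 := fun G h1 h2 h3 h4 => by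
    obtain ⟨u, hu⟩ := exists_shift_eq_of_contDiff hz h1 h2 h3 h4
    have e : ∫ ξ, κ ξ * UnboundedSpectrum.shift (L b) z u ξ = -4 * ∫ ξ, G ξ * Real.exp ξ • κ ξ := by
      rw [← integral_const_mul]
      refine integral_congr_ae ?_
      filter_upwards [hu] with ξ hξ
      rw [hξ, Complex.real_smul]; ring
    rw [h u] at e
    exact (mul_eq_zero.1 e.symm).resolve_left (by norm_num)
  by_cases hc : z.re < 0 ∨ b - 5 < z.re
  · obtain ⟨C, hC⟩ := exists_ae_eq_const_mul (σ := 0) hli (locallyIntegrableOn_zero) fun G h1 h2 h3 _ =>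
      key G h1 h2 h3 (hc.elim Or.inl fun h => Or.inr (Or.inl h))
    filter_upwards [hC] with ξ h h0
    have := h h0
    simpa [Real.exp_ne_zero] using this
  · push Not at hc
    have hcσ : ContinuousOn (fun ξ : ℝ => (Real.exp (-2 * ξ) : ℂ) *
        xpowDeriv₂ ((z + 1) / 2) ((b - 2 - z) / 2) ξ) (Ioi 0) :=
      (Continuous.continuousOn (by fun_prop)).mul (continuousOn_xpowDeriv₂ _ _)
    obtain ⟨C, hC⟩ := exists_ae_eq_const_mul hli (hcσ.locallyIntegrableOn measurableSet_Ioi)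
      fun G h1 h2 h3 h4 => key G h1 h2 h3 (Or.inr (Or.inr h4))
    have hC' : ∀ᵐ ξ, ξ ∈ Ioi (0 : ℝ) → κ ξ = C * annihilator b z ξ := by
      filter_upwards [hC] with ξ h h0
      have := h h0
      rw [Complex.real_smul] at this
      refine mul_left_cancel₀ (ofReal_exp_ne_zero ξ) ?_
      rw [this, annihilator, show -2 * ξ = ξ + -3 * ξ by ring, Real.exp_add]
      push_cast; ring
    have hC0 : C = 0 := by
      by_contra hne
      refine not_memLp_annihilator (b := b) (z := z) ?_ (((hκ.restrict (Ioi (0 : ℝ))).const_mul C⁻¹).ae_eq ?_)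
      · by_contra! hn
        exact hz' ⟨lt_of_le_of_ne hc.1 (Ne.symm hn.1), lt_of_le_of_ne hc.2 hn.2⟩
      · rw [EventuallyEq, ae_restrict_iff' measurableSet_Ioi]
        filter_upwards [hC'] with ξ h h0
        rw [h h0, inv_mul_cancel_left₀ hne]
    filter_upwards [hC'] with ξ h h0
    rw [h h0, hC0, zero_mul]

/-- The reflection of a functional that annihilates the range of `L - z` annihilates that of
`L + z`. -/
theorem integral_mul_shift_neg_eq_zero {b : ℝ} {z : ℂ} {κ : ℝ → ℂ}
    (h : ∀ u : (L b).domain, ∫ ξ, κ ξ * UnboundedSpectrum.shift (L b) z u ξ = 0)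
    (u : (L b).domain) : ∫ ξ, κ (-ξ) * UnboundedSpectrum.shift (L b) (-z) u ξ = 0 := by
  have hs := (isSol_shift b (-z) u).comp_neg
  rw [neg_neg] at hs
  obtain ⟨w, -, hw⟩ := hs.exists_shift_eq
  have := h w
  rw [← integral_neg_eq_self, ← neg_eq_zero, ← integral_neg, ← this]
  refine integral_congr_ae ?_
  filter_upwards [hw] with ξ hξ
  rw [hξ, neg_neg]; ring

open ComplexConjugate in
/-- A vector orthogonal to the range vanishes on both half-lines. -/
theorem denseRange_shift {b : ℝ} {z : ℂ} (hz : z ^ 2 ≠ -((b - 2) * (b - 4) : ℝ))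
    (hz' : ¬ (0 < |z.re| ∧ |z.re| < b - 5)) : DenseRange (UnboundedSpectrum.shift (L b) z) := by
  change Dense (range (UnboundedSpectrum.shift (L b) z))
  rw [← LinearMap.coe_range]
  rw [Submodule.dense_iff_topologicalClosure_eq_top, Submodule.topologicalClosure_eq_top_iff,
    Submodule.eq_bot_iff]
  intro w hw
  have hκ := memLp_conj (Lp.memLp w)
  have h : ∀ u : (L b).domain,
      ∫ ξ, conj ((w : ℝ → ℂ) ξ) * UnboundedSpectrum.shift (L b) z u ξ = 0 := fun u => by
    have := (Submodule.mem_orthogonal' _ _).1 hw _ (LinearMap.mem_range_self _ u)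
    rw [L2.inner_def] at this
    rw [← this]
    congr 1; funext ξ
    rw [RCLike.inner_apply, mul_comm]
  have h1 := ae_eq_zero_of_integral_mul_shift_eq_zero hκ hz (fun hn => hz' (by
    rwa [abs_of_pos hn.1])) h
  have h2 := ae_eq_zero_of_integral_mul_shift_eq_zero (z := -z) (memLp_comp_neg hκ)
    (by rwa [neg_sq]) (fun hn => hz' (by
      rw [Complex.neg_re] at hn
      rwa [abs_of_neg (by linarith)])) (integral_mul_shift_neg_eq_zero h)
  have h3 := (Measure.measurePreserving_neg (volume : Measure ℝ)).quasiMeasurePreserving.ae h2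
  refine Lp.ext (EventuallyEq.trans ?_ (Lp.coeFn_zero ℂ 2 volume).symm)
  filter_upwards [h1, h3, Measure.ae_ne volume (0 : ℝ)] with ξ k1 k2 k3
  rcases lt_or_gt_of_ne k3 with h | h
  · have := k2 (by simpa using h)
    simpa using this
  · simpa using k1 h

/-! ### A functional annihilating the range -/

theorem tendsto_nhdsGT_zero {E : Type*} [TopologicalSpace E] {f : ℝ → E} (hf : Continuous f) :
    Tendsto f (𝓝[>] 0) (𝓝 (f 0)) :=
  (hf.tendsto 0).mono_left nhdsWithin_le_nhds

theorem memLp_annihilator {b : ℝ} {z : ℂ} (hz : 0 < z.re) (hz' : z.re < b - 5) :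
    MemLp (annihilator b z) 2 (volume.restrict (Ioi (0 : ℝ))) := by
  set m : ℝ → ℂ := fun ξ => (z + 1) / 2 * ((z + 1) / 2 - 1) -
    2 * ((z + 1) / 2) * ((b - 1) / 2 - 1) * Real.exp (-2 * ξ) +
      (b - 1) / 2 * ((b - 1) / 2 - 1) * Real.exp (-2 * ξ) ^ 2 with hm
  have e : annihilator b z = fun ξ => xpow (z / 2) ((b - 6 - z) / 2) ξ * m ξ :=
    funext fun ξ => annihilator_eq b z ξ
  have m1 : m =O[atTop] fun _ => (1 : ℝ) := by
    have lE := tendsto_exp_neg_mul_atTop (a := -2) (by norm_num)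
    exact (((lE.const_mul (2 * ((z + 1) / 2) * (((b : ℂ) - 1) / 2 - 1))).const_sub
        ((z + 1) / 2 * ((z + 1) / 2 - 1))).add
        ((lE.pow 2).const_mul (((b : ℂ) - 1) / 2 * (((b : ℂ) - 1) / 2 - 1)))).isBigO_one ℝ
  have m0 : m =O[𝓝[>] 0] fun _ => (1 : ℝ) :=
    (tendsto_nhdsGT_zero (by fun_prop : Continuous m)).isBigO_one ℝ
  have o1 := (xpow_isBigO_atTop (z / 2) ((b - 6 - z) / 2) (a := -z.re) (by
    rw [Complex.div_ofNat_re]; linarith)).mul m1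
  have o0 := (xpow_isBigO_zero (z / 2) ((b - 6 - z) / 2) (r := (b - 6 - z.re) / 2) (by
    rw [Complex.div_ofNat_re]; simp)).mul m0
  simp only [mul_one] at o1 o0
  rw [← e] at o1 o0
  have hc := continuousOn_annihilator b z
  obtain ⟨C₁, h1⟩ := exists_norm_le_of_isBigO_atTop hc o1
  obtain ⟨C₂, h2⟩ := exists_norm_le_of_isBigO_zero hc o0
  exact memLp_of_norm_le (C := max C₁ C₂) hc (neg_lt_zero.2 hz)
    (r := (b - 6 - z.re) / 2) (by linarith)
    (fun ξ hξ => (h1 ξ hξ).trans (by gcongr; exact le_max_left _ _))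
    (fun ξ hξ => (h2 ξ hξ).trans (by have := hξ.1; gcongr; exact le_max_right _ _))

/-- With `ρ = x^p (1 - x)^q` and derivatives in `x`, one has
`(x (1 - x) ρ'')' = (p - 1 - (p + q - 2) x) ρ'' - 2 (p + q - 1) ρ'`. For `p = (z + 1) / 2` and
`p + q = (b - 1) / 2` this says that `ρ''` is in the kernel of the transpose of the operator
`u ↦ x (1 - x) u' + ((z - 1) / 2 + (5 - b) / 2 x) u + (b - 3) ∫₀ˣ u`. -/
theorem hasDerivAt_mul_xpowDeriv₂ (p q : ℂ) {ξ : ℝ} (hξ : 0 < ξ) :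
    HasDerivAt (fun ξ => Real.exp (-2 * ξ) * (1 - Real.exp (-2 * ξ)) * xpowDeriv₂ p q ξ)
      (-2 * Real.exp (-2 * ξ) * ((p - 1 - (p + q - 2) * Real.exp (-2 * ξ)) * xpowDeriv₂ p q ξ -
        2 * (p + q - 1) * xpowDeriv p q ξ)) ξ := by
  have e : ∀ ξ, 0 < ξ → Real.exp (-2 * ξ) * (1 - Real.exp (-2 * ξ)) * xpowDeriv₂ p q ξ =
      (p - 1 - (p + q - 2) * Real.exp (-2 * ξ)) * xpowDeriv p q ξ - (p + q) * xpow p q ξ :=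
    fun ξ hξ => by
      rw [xpowDeriv, xpowDeriv₂, xpow_sub_one p q hξ, xpow_sub_one (p - 1) (q - 1) hξ, sub_sub p,
        sub_sub q, one_add_one_eq_two]
      ring_nf
  refine HasDerivAt.congr_of_eventuallyEq (f := fun ξ =>
    (p - 1 - (p + q - 2) * Real.exp (-2 * ξ)) * xpowDeriv p q ξ - (p + q) * xpow p q ξ) ?_ (by
      filter_upwards [Ioi_mem_nhds hξ] with η hη using e η hη)
  refine (((((hasDerivAt_ofReal_exp ξ).const_mul (p + q - 2)).const_sub (p - 1)).mul
    (hasDerivAt_xpowDeriv p q hξ)).sub ((hasDerivAt_xpow' p q hξ).const_mul (p + q))).congr_deriv ?_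
  ring

theorem tendsto_xpow_atTop {p : ℂ} (q : ℂ) (hp : 0 < p.re) :
    Tendsto (xpow p q) atTop (𝓝 0) := by
  refine (xpow_isBigO_atTop p q le_rfl).trans_tendsto ?_
  exact Real.tendsto_exp_atBot.comp ((tendsto_id (α := ℝ)).const_mul_atTop_of_neg (by linarith))

theorem tendsto_xpow_zero (p : ℂ) {q : ℂ} (hq : 0 < q.re) :
    Tendsto (xpow p q) (𝓝[>] 0) (𝓝 0) := by
  refine (xpow_isBigO_zero p q le_rfl).trans_tendsto ?_
  have := (Real.continuousAt_rpow_const 0 q.re (Or.inr hq.le)).tendsto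
  rw [Real.zero_rpow hq.ne'] at this
  exact this.mono_left nhdsWithin_le_nhds

theorem tendsto_mul_of_isBigO_one {l : Filter ℝ} {f g : ℝ → ℂ} (hf : Tendsto f l (𝓝 0))
    (hg : g =O[l] fun _ => (1 : ℝ)) : Tendsto (fun ξ => f ξ * g ξ) l (𝓝 0) := by
  have := ((isLittleO_one_iff ℝ).2 hf).mul_isBigO hg
  rw [mul_one] at this
  exact (isLittleO_one_iff ℝ).1 this

/-- Integration of the half-line equation against `ρ''`. The boundary term is `V S + R`, where
`S = x (1 - x) x^{1/2} ρ'' / 2` comes from the transport term and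
`R = (b - 3) (ρ' W - A (x ρ' - ρ))` from the nonlocal ones; it vanishes at both ends because
`(1 - φ²) |V|²` does and `0 < Re z < b - 5`. -/
theorem IsSol.integral_annihilator_eq_zero {b : ℝ} {z : ℂ} {v f : ℝ → ℂ} (h : IsSol b z v f)
    (hz : 0 < z.re) (hz' : z.re < b - 5) :
    ∫ ξ in Ioi (0 : ℝ), annihilator b z ξ * f ξ = 0 := by
  obtain ⟨V, hV, hVm, hVi, hVe⟩ := h.exists_halfLine
  have hli := locallyIntegrableOn_div_weight h.memLp_rhs
  have hVc : ContinuousOn V (Ioi 0) := continuousOn_of_eq_integral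
    (g := fun η => (1 - Real.exp (-2 * η))⁻¹ • weightedDerivRHS b z v f η) hli hVi
  obtain ⟨k1, k2, -⟩ := energy_tendsto hVm h.memLp_rhs hVi
  have hW : ∀ ξ, 0 < ξ → HasDerivAt (tail v) (-(Real.exp (-3 * ξ) • V ξ)) ξ :=
    fun ξ hξ => hasDerivAt_tail h.memLp hV hVc hξ
  have hWc : ContinuousOn (tail v) (Ioi 0) := fun ξ hξ => (hW ξ hξ).continuousAt.continuousWithinAt
  set A := tail (fun η => v (-η)) 0 with hA
  set W := tail v with hWdef
  set p := (z + 1) / 2 with hp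
  set q := (b - 2 - z) / 2 with hq
  have pre : 1 / 2 < p.re := by
    rw [hp, Complex.div_ofNat_re, Complex.add_re, Complex.one_re]; linarith
  have qre : 3 / 2 < q.re := by
    rw [hq, Complex.div_ofNat_re]; simp; linarith
  set S : ℝ → ℂ := fun ξ => Real.exp (-ξ) / 2 *
    (Real.exp (-2 * ξ) * (1 - Real.exp (-2 * ξ)) * xpowDeriv₂ p q ξ) with hS
  have hS' : ∀ ξ, S ξ = (1 - Real.exp (-2 * ξ)) * annihilator b z ξ / 2 := fun ξ => by
    rw [hS, annihilator, show -3 * ξ = -ξ + -2 * ξ by ring, Real.exp_add]; push_cast; ring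
  set S' : ℝ → ℂ := fun ξ => -Real.exp (-ξ) / 2 *
    (Real.exp (-2 * ξ) * (1 - Real.exp (-2 * ξ)) * xpowDeriv₂ p q ξ) + Real.exp (-ξ) / 2 *
    (-2 * Real.exp (-2 * ξ) * ((p - 1 - (p + q - 2) * Real.exp (-2 * ξ)) * xpowDeriv₂ p q ξ -
        2 * (p + q - 1) * xpowDeriv p q ξ)) with hS'def
  have dS : ∀ ξ, 0 < ξ → HasDerivAt S (S' ξ) ξ := fun ξ hξ => by
    refine ((((hasDerivAt_neg ξ).exp.ofReal_comp).div_const 2).mul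
      (hasDerivAt_mul_xpowDeriv₂ p q hξ)).congr_deriv ?_
    rw [hS'def]; push_cast; ring
  have cd2 := continuousOn_xpowDeriv₂ p q
  have cd1 : ContinuousOn (xpowDeriv p q) (Ioi 0) := fun ξ hξ =>
    (hasDerivAt_xpowDeriv p q hξ).continuousAt.continuousWithinAt
  have cS' : ContinuousOn S' (Ioi 0) := by
    rw [hS'def]
    refine ContinuousOn.add (ContinuousOn.mul ?_ (ContinuousOn.mul ?_ cd2)) (ContinuousOn.mul ?_
      (ContinuousOn.mul ?_ (ContinuousOn.sub (ContinuousOn.mul ?_ cd2) (ContinuousOn.mul ?_ cd1))))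
    all_goals exact Continuous.continuousOn (by fun_prop)
  set R : ℝ → ℂ := fun ξ => (b - 3) * (xpowDeriv p q ξ * W ξ) -
    (b - 3) * A * (Real.exp (-2 * ξ) * xpowDeriv p q ξ - xpow p q ξ) with hR
  set R' : ℝ → ℂ := fun ξ => (b - 3) * (-2 * Real.exp (-2 * ξ) * xpowDeriv₂ p q ξ * W ξ -
    xpowDeriv p q ξ * (Real.exp (-3 * ξ) * V ξ)) +
    (b - 3) * A * (2 * Real.exp (-2 * ξ) ^ 2 * xpowDeriv₂ p q ξ) with hR'
  have dR : ∀ ξ, 0 < ξ → HasDerivAt R (R' ξ) ξ := fun ξ hξ => by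
    refine ((((hasDerivAt_xpowDeriv p q hξ).mul (hW ξ hξ)).const_mul ((b : ℂ) - 3)).sub
      (((((hasDerivAt_ofReal_exp ξ).mul (hasDerivAt_xpowDeriv p q hξ)).sub
        (hasDerivAt_xpow' p q hξ))).const_mul (((b : ℂ) - 3) * A))).congr_deriv ?_
    rw [hR', Complex.real_smul]; ring
  have cR' : ContinuousOn R' (Ioi 0) := by
    rw [hR']
    refine ContinuousOn.add (ContinuousOn.mul ?_ (ContinuousOn.sub (ContinuousOn.mul
      (ContinuousOn.mul ?_ cd2) hWc) (ContinuousOn.mul cd1 (ContinuousOn.mul ?_ hVc))))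
      (ContinuousOn.mul ?_ (ContinuousOn.mul ?_ cd2))
    all_goals exact Continuous.continuousOn (by fun_prop)
  have hsub : ∀ {s t : ℝ}, 0 < s → s ≤ t → uIcc s t ⊆ Ioi 0 := fun hs hst x hx => by
    rw [uIcc_of_le hst] at hx; exact hs.trans_le hx.1
  -- `V` is only absolutely continuous, as `f` is merely square-integrable
  have hB : ∀ s t, 0 < s → s ≤ t → (V t * S t + R t) - (V s * S s + R s) =
      ∫ η in s..t, annihilator b z η * f η / 2 := fun s t hs hst => by
    have iV := intervalIntegrable_of_locallyIntegrableOn_Ioi hli hs (hs.trans_le hst)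
    have iS : IntervalIntegrable S' volume s t := (cS'.mono (hsub hs hst)).intervalIntegrable
    have iR : IntervalIntegrable R' volume s t := (cR'.mono (hsub hs hst)).intervalIntegrable
    have p1 := mul_sub_mul_eq_integral hst iV iS (F := V) (G := S)
      (fun x hx => by rw [← hVi s x hs (hs.trans_le hx.1)]; ring)
      (fun x hx => by
        rw [intervalIntegral.integral_eq_sub_of_hasDerivAt
          (fun y hy => dS y (hsub hs hx.1 hy)) (cS'.mono (hsub hs hx.1)).intervalIntegrable]
        ring)
    have p2 := intervalIntegral.integral_eq_sub_of_hasDerivAt (fun y hy => dR y (hsub hs hst hy)) iR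
    have cS : ContinuousOn S (Ioi 0) := fun ξ hξ => (dS ξ hξ).continuousAt.continuousWithinAt
    have i3 := (iV.mul_continuousOn (cS.mono (hsub hs hst))).add
      ((iS.continuousOn_mul (hVc.mono (hsub hs hst))))
    calc V t * S t + R t - (V s * S s + R s) = (V t * S t - V s * S s) + (R t - R s) := by ring
      _ = _ := by
        rw [p1, ← p2, ← intervalIntegral.integral_add i3 iR]
        refine intervalIntegral.integral_congr_ae ?_
        filter_upwards [hVe] with η hη hmem
        rw [uIoc_of_le hst] at hmem
        have h0 : 0 < η := hs.trans hmem.1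
        have n1 := one_sub_ofReal_exp_ne_zero h0
        have n2 := ofReal_exp_ne_zero (-η)
        have a1 : (Real.exp η : ℂ) = (Real.exp (-η) : ℂ)⁻¹ := by
          rw [Real.exp_neg]; push_cast; rw [inv_inv]
        have a2 : (Real.exp (-2 * η) : ℂ) = (Real.exp (-η) : ℂ) ^ 2 := by
          rw [← Complex.ofReal_pow, ← Real.exp_nat_mul]; congr 2; push_cast; ring
        have a3 : (Real.exp (-3 * η) : ℂ) = (Real.exp (-η) : ℂ) ^ 3 := by
          rw [← Complex.ofReal_pow, ← Real.exp_nat_mul]; congr 2; push_cast; ring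
        have hpq : p + q = (b - 1) / 2 := by rw [hp, hq]; ring
        have hp1 : z = 2 * p - 1 := by rw [hp]; ring
        simp only [hη h0, hS, hS'def, hR', annihilator, Complex.real_smul, Complex.ofReal_inv,
          Complex.ofReal_sub, Complex.ofReal_one, ← hp, ← hq, hpq]
        rw [a2] at n1
        rw [a1, a2, a3, hp1]
        generalize xpowDeriv p q η = ρ₁
        generalize xpowDeriv₂ p q η = ρ₂
        generalize (Real.exp (-η) : ℂ) = y at *
        field_simp
        ring
  have hsV : ∀ ξ, 0 < ξ → ‖xpow 0 (1 / 2) ξ * V ξ‖ =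
      √((1 - Real.exp (-2 * ξ)) * ‖V ξ‖ ^ 2) := fun ξ hξ => by
    rw [norm_mul, norm_xpow 0 (1 / 2) hξ, Real.sqrt_mul (one_sub_exp_pos hξ).le,
      Real.sqrt_sq (norm_nonneg _), Real.sqrt_eq_rpow]
    simp
  have lV0 : Tendsto (fun ξ => xpow 0 (1 / 2) ξ * V ξ) (𝓝[>] 0) (𝓝 0) := by
    have := k1.sqrt
    rw [Real.sqrt_zero] at this
    refine tendsto_zero_iff_norm_tendsto_zero.2 (this.congr' ?_)
    filter_upwards [self_mem_nhdsWithin] with ξ hξ using (hsV ξ hξ).symm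
  have lVi : Tendsto (fun ξ => xpow 0 (1 / 2) ξ * V ξ) atTop (𝓝 0) := by
    have := k2.sqrt
    rw [Real.sqrt_zero] at this
    refine tendsto_zero_iff_norm_tendsto_zero.2 (this.congr' ?_)
    filter_upwards [eventually_gt_atTop 0] with ξ hξ using (hsV ξ hξ).symm
  set m : ℝ → ℂ := fun ξ => (p * (p - 1) - 2 * p * (p + q - 1) * Real.exp (-2 * ξ) +
    (p + q) * (p + q - 1) * Real.exp (-2 * ξ) ^ 2) / 2 with hm
  have hSV : ∀ ξ, 0 < ξ → V ξ * S ξ =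
      xpow 0 (1 / 2) ξ * V ξ * (xpow (z / 2) ((b - 5 - z) / 2) ξ * m ξ) := fun ξ hξ => by
    have e : xpow (1 / 2) 0 ξ * (xpow 1 0 ξ * xpow 0 1 ξ) * xpow (p - 2) (q - 2) ξ =
        xpow 0 (1 / 2) ξ * xpow (z / 2) ((b - 5 - z) / 2) ξ := by
      rw [xpow_mul, xpow_mul, xpow_mul, xpow_mul, hp, hq]
      congr 1 <;> ring
    have e0 : (Real.exp (-ξ) : ℂ) = xpow (1 / 2) 0 ξ := by
      rw [xpow, zero_mul, Complex.exp_zero, mul_one, Complex.ofReal_exp]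
      congr 1; push_cast; ring
    rw [xpow_zero_one hξ, xpow_one_zero] at e
    simp only [hS, hm, xpowDeriv₂]
    rw [e0]
    linear_combination V ξ * (p * (p - 1) - 2 * p * (p + q - 1) * Real.exp (-2 * ξ) +
      (p + q) * (p + q - 1) * Real.exp (-2 * ξ) ^ 2) / 2 * e
  have lE := tendsto_exp_neg_mul_atTop (a := -2) (by norm_num)
  have mi : m =O[atTop] fun _ => (1 : ℝ) :=
    ((((lE.const_mul (2 * p * (p + q - 1))).const_sub (p * (p - 1))).add
      ((lE.pow 2).const_mul ((p + q) * (p + q - 1)))).div_const 2).isBigO_one ℝ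
  have m0 : m =O[𝓝[>] 0] fun _ => (1 : ℝ) :=
    (tendsto_nhdsGT_zero (by fun_prop : Continuous m)).isBigO_one ℝ
  have Wb : ∀ ξ, 0 < ξ → ‖W ξ‖ ≤ Real.exp (-2 * ξ) * ∫ η, ‖phi η • v η‖ := fun ξ hξ =>
    norm_tail_le h.memLp hξ.le
  have I0 : 0 ≤ ∫ η, ‖phi η • v η‖ := integral_nonneg fun _ => norm_nonneg _
  have n0 : (fun ξ : ℝ => p - (p + q) * Real.exp (-2 * ξ)) =O[𝓝[>] 0] fun _ => (1 : ℝ) :=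
    (tendsto_nhdsGT_zero (by fun_prop :
      Continuous fun ξ : ℝ => p - (p + q) * (Real.exp (-2 * ξ) : ℂ))).isBigO_one ℝ
  have ni : (fun ξ : ℝ => p - (p + q) * Real.exp (-2 * ξ)) =O[atTop] fun _ => (1 : ℝ) :=
    ((lE.const_mul (p + q)).const_sub p).isBigO_one ℝ
  have lρ0 : Tendsto (xpowDeriv p q) (𝓝[>] 0) (𝓝 0) :=
    tendsto_mul_of_isBigO_one (tendsto_xpow_zero (p - 1) (q := q - 1)
      (by rw [Complex.sub_re, Complex.one_re]; linarith)) n0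
  have lρi : Tendsto (fun ξ : ℝ => (Real.exp (-2 * ξ) : ℂ) * xpowDeriv p q ξ) atTop (𝓝 0) := by
    refine (tendsto_mul_of_isBigO_one (tendsto_xpow_atTop (p := p) (q - 1) (by linarith)) ni).congr
      fun ξ => ?_
    rw [xpowDeriv, ← mul_assoc, ← xpow_one_zero, xpow_mul]
    congr 2 <;> ring
  have lB0 : Tendsto (fun ξ => V ξ * S ξ + R ξ) (𝓝[>] 0) (𝓝 0) := by
    have l1 := lV0.mul (tendsto_mul_of_isBigO_one (tendsto_xpow_zero (z / 2)
      (q := (b - 5 - z) / 2) (by rw [Complex.div_ofNat_re]; simp; linarith)) m0)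
    have W0 : W =O[𝓝[>] 0] fun _ => (1 : ℝ) := IsBigO.of_bound (∫ η, ‖phi η • v η‖) (by
      filter_upwards [self_mem_nhdsWithin] with ξ hξ
      have hξ' : 0 < ξ := hξ
      rw [norm_one, mul_one]
      refine (Wb ξ hξ).trans (mul_le_of_le_one_left I0 ?_)
      rw [Real.exp_le_one_iff]; linarith)
    have lE0 : Tendsto (fun ξ : ℝ => (Real.exp (-2 * ξ) : ℂ)) (𝓝[>] 0) (𝓝 1) := by
      simpa using tendsto_nhdsGT_zero (by fun_prop : Continuous fun ξ : ℝ => (Real.exp (-2 * ξ) : ℂ))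
    have l2 := l1.add (((tendsto_mul_of_isBigO_one lρ0 W0).const_mul ((b : ℂ) - 3)).sub
      (((lE0.mul lρ0).sub (tendsto_xpow_zero p (q := q) (by linarith))).const_mul
        (((b : ℂ) - 3) * A)))
    refine (l2.congr' ?_).trans_eq (by simp)
    filter_upwards [self_mem_nhdsWithin] with ξ hξ
    rw [hSV ξ hξ]
  have lBi : Tendsto (fun ξ => V ξ * S ξ + R ξ) atTop (𝓝 0) := by
    have l1 := lVi.mul (tendsto_mul_of_isBigO_one (tendsto_xpow_atTop (p := z / 2)
      ((b - 5 - z) / 2) (by rw [Complex.div_ofNat_re]; linarith)) mi)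
    have Wi : (fun ξ : ℝ => (Real.exp (-2 * ξ) : ℂ)⁻¹ * W ξ) =O[atTop] fun _ => (1 : ℝ) :=
      IsBigO.of_bound (∫ η, ‖phi η • v η‖) (by
        filter_upwards [eventually_gt_atTop 0] with ξ hξ
        rw [norm_one, mul_one, norm_mul, norm_inv, Complex.norm_real,
          Real.norm_of_nonneg (Real.exp_pos _).le, inv_mul_le_iff₀ (Real.exp_pos _)]
        exact Wb ξ hξ)
    have l2 := l1.add (((tendsto_mul_of_isBigO_one lρi Wi).const_mul ((b : ℂ) - 3)).sub
      ((lρi.sub (tendsto_xpow_atTop (p := p) q (by linarith))).const_mul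
        (((b : ℂ) - 3) * A)))
    refine (l2.congr' ?_).trans_eq (by simp)
    filter_upwards [eventually_gt_atTop 0] with ξ hξ
    have := ofReal_exp_ne_zero (-2 * ξ)
    rw [hSV ξ hξ, hR]
    field_simp
  obtain ⟨l₀, l₁, t0, t1, hl⟩ := exists_tendsto_of_sub_eq_integral
    (Y := fun ξ => V ξ * S ξ + R ξ) (n := fun ξ => annihilator b z ξ * f ξ / 2)
    (((memLp_annihilator hz hz').integrable_mul (h.memLp_source.restrict (Ioi (0 : ℝ)))).div_const 2)
    hB
  rw [tendsto_nhds_unique t0 lB0, tendsto_nhds_unique t1 lBi, sub_zero, integral_div] at hl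
  simpa using hl.symm

theorem glue_annihilator_ne_zero {b : ℝ} {z : ℂ} (hz' : z.re < b - 5) :
    ¬ glue (annihilator b z) 0 =ᵐ[volume] 0 := by
  intro h0
  have h1 : ∀ ξ, 0 < ξ → annihilator b z ξ = 0 := fun ξ hξ =>
    (eq_zero_of_glue_ae_eq_zero (continuousOn_annihilator b z) continuousOn_const h0 hξ).1
  have hc : Continuous fun ξ : ℝ => (z + 1) / 2 * ((z + 1) / 2 - 1) -
      2 * ((z + 1) / 2) * ((b - 1) / 2 - 1) * (Real.exp (-2 * ξ) : ℂ) +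
        (b - 1) / 2 * ((b - 1) / 2 - 1) * (Real.exp (-2 * ξ) : ℂ) ^ 2 := by fun_prop
  have h2 := tendsto_nhds_unique (tendsto_nhdsGT_zero hc) (tendsto_const_nhds.congr' (by
    filter_upwards [self_mem_nhdsWithin] with ξ hξ
    have := h1 ξ hξ
    rw [annihilator_eq] at this
    exact ((mul_eq_zero.1 this).resolve_left (xpow_ne_zero _ _ _)).symm))
  rw [mul_zero, Real.exp_zero, Complex.ofReal_one] at h2
  -- the value of the polynomial factor at `x = 1` is a multiple of this product
  have h3 : (b - 2 - z) * (b - 4 - z) = 0 := by linear_combination 4 * h2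
  rcases mul_eq_zero.1 h3 with h | h
  · have := congrArg Complex.re h
    simp at this
    linarith
  · have := congrArg Complex.re h
    simp at this
    linarith

/-- In the strip `0 < |Re z| < b - 5` the range of `L - z` is annihilated by a nonzero functional,
supported on a half-line. -/
theorem not_denseRange_shift {b : ℝ} {z : ℂ} (hz : 0 < |z.re|) (hz' : |z.re| < b - 5) :
    ¬ DenseRange (UnboundedSpectrum.shift (L b) z) := by
  have pos : ∀ {z : ℂ}, 0 < z.re → z.re < b - 5 → ∃ κ : ℝ → ℂ, MemLp κ 2 (volume : Measure ℝ) ∧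
      ¬ κ =ᵐ[volume] 0 ∧
      ∀ u : (L b).domain, ∫ ξ, κ ξ * UnboundedSpectrum.shift (L b) z u ξ = 0 := by
    intro z hz hz'
    refine ⟨glue (annihilator b z) 0, memLp_glue (memLp_annihilator hz hz') MemLp.zero',
      glue_annihilator_ne_zero hz', fun u => ?_⟩
    rw [← (isSol_shift b z u).integral_annihilator_eq_zero hz hz',
      ← integral_indicator measurableSet_Ioi]
    congr 1
    funext ξ
    by_cases h : 0 < ξ
    · simp [glue, h]
    · simp [glue, h]
  obtain ⟨κ, hκ, hne, h⟩ : ∃ κ : ℝ → ℂ, MemLp κ 2 (volume : Measure ℝ) ∧ ¬ κ =ᵐ[volume] 0 ∧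
      ∀ u : (L b).domain, ∫ ξ, κ ξ * UnboundedSpectrum.shift (L b) z u ξ = 0 := by
    rcases lt_or_gt_of_ne (abs_pos.1 hz) with h0 | h0
    · rw [abs_of_neg h0] at hz'
      obtain ⟨κ, hκ, hne, h⟩ := pos (z := -z) (by simpa using h0) (by simpa using hz')
      refine ⟨fun ξ => κ (-ξ), memLp_comp_neg hκ, fun hn => hne ?_, fun u => ?_⟩
      · have := (Measure.measurePreserving_neg (volume : Measure ℝ)).quasiMeasurePreserving.ae hn
        filter_upwards [this] with ξ hξ
        simpa using hξ
      · have := integral_mul_shift_neg_eq_zero h u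
        rwa [neg_neg] at this
    · rw [abs_of_pos h0] at hz'
      exact pos h0 hz'
  intro hd
  have hp : (pairing κ hκ : H → ℂ) = fun _ => 0 :=
    hd.equalizer (pairing κ hκ).continuous continuous_const (funext fun u => by
      rw [Function.comp_apply, pairing_apply]; exact h u)
  have h0 : (memLp_conj hκ).toLp _ = (0 : H) := by
    rw [← inner_self_eq_zero (𝕜 := ℂ)]
    exact congrFun hp _
  refine hne ?_
  have h1 := (memLp_conj hκ).coeFn_toLp
  rw [h0] at h1
  filter_upwards [h1, Lp.coeFn_zero ℂ 2 (volume : Measure ℝ)] with ξ h2 h3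
  rw [h3] at h2
  simpa using h2.symm

/-! ### The boundary of the spectrum -/

/-- The range stays dense under small perturbations of a point of the resolvent set. -/
theorem denseRange_shift_of_norm_sub_mul_lt {b : ℝ} {z z' : ℂ} {C : ℝ}
    (hs : Function.Surjective (UnboundedSpectrum.shift (L b) z))
    (hC : ∀ v : (L b).domain, ‖(v : H)‖ ≤ C * ‖UnboundedSpectrum.shift (L b) z v‖)
    (hz : ‖z' - z‖ * C < 1) : DenseRange (UnboundedSpectrum.shift (L b) z') := by
  change Dense (range (UnboundedSpectrum.shift (L b) z'))
  rw [← LinearMap.coe_range, Submodule.dense_iff_topologicalClosure_eq_top,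
    Submodule.topologicalClosure_eq_top_iff, Submodule.eq_bot_iff]
  intro w hw
  obtain ⟨u, hu⟩ := hs w
  have h0 := (Submodule.mem_orthogonal' _ _).1 hw _ (LinearMap.mem_range_self _ u)
  have e : w = UnboundedSpectrum.shift (L b) z' u + (z' - z) • (u : H) := by
    rw [← hu, shift_L_eq, shift_L_eq, sub_smul]; abel
  have h1 : inner ℂ w w = (z' - z) * inner ℂ w (u : H) := by
    nth_rewrite 2 [e]
    rw [inner_add_right, h0, zero_add, inner_smul_right]
  have h2 : ‖w‖ * ‖w‖ ≤ ‖z' - z‖ * (‖w‖ * (C * ‖w‖)) := by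
    have := congrArg norm h1
    rw [inner_self_eq_norm_sq_to_K, norm_mul, norm_pow, RCLike.norm_ofReal, abs_norm] at this
    rw [← sq, this]
    refine mul_le_mul_of_nonneg_left ((norm_inner_le_norm _ _).trans ?_) (norm_nonneg _)
    refine mul_le_mul_of_nonneg_left ?_ (norm_nonneg _)
    have := hC u
    rwa [hu] at this
  by_contra hne
  have hp : 0 < ‖w‖ := norm_pos_iff.2 hne
  have : ‖z' - z‖ * C * (‖w‖ * ‖w‖) < 1 * (‖w‖ * ‖w‖) :=
    mul_lt_mul_of_pos_right hz (by positivity)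
  linarith

/-- Eigenvalues of `L b'` for `b'` near `b` are approximate eigenvalues of `L b`, since the
difference of the two operators is the bounded operator `(b' - b) (φ φ' - qCLM)`. -/
theorem norm_le_of_isSol {b b' : ℝ} {z z' : ℂ} {v : ℝ → ℂ} (h : IsSol b' z' v 0) :
    ∃ u : (L b).domain, (u : H) =ᵐ[volume] v ∧ ‖UnboundedSpectrum.shift (L b) z u‖ ≤
      (|b - b'| * (1 + ‖qCLM‖) + ‖z' - z‖) * ‖(u : H)‖ := by
  obtain ⟨u, hu, hu'⟩ := h.exists_shift_eq
  have h0 : UnboundedSpectrum.shift (L b') z' u = 0 :=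
    Lp.ext (hu'.trans (Lp.coeFn_zero ℂ 2 volume).symm)
  refine ⟨u, hu, ?_⟩
  have e : UnboundedSpectrum.shift (L b) z u = ((b' - b : ℝ) : ℂ) • mulPhiPhi' (u : H) +
      ((b - b' : ℝ) : ℂ) • qCLM (u : H) + (z' - z) • (u : H) := by
    have e1 : UnboundedSpectrum.shift (L b) z u = UnboundedSpectrum.shift (L b) z u -
      UnboundedSpectrum.shift (L b') z' u := by rw [h0, sub_zero]
    have q1 : ∀ b, Q b (u : H) = ((b - 3 : ℝ) : ℂ) • qCLM (u : H) := fun b => by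
      rw [qCLM_apply]; rfl
    rw [e1]
    change (weightedDeriv u + (((4 - b : ℝ) : ℂ) • mulPhiPhi' (u : H) + Q b (u : H)) - z • (u : H)) -
      (weightedDeriv u + (((4 - b' : ℝ) : ℂ) • mulPhiPhi' (u : H) + Q b' (u : H)) - z' • (u : H)) = _
    rw [q1, q1]
    push_cast
    module
  rw [e]
  refine (norm_add₃_le).trans ?_
  rw [norm_smul, norm_smul, norm_smul, Complex.norm_real, Complex.norm_real, Real.norm_eq_abs,
    Real.norm_eq_abs, abs_sub_comm b' b]
  have h1 := norm_mulPhiPhi'_le (u : H)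
  have h2 := qCLM.le_opNorm (u : H)
  have := abs_nonneg (b - b')
  calc _ ≤ |b - b'| * ‖(u : H)‖ + |b - b'| * (‖qCLM‖ * ‖(u : H)‖) + ‖z' - z‖ * ‖(u : H)‖ := by
        gcongr
    _ = _ := by ring

theorem mem_spectrum_of_eigenvalues {b : ℝ} {z : ℂ}
    (h : ∀ ε > 0, ∃ (b' : ℝ) (z' : ℂ), |b - b'| < ε ∧ ‖z' - z‖ < ε ∧
      z' ∈ UnboundedSpectrum.pointSpectrum (L b')) : z ∈ UnboundedSpectrum.spectrum (L b) := by
  rintro ⟨-, C, hC⟩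
  have hK : 0 < (|C| + 1) * (2 + ‖qCLM‖) := by positivity
  obtain ⟨b', z', h1, h2, h3⟩ := h ((|C| + 1) * (2 + ‖qCLM‖))⁻¹ (inv_pos.2 hK)
  obtain ⟨v, hv, hne⟩ := mem_pointSpectrum_iff_exists_isSol.1 h3
  obtain ⟨u, hu, hle⟩ := norm_le_of_isSol (b := b) (z := z) hv
  have hu0 : (u : H) ≠ 0 := fun h0 => hne (by
    rw [h0] at hu
    exact hu.symm.trans (Lp.coeFn_zero ℂ 2 volume))
  have hp : 0 < ‖(u : H)‖ := norm_pos_iff.2 hu0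
  have k1 := hC u
  have k2 : |b - b'| * (1 + ‖qCLM‖) + ‖z' - z‖ <
      ((|C| + 1) * (2 + ‖qCLM‖))⁻¹ * (2 + ‖qCLM‖) := by
    have := norm_nonneg qCLM
    nlinarith
  have k3 : ((|C| + 1) * (2 + ‖qCLM‖))⁻¹ * (2 + ‖qCLM‖) = (|C| + 1)⁻¹ := by
    have : (2 + ‖qCLM‖) ≠ 0 := by positivity
    field_simp
  rw [k3] at k2
  have k4 : ‖(u : H)‖ ≤ (|C| + 1) * ‖UnboundedSpectrum.shift (L b) z u‖ :=
    k1.trans (mul_le_mul_of_nonneg_right (by linarith [le_abs_self C]) (norm_nonneg _))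
  have k5 : (|C| + 1) * ‖UnboundedSpectrum.shift (L b) z u‖ <
      (|C| + 1) * ((|C| + 1)⁻¹ * ‖(u : H)‖) :=
    mul_lt_mul_of_pos_left (hle.trans_lt (mul_lt_mul_of_pos_right k2 hp)) (by positivity)
  rw [mul_inv_cancel_left₀ (by positivity)] at k5
  linarith

/-- Every real number of absolute value at most `a` is close to one of absolute value strictly
between `0` and `a`. -/
theorem exists_abs_sub_lt {x a ε : ℝ} (ha : 0 < a) (hx : |x| ≤ a) (hε : 0 < ε) :
    ∃ y, |y - x| < ε ∧ 0 < |y| ∧ |y| < a := by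
  obtain ⟨δ, d0, d1, d2⟩ : ∃ δ, 0 < δ ∧ δ < ε ∧ δ < a := by
    obtain ⟨δ, d0, d1⟩ := exists_between (lt_min hε ha)
    exact ⟨δ, d0, lt_min_iff.1 d1⟩
  rcases eq_or_ne x 0 with rfl | h0
  · exact ⟨δ, by rw [sub_zero, abs_of_pos d0]; linarith, by rwa [abs_of_pos d0],
      by rw [abs_of_pos d0]; linarith⟩
  · obtain ⟨t, t0, t1⟩ := exists_between
      (lt_min one_pos (div_pos hε (abs_pos.2 h0)))
    obtain ⟨t1, t2⟩ := lt_min_iff.1 t1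
    have hp := abs_pos.2 h0
    have e : |(1 - t) * x| = (1 - t) * |x| := by rw [abs_mul, abs_of_pos (by linarith)]
    refine ⟨(1 - t) * x, ?_, ?_, ?_⟩
    · rw [show (1 - t) * x - x = -(t * x) by ring, abs_neg, abs_mul, abs_of_pos t0]
      exact (lt_div_iff₀ hp).1 t2
    · rw [e]
      exact mul_pos (by linarith) hp
    · rw [e]
      nlinarith

/-- Points of the closed strip are limits of eigenvalues of `L b'` with `b' < b` if `b ≤ 5`, and of
points where the range is not dense if `b > 5`. -/
theorem mem_spectrum_of_abs_re_le {b : ℝ} {z : ℂ} (hz : |z.re| ≤ |5 - b|) :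
    z ∈ UnboundedSpectrum.spectrum (L b) := by
  rcases le_or_gt b 5 with hb | hb
  · refine mem_spectrum_of_eigenvalues fun ε hε => ?_
    rw [abs_of_nonneg (show 0 ≤ 5 - b by linarith)] at hz
    obtain ⟨y, h1, h2, h3⟩ := exists_abs_sub_lt (x := z.re) (a := 5 - (b - ε / 2))
      (by linarith) (by linarith) hε
    refine ⟨b - ε / 2, ⟨y, z.im⟩, ?_, ?_, mem_pointSpectrum_of_abs_re_lt h2 h3⟩
    · rw [sub_sub_cancel, abs_of_pos] <;> linarith
    · have : (⟨y, z.im⟩ : ℂ) - z = ((y - z.re : ℝ) : ℂ) := by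
        apply Complex.ext <;> simp
      rwa [this, Complex.norm_real]
  · rintro ⟨⟨-, hs⟩, C, hC⟩
    rw [abs_of_neg (show 5 - b < 0 by linarith), neg_sub] at hz
    obtain ⟨y, h1, h2, h3⟩ := exists_abs_sub_lt (by linarith) hz
      (show 0 < (|C| + 1)⁻¹ by positivity)
    refine not_denseRange_shift (b := b) (z := ⟨y, z.im⟩) h2 h3
      (denseRange_shift_of_norm_sub_mul_lt hs hC ?_)
    have : (⟨y, z.im⟩ : ℂ) - z = ((y - z.re : ℝ) : ℂ) := by
      apply Complex.ext <;> simp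
    rw [this, Complex.norm_real, Real.norm_eq_abs]
    have k : |y - z.re| * (|C| + 1) < 1 := by
      rwa [← one_div, lt_div_iff₀ (by positivity)] at h1
    nlinarith [le_abs_self C, abs_nonneg (y - z.re)]

/-! ### The parts of the spectrum -/

theorem re_im_of_sq_eq {b : ℝ} {z : ℂ} (h : z ^ 2 = -((b - 2) * (b - 4) : ℝ)) :
    z.re ^ 2 - z.im ^ 2 = 1 - (b - 3) ^ 2 ∧ z.re * z.im = 0 := by
  have h1 := congrArg Complex.re h
  have h2 := congrArg Complex.im h
  simp only [sq, Complex.mul_re, Complex.mul_im, Complex.neg_re, Complex.neg_im, Complex.ofReal_re,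
    Complex.ofReal_im] at h1 h2
  constructor <;> linarith

/-- The exceptional values `± √(-(b - 2)(b - 4))` are imaginary or lie inside the strip
`|Re z| < 5 - b`, since `(5 - b)² - (1 - (b - 3)²) = 2 (b - 4)² + 1`. -/
theorem re_eq_zero_or_abs_re_lt {b : ℝ} {z : ℂ} (h : z ^ 2 = -((b - 2) * (b - 4) : ℝ)) :
    z.re = 0 ∨ (0 < |z.re| ∧ |z.re| < 5 - b) := by
  obtain ⟨h1, h2⟩ := re_im_of_sq_eq h
  by_cases h0 : z.re = 0
  · exact Or.inl h0
  have him : z.im = 0 := (mul_eq_zero.1 h2).resolve_left h0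
  rw [him] at h1
  have hp : 0 < z.re ^ 2 := by positivity
  refine Or.inr ⟨abs_pos.2 h0, abs_lt_of_sq_lt_sq ?_ ?_⟩
  · nlinarith [sq_nonneg (b - 4)]
  · nlinarith

theorem mem_pointSpectrum_of_sq_eq_neg {b : ℝ} {z : ℂ} (h : z ^ 2 = -((b - 2) * (b - 4) : ℝ)) :
    z ∈ UnboundedSpectrum.pointSpectrum (L b) := by
  rcases re_eq_zero_or_abs_re_lt h with h0 | ⟨h1, h2⟩
  · refine mem_pointSpectrum_of_sq_eq (by rw [h]; push_cast; rfl) fun h1 => ?_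
    have := congrArg Complex.re h1
    simp [h0] at this
  · exact mem_pointSpectrum_of_abs_re_lt h1 h2

theorem mem_embeddedEigenvalues_iff {b : ℝ} {z : ℂ} :
    z ∈ embeddedEigenvalues b ↔ z.re = 0 ∧ z ^ 2 = -((b - 2) * (b - 4) : ℝ) := by
  constructor
  · rintro ⟨hb, hz⟩
    have hp : 0 ≤ (b - 2) * (b - 4) := by rcases hb with h | h <;> nlinarith
    have e : (Complex.I * (√((b - 2) * (b - 4)) : ℝ)) ^ 2 = -((b - 2) * (b - 4) : ℝ) := by
      rw [mul_pow, Complex.I_sq, ← Complex.ofReal_pow, Real.sq_sqrt hp, neg_one_mul]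
    rcases hz with rfl | rfl
    · exact ⟨by simp, e⟩
    · exact ⟨by simp, by rw [neg_sq, e]⟩
  · rintro ⟨h0, h⟩
    obtain ⟨h1, -⟩ := re_im_of_sq_eq h
    rw [h0] at h1
    have hp : z.im ^ 2 = (b - 2) * (b - 4) := by linarith
    refine ⟨?_, ?_⟩
    · by_contra! hb
      nlinarith [sq_nonneg z.im]
    · have hz : z = Complex.I * (z.im : ℝ) := by apply Complex.ext <;> simp [h0]
      rw [← hp, Real.sqrt_sq_eq_abs]
      rcases abs_choice z.im with h | h <;> rw [h]
      · exact Or.inl hz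
      · right
        rw [Complex.ofReal_neg, mul_neg, neg_neg]
        exact hz

theorem not_injective_shift {b : ℝ} {z : ℂ} (h : z ∈ UnboundedSpectrum.pointSpectrum (L b)) :
    ¬ Function.Injective (UnboundedSpectrum.shift (L b) z) := by
  obtain ⟨v, hv, he⟩ := h
  intro hi
  have h0 : UnboundedSpectrum.shift (L b) z v = 0 := sub_eq_zero.2 he
  have := hi (h0.trans (map_zero _).symm)
  exact hv (by rw [this]; rfl)

theorem injective_shift_iff {b : ℝ} {z : ℂ} :
    Function.Injective (UnboundedSpectrum.shift (L b) z) ↔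
      z ^ 2 ≠ -((b - 2) * (b - 4) : ℝ) ∧ ¬(0 < |z.re| ∧ |z.re| < 5 - b) :=
  ⟨fun h => ⟨fun h' => not_injective_shift (mem_pointSpectrum_of_sq_eq_neg h') h,
    fun h' => not_injective_shift (mem_pointSpectrum_of_abs_re_lt h'.1 h'.2) h⟩,
    fun h => injective_shift h.1 h.2⟩

theorem spectrum_L (b : ℝ) :
    UnboundedSpectrum.spectrum (L b) = {z : ℂ | |z.re| ≤ |5 - b|} := by
  refine Subset.antisymm (fun z hz => ?_) fun z hz => mem_spectrum_of_abs_re_le hz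
  by_contra h
  have h' : |5 - b| < |z.re| := not_le.1 h
  have n1 : ¬(0 < |z.re| ∧ |z.re| < 5 - b) := fun k => by linarith [k.2, le_abs_self (5 - b)]
  have n2 : ¬(0 < |z.re| ∧ |z.re| < b - 5) := fun k => by linarith [k.2, neg_abs_le (5 - b)]
  have n3 : z ^ 2 ≠ -((b - 2) * (b - 4) : ℝ) := fun k => by
    rcases re_eq_zero_or_abs_re_lt k with k | k
    · rw [k, abs_zero] at h'
      exact absurd h' (abs_nonneg _).not_gt
    · exact n1 k
  exact hz (mem_resolventSet_of_injective_of_denseRange h' (injective_shift n3 n1)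
    (denseRange_shift n3 n2))

theorem residualSpectrum_L (b : ℝ) :
    UnboundedSpectrum.residualSpectrum (L b) = {z : ℂ | 0 < |z.re| ∧ |z.re| < b - 5} := by
  ext z
  constructor
  · rintro ⟨hi, hd⟩
    by_contra h
    exact hd (denseRange_shift (injective_shift_iff.1 hi).1 h)
  · rintro ⟨h1, h2⟩
    have n1 : ¬(0 < |z.re| ∧ |z.re| < 5 - b) := fun k => by linarith [k.2]
    refine ⟨injective_shift (fun k => ?_) n1, not_denseRange_shift h1 h2⟩
    rcases re_eq_zero_or_abs_re_lt k with k | k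
    · exact absurd k (abs_pos.1 h1)
    · exact n1 k

theorem continuousSpectrum_L (b : ℝ) :
    UnboundedSpectrum.continuousSpectrum (L b) =
      {z : ℂ | z.re = 0 ∨ |z.re| = |5 - b|} \ embeddedEigenvalues b := by
  ext z
  constructor
  · rintro ⟨hs, hi, hd⟩
    rw [spectrum_L] at hs
    obtain ⟨n1, n2⟩ := injective_shift_iff.1 hi
    refine ⟨?_, fun h => n1 (mem_embeddedEigenvalues_iff.1 h).2⟩
    by_contra h
    obtain ⟨k1, k2⟩ := not_or.1 h
    have hp := abs_pos.2 k1
    have hlt : |z.re| < |5 - b| := lt_of_le_of_ne hs k2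
    rcases abs_choice (5 - b) with e | e <;> rw [e] at hlt
    · exact n2 ⟨hp, hlt⟩
    · exact not_denseRange_shift hp (by linarith) hd
  · rintro ⟨hz, hE⟩
    have n0 : ∀ c, |c| = |5 - b| → ¬(0 < |z.re| ∧ |z.re| < c) := fun c hc k => by
      have hc' : |z.re| < |5 - b| := hc ▸ k.2.trans_le (le_abs_self c)
      rcases hz with hz | hz
      · exact absurd hz (abs_pos.1 k.1)
      · exact hc'.ne hz
    have n1 := n0 _ rfl
    have n2 := n0 (b - 5) (abs_sub_comm _ _)
    have n3 : z ^ 2 ≠ -((b - 2) * (b - 4) : ℝ) := fun k => by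
      rcases re_eq_zero_or_abs_re_lt k with k' | k'
      · exact hE (mem_embeddedEigenvalues_iff.2 ⟨k', k⟩)
      · exact n1 k'
    refine ⟨mem_spectrum_of_abs_re_le ?_, injective_shift n3 n1, denseRange_shift n3 n2⟩
    rcases hz with hz | hz
    · rw [hz, abs_zero]
      exact abs_nonneg _
    · exact hz.le

end Peakon

end

theorem mainTheorem1 (b : ℝ) :
    UnboundedSpectrum.spectrum (Peakon.L b) = {z : ℂ | |z.re| ≤ |5 - b|} ∧
    (b < 5 → {z : ℂ | 0 < |z.re| ∧ |z.re| < 5 - b} ⊆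
      UnboundedSpectrum.pointSpectrum (Peakon.L b)) ∧
    UnboundedSpectrum.residualSpectrum (Peakon.L b) =
      {z : ℂ | 0 < |z.re| ∧ |z.re| < b - 5} ∧
    UnboundedSpectrum.continuousSpectrum (Peakon.L b) =
      {z : ℂ | z.re = 0 ∨ |z.re| = |5 - b|} \ Peakon.embeddedEigenvalues b ∧
    Peakon.embeddedEigenvalues b ⊆ UnboundedSpectrum.pointSpectrum (Peakon.L b) :=
  ⟨Peakon.spectrum_L b, fun _ _ hz => Peakon.mem_pointSpectrum_of_abs_re_lt hz.1 hz.2,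
    Peakon.residualSpectrum_L b, Peakon.continuousSpectrum_L b,
    fun _ hz => Peakon.mem_pointSpectrum_of_sq_eq_neg (Peakon.mem_embeddedEigenvalues_iff.1 hz).2⟩
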